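/- A normal (propositional, finite) logic program $P$ is a finite list of rules $h\leftarrow b_1,\dots,b_p,\mathbf{not}(c_1),\dots,\mathbf{not}(c_q)$; $At(P)$ is the set of atoms occurring in $P$, and $size(P)$ is the total number of occurrences of atoms in $P$. $LM(Q)$ is the least model of a Horn program $Q$. $P_M^h$ is obtained from $P$ by deleting the rules with some $\mathbf{not}(a)$, $a\in M$, in the body, and then all negative literals; $GL(M)=LM(P_M^h)$. The well-founded semantics is $T_{wfs}$, the least fixpoint of $GL^2$ on the subsets of $At(P)$, and $F_{wfs}=At(P)\setminus GL(T_{wfs})$. $P_{F,T}^h$ is obtained from $P$ by deleting all rules with head in $F$, with a positive body atom in $F$, or with some $\mathbf{not}(a)$, $a\in T$, in the body, and then all negative literals. Write $\overline F=At(P)\setminus F$. Algorithm 3, with an operator $\Delta_w$, is $$F:=\emptyset;\ \textbf{repeat}\ T:=true(LM(P\cup\mathbf{not}(F)));\ \Delta F:=\Delta_w(F,P^h_{F,T});\ F:=F\cup\Delta F\ \textbf{until no change in }F;\ \textbf{return }T,F,$$ where in $LM(P\cup\mathbf{not}(F))$ negated literals count as new atoms and $true$ keeps the ordinary atoms. (1)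 Suppose that for all $F\subseteq At(P)$ and all finite Horn programs $Q$ with $At(Q)\subseteq\overline F$ we have (W1) $\Delta_w(F,Q)\subseteq\overline F\setminus LM(Q)$ and (W2) $\Delta_w(F,Q)=\emptyset$ if and only if $\overline F\setminus LM(Q)=\emptyset$. Then Algorithm 3 terminates and returns $T_{wfs}$ and $F_{wfs}$. (2) Procedure $false$ takes a finite set $V$ of atoms and a Horn program $Q$ over $V$ whose rules have at most one body atom. For each $a\in V$ the list $IN(a)$ contains, without repetition, the tails of the rules of $Q$ with head $a$, the tail being the body atom, or a new atom $s$ if the body is empty. The procedure keeps a partition $\mathcal S$ of $V\cup\{s\}$, at first into singletons, and a partial function $pred:\mathcal S\to\mathcal S$, at first nowhere defined. A set $v\in\mathcal S$, $v\ne\{s\}$, is active if $pred(v)$ is undefined. For $k=1,\dots,|V|$ it does the following. First, for every cycle of the graph with edges $(pred(v),v)$ it replaces the members of the cycle by their union, at which $pred$ is undefined, and redirects $pred$ accordingly. Then it lists the active sets of cardinality $k$. For each set $v$ on this list, in turn, it scans the lists $IN(u)$, $u\in v$, each from the place where its last scan ended, until it meets a tail outside $v$; if it meets one, $pred(v)$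 becomes the member of $\mathcal S$ that contains this tail, and otherwise the procedure returns $v$. If no set is returned for any $k\le|V|$, it returns $\emptyset$. The order of all lists is free. Consider Algorithm 3 with $\Delta_w(F,Q)=false(Q)$, where $V=\overline F$. There are a program of a random access machine (with finitely many registers and arrays of natural numbers, the operations copy, constant, $+1$, $-1$, array access and comparison, and unit cost per operation) and a constant $C$ such that, for every normal program $P$ whose rules have at most one positive atom in the body, the machine, given $P$ as a list of numbers, carries out Algorithm 3 with this $\Delta_w$ (it outputs the increments of $T$ and $F$ in every pass of the loop, and marks the beginning and the end of every call of $false$), halts with $T=T_{wfs}$ and $F=F_{wfs}$ stored in its memory, and - its running time is at most $C\,(|At(P)|^2+size(P)+1)$; - each call of $false$ takes at most $C\,|v|\,|\overline F|$ steps if it returns a nonempty set $v$, and at most $C\,(|\overline F|^2+1)$ steps if it returns $\emptyset$, where $F$ is the value before the call; - the time spent outside the calls of $false$ is at most $C\,(size(P)+1)$. -/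

import Mathlib

/-!
# Normal logic programs, the well-founded semantics, the alternating-fixpoint template,
# the top-down procedure for false atoms, and a successor RAM with a step count
-/

namespace WFS

/-! ## Horn programs -/

/-- A Horn rule `head ← body`. -/
structure HornRule (α : Type) where
  head : α
  body : List α

/-- The least model `LM(Q)` of a Horn program (a set of Horn rules). -/
def LM {α : Type} (Q : Set (HornRule α)) : Set α :=
  ⋂₀ {M : Set α | ∀ r ∈ Q, (∀ b ∈ r.body, b ∈ M) → r.head ∈ M}

/-- The atoms occurring in a Horn program. -/
def hornAtoms {α : Type} (Q : Set (HornRule α)) : Set α :=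
  {a | ∃ r ∈ Q, a = r.head ∨ a ∈ r.body}

/-! ## Normal programs -/

/-- A normal rule `head ← pos, not(neg)` over atoms named by natural numbers. -/
structure Rule where
  head : ℕ
  pos : List ℕ
  neg : List ℕ

/-- A finite propositional normal logic program. -/
abbrev Program := List Rule

/-- `At(P)`. -/
def atoms (P : Program) : Set ℕ :=
  {a | ∃ r ∈ P, a = r.head ∨ a ∈ r.pos ∨ a ∈ r.neg}

/-- `size(P)`: the total number of occurrences of atoms in `P`. -/
def size (P : Program) : ℕ :=
  (P.map fun r => 1 + r.pos.length + r.neg.length).sum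

/-- Every rule has at most one positive atom in its body. -/
def InLP1 (P : Program) : Prop := ∀ r ∈ P, r.pos.toFinset.card ≤ 1

/-- Deletion of the negative literals of a rule. -/
def Rule.horn (r : Rule) : HornRule ℕ := ⟨r.head, r.pos⟩

/-- The reduct `P_M^h`. -/
def reduct (P : Program) (M : Set ℕ) : Set (HornRule ℕ) :=
  {h | ∃ r ∈ P, (∀ c ∈ r.neg, c ∉ M) ∧ h = r.horn}

/-- The Gelfond-Lifschitz operator `GL(M) = LM(P_M^h)`. -/
def glOp (P : Program) (M : Set ℕ) : Set ℕ := LM (reduct P M)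

/-- `T` and `F` are the sets of true and false atoms of the well-founded semantics of `P`:
`T` is the least fixpoint of `GL²` on the subsets of `At(P)`, and `F` is the complement of
`GL(T)` in `At(P)`. -/
def IsWellFounded (P : Program) (T F : Set ℕ) : Prop :=
  IsLeast {M | M ⊆ atoms P ∧ glOp P (glOp P M) = M} T ∧ F = atoms P \ glOp P T

/-- `P` as a Horn program in which every literal `not(a)` counts as a new atom `inr a`. -/
def Rule.literals (r : Rule) : HornRule (ℕ ⊕ ℕ) :=
  ⟨Sum.inl r.head, r.pos.map Sum.inl ++ r.neg.map Sum.inr⟩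

/-- `true(LM(P ∪ not(F)))`. -/
def trueLM (P : Program) (F : Set ℕ) : Set ℕ :=
  {a | Sum.inl a ∈ LM ({h | ∃ r ∈ P, h = r.literals} ∪ {h | ∃ a ∈ F, h = ⟨Sum.inr a, []⟩})}

/-- The program `P_{F,T}^h`: drop all rules with head in `F`, with a positive body atom in `F`,
or with a literal `not(a)`, `a ∈ T`, in the body; then drop the negative literals. -/
def restrict (P : Program) (F T : Set ℕ) : Set (HornRule ℕ) :=
  {h | ∃ r ∈ P, r.head ∉ F ∧ (∀ b ∈ r.pos, b ∉ F) ∧ (∀ c ∈ r.neg, c ∉ T) ∧ h = r.horn}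

/-! ## The template -/

/-- What one pass of the loop does: the set `F` before it, and the increments it computes. -/
structure Pass where
  F : Set ℕ
  ΔT : Set ℕ
  ΔF : Set ℕ

/-- `Template P Δ T F passes T' F'`: the loop
`repeat T := true(LM(P ∪ not(F))); ΔF := Δ(F, P_{F,T}^h); F := F ∪ ΔF until no change in F`,
entered with the values `T` and `F`, performs the listed passes and returns `T'` and `F'`.
Here `Δ F Q D` says that `D` is a possible value of `Δ(F, Q)`. -/
inductive Template (P : Program) (Δ : Set ℕ → Set (HornRule ℕ) → Set ℕ → Prop) :
    Set ℕ → Set ℕ → List Pass → Set ℕ → Set ℕ → Prop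
  | last {T F D : Set ℕ} :
      Δ F (restrict P F (trueLM P F)) D → F ∪ D = F →
      Template P Δ T F [⟨F, trueLM P F \ T, D⟩] (trueLM P F) (F ∪ D)
  | more {T F D T' F' : Set ℕ} {passes : List Pass} :
      Δ F (restrict P F (trueLM P F)) D → F ∪ D ≠ F →
      Template P Δ (trueLM P F) (F ∪ D) passes T' F' →
      Template P Δ T F (⟨F, trueLM P F \ T, D⟩ :: passes) T' F'

/-- The conditions on `Δ_w`, for `F ⊆ At(P)` and finite Horn programs `Q` with
`At(Q) ⊆ At(P) \ F`: (W1) `Δ_w(F,Q) ⊆ (At(P) \ F) \ LM(Q)`, and (W2) one of the two sets is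
empty if and only if the other is. -/
def Admissible (P : Program) (Δ : Set ℕ → Set (HornRule ℕ) → Set ℕ) : Prop :=
  ∀ F Q, F ⊆ atoms P → Q.Finite → hornAtoms Q ⊆ atoms P \ F →
    Δ F Q ⊆ (atoms P \ F) \ LM Q ∧ (Δ F Q = ∅ ↔ (atoms P \ F) \ LM Q = ∅)

/-! ## The procedure for false atoms

The extra atom `s` is `none`, an atom `a` is `some a`. The vertices of the graph are sets of such
elements: the vertex `{s}` and the potentially false sets. -/

/-- A vertex of the graph. -/
abbrev Vertex := Set (Option ℕ)

/-- The vertex `{s}`. -/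
def source : Vertex := {none}

/-- The partial function `pred`, which gives the edges of the graph; `none` is `undefined`. -/
abbrev Pred := Vertex → Option Vertex

/-- For every atom `u`, the part of the list `IN(u)` after the pointer `w(u)`. -/
abbrev Rest := ℕ → List (Option ℕ)

/-- `IN(a)` lists, without repetition, the tails of the rules of `Q` with head `a`: the unique
body atom if there is one, and `s` for a rule with empty body. -/
def IsIN (Q : Set (HornRule ℕ)) (IN : Rest) : Prop :=
  ∀ a, (IN a).Nodup ∧ ∀ t, t ∈ IN a ↔ ∃ r ∈ Q, r.head = a ∧ r.body.head? = t

/-- There is a nonempty path along `pred` from `v` to `z`. -/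
def Leads (pred : Pred) : Vertex → Vertex → Prop :=
  Relation.TransGen fun v z => pred v = some z

open Classical in
/-- The vertex into which `cycle` puts `v`: the union of the cycle through `v`, if `v` lies on
one, and `v` itself otherwise. -/
noncomputable def glue (S : Set Vertex) (pred : Pred) (v : Vertex) : Vertex :=
  if Leads pred v v then ⋃₀ {z | z ∈ S ∧ Leads pred v z ∧ Leads pred z v} else v

/-- The vertex set after `cycle`. -/
def cycleS (S : Set Vertex) (pred : Pred) : Set Vertex := glue S pred '' S

open Classical in
/-- The function `pred` after `cycle`: undefined at the glued vertices. -/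
noncomputable def cyclePred (S : Set Vertex) (pred : Pred) : Pred := fun v =>
  if v ∈ S ∧ ¬ Leads pred v v then (pred v).map (glue S pred) else none

/-- `L` lists the active potentially false sets of cardinality `k`. -/
def IsActiveList (S : Set Vertex) (pred : Pred) (k : ℕ) (L : List Vertex) : Prop :=
  L.Nodup ∧ ∀ v, v ∈ L ↔ v ∈ S ∧ v ≠ source ∧ pred v = none ∧ v.ncard = k

/-- `us` lists the atoms of `v`. -/
def IsListing (v : Vertex) (us : List ℕ) : Prop :=
  us.Nodup ∧ ∀ u, u ∈ us ↔ some u ∈ v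

open Classical in
/-- For the atoms `u` of `v` in turn, advance in `IN(u)` until a tail outside `v` is met. The
result is this tail (`none` if there is none), and the new positions. -/
noncomputable def scan (v : Vertex) : List ℕ → Rest → Option (Option ℕ) × Rest
  | [], w => (none, w)
  | u :: us, w =>
    match (w u).dropWhile fun t => decide (t ∈ v) with
    | [] => scan v us (Function.update w u [])
    | t :: ts => (some t, Function.update w u ts)

open Classical in
/-- The `for` loop over the list `L`. The outcome is `Sum.inl v` if the procedure returns `v`, and
`Sum.inr (pred', w')` if the loop is completed with these values. -/
inductive ForLoop (S : Set Vertex) :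
    List Vertex → Pred → Rest → Vertex ⊕ (Pred × Rest) → Prop
  | done {pred w} : ForLoop S [] pred w (Sum.inr (pred, w))
  | success {v z : Vertex} {L pred w us t w' o} :
      IsListing v us → scan v us w = (some t, w') → z ∈ S → t ∈ z →
      ForLoop S L (Function.update pred v (some z)) w' o →
      ForLoop S (v :: L) pred w o
  | failure {v : Vertex} {L pred w us w'} :
      IsListing v us → scan v us w = (none, w') →
      ForLoop S (v :: L) pred w (Sum.inl v)

/-- The main `while` loop, for `n` atoms: entered with the given values of `size`, `S`, `pred` and
`w`, it makes the procedure return the last argument. -/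
inductive MainLoop (n : ℕ) : ℕ → Set Vertex → Pred → Rest → Vertex → Prop
  | finish {k S pred w} : n ≤ k → MainLoop n k S pred w ∅
  | found {k S pred w L v} : k < n →
      IsActiveList (cycleS S pred) (cyclePred S pred) (k + 1) L →
      ForLoop (cycleS S pred) L (cyclePred S pred) w (Sum.inl v) →
      MainLoop n k S pred w v
  | again {k S pred w L pred' w' v} : k < n →
      IsActiveList (cycleS S pred) (cyclePred S pred) (k + 1) L →
      ForLoop (cycleS S pred) L (cyclePred S pred) w (Sum.inr (pred', w')) →
      MainLoop n (k + 1) (cycleS S pred) pred' w' v →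
      MainLoop n k S pred w v

/-- The procedure `false`, run on the Horn program `Q` over the set `V` of atoms, with some order
of its lists, returns `D`. -/
def FalseReturns (V : Set ℕ) (Q : Set (HornRule ℕ)) (D : Set ℕ) : Prop :=
  ∃ (IN : Rest) (v : Vertex), IsIN Q IN ∧
    MainLoop V.ncard 0 ({v | ∃ x ∈ V, v = {some x}} ∪ {source}) (fun _ => none) IN v ∧
    D = {a | some a ∈ v}

/-- The operator `Δ_w(F,Q) = false(Q)`, where the alphabet of `Q` is `At(P) \ F`. -/
def falseOp (P : Program) (F : Set ℕ) (Q : Set (HornRule ℕ)) (D : Set ℕ) : Prop :=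
  FalseReturns (atoms P \ F) Q D

/-! ## A successor RAM

Registers and arrays hold natural numbers; the only arithmetic is `+ 1` and `- 1`. Every
instruction and every evaluation of a condition costs one step. The output is write-only. -/

/-- Output items: a number, or a mark that carries the current step count. Both have a label. -/
inductive Event where
  | value (label a : ℕ)
  | mark (label time : ℕ)

/-- A machine state. The step count `time` cannot be read by programs. -/
structure State where
  reg : ℕ → ℕ
  arr : ℕ → ℕ → ℕ
  out : List Event
  time : ℕ

/-- Count one step. -/
def State.tick (σ : State) : State := { σ with time := σ.time + 1 }

/-- Elementary instructions; `x`, `y` are registers and `m` is an array. -/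
inductive Instr where
  | const (x k : ℕ)
  | copy (x y : ℕ)
  | succ (x y : ℕ)
  | pred (x y : ℕ)
  | load (x m y : ℕ)
  | store (m x y : ℕ)
  | emit (label x : ℕ)
  | mark (label : ℕ)

/-- The effect of an instruction, apart from its cost. -/
def Instr.effect : Instr → State → State
  | const x k, σ => { σ with reg := Function.update σ.reg x k }
  | copy x y, σ => { σ with reg := Function.update σ.reg x (σ.reg y) }
  | succ x y, σ => { σ with reg := Function.update σ.reg x (σ.reg y + 1) }
  | pred x y, σ => { σ with reg := Function.update σ.reg x (σ.reg y - 1) }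
  | load x m y, σ => { σ with reg := Function.update σ.reg x (σ.arr m (σ.reg y)) }
  | store m x y, σ =>
    { σ with arr := Function.update σ.arr m (Function.update (σ.arr m) (σ.reg x) (σ.reg y)) }
  | emit label x, σ => { σ with out := σ.out ++ [Event.value label (σ.reg x)] }
  | mark label, σ => { σ with out := σ.out ++ [Event.mark label σ.time] }

/-- Conditions on two registers. -/
inductive Cond where
  | eq (x y : ℕ)
  | lt (x y : ℕ)

/-- Truth of a condition. -/
def Cond.holds : Cond → State → Prop
  | eq x y, σ => σ.reg x = σ.reg y
  | lt x y, σ => σ.reg x < σ.reg y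

/-- Machine programs. -/
inductive Code where
  | instr (i : Instr)
  | seq (c d : Code)
  | cond (b : Cond) (c d : Code)
  | loop (b : Cond) (c : Code)

/-- `Exec c σ σ'`: started in `σ`, the program `c` terminates, in `σ'`. -/
inductive Exec : Code → State → State → Prop
  | instr {i σ} : Exec (Code.instr i) σ (i.effect σ).tick
  | seq {c d σ σ₁ σ₂} : Exec c σ σ₁ → Exec d σ₁ σ₂ → Exec (Code.seq c d) σ σ₂
  | condTrue {b c d σ σ'} : b.holds σ → Exec c σ.tick σ' → Exec (Code.cond b c d) σ σ'
  | condFalse {b c d σ σ'} : ¬ b.holds σ → Exec d σ.tick σ' → Exec (Code.cond b c d) σ σ'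
  | loopFalse {b c σ} : ¬ b.holds σ → Exec (Code.loop b c) σ σ.tick
  | loopTrue {b c σ σ₁ σ₂} : b.holds σ → Exec c σ.tick σ₁ → Exec (Code.loop b c) σ₁ σ₂ →
      Exec (Code.loop b c) σ σ₂

/-- The input word for `P`: the number of rules, then for each rule its head, and its positive and
its negative body atoms, each preceded by their number. -/
def encode (P : Program) : List ℕ :=
  P.length :: P.flatMap fun r =>
    r.head :: r.pos.length :: (r.pos ++ r.neg.length :: r.neg)

/-- The state at the start: the input word is in array `0`, and everything else is zero. -/
def startState (P : Program) : State where
  reg := fun _ => 0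
  arr := fun m i => if m = 0 then (encode P).getD i 0 else 0
  out := []
  time := 0

/-! ## Implementations of the template -/

/-- What a machine program writes in one pass: the atoms of `ΔT`, a mark at the call of `false`,
the atoms of `ΔF`, and a mark at the return from `false`. -/
structure PassLog where
  trueAtoms : List ℕ
  callTime : ℕ
  falseAtoms : List ℕ
  duration : ℕ

/-- The corresponding output. -/
def PassLog.events (l : PassLog) : List Event :=
  l.trueAtoms.map (Event.value 0) ++ Event.mark 0 l.callTime ::
    (l.falseAtoms.map (Event.value 1) ++ [Event.mark 1 (l.callTime + l.duration)])

/-- The log reports the increments of the given pass. -/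
def PassLog.Reports (l : PassLog) (p : Pass) : Prop :=
  l.trueAtoms.Nodup ∧ {a | a ∈ l.trueAtoms} = p.ΔT ∧
  l.falseAtoms.Nodup ∧ {a | a ∈ l.falseAtoms} = p.ΔF

/-- The call of `false` in this pass, over the alphabet `At(P) \ F`, takes at most
`C * |ΔF| * |At(P) \ F|` steps if it returns a nonempty set, and at most
`C * (|At(P) \ F| ^ 2 + 1)` steps otherwise. -/
def PassLog.CallBound (P : Program) (C : ℕ) (l : PassLog) (p : Pass) : Prop :=
  (p.ΔF ≠ ∅ → l.duration ≤ C * (p.ΔF.ncard * (atoms P \ p.F).ncard)) ∧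
  (p.ΔF = ∅ → l.duration ≤ C * ((atoms P \ p.F).ncard ^ 2 + 1))

/-- Started on `P`, the machine program `code` terminates in the state `σ`; it carries out the
template with `Δ_w = false`, through the passes `passes`, which `logs` report, and it leaves the
returned sets `T` and `F` as characteristic functions in the arrays `1` and `2`. -/
def RunsTemplate (code : Code) (P : Program) (σ : State) (passes : List Pass)
    (logs : List PassLog) (T F : Set ℕ) : Prop :=
  Exec code (startState P) σ ∧
  Template P (falseOp P) ∅ ∅ passes T F ∧
  List.Forall₂ PassLog.Reports logs passes ∧
  σ.out = logs.flatMap PassLog.events ∧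
  σ.arr 1 = Set.indicator T 1 ∧
  σ.arr 2 = Set.indicator F 1

end WFS

/-! Correctness of the template. Write T_F for `trueLM P F`; it equals GL(At(P) \ F) (`trueLM_eq`).
The loop preserves `TemplateInv`: F is disjoint from GL(T_F), and T_F lies below every fixpoint of
GL². For such F one has GL(T_F) ⊆ LM(P^h_{F,T}), so new false atoms taken outside this least model
also avoid GL(T_F), and antitonicity of GL carries both clauses to the larger F. When no atom is
left outside the least model, GL(T_F) = At(P) \ F; then GL²(T_F) = T_F, and T_F is the least
fixpoint.

Implementation. The machine does not simulate `false`. Call a set U of atoms closed if every rule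
with head in U has its tail in U. The procedure can return any nonempty closed set of least
cardinality, and it can return ∅ if no nonempty closed set exists (`falseReturns_of_minimal`): in
stage k a closed set of k elements is a member of the partition, as all smaller members have
predecessors and the contracted graph is acyclic, and the free order of the lists lets it be scanned
before the others. So any method of finding a smallest closed set implements the template.

The method is a path-based search for strongly connected components in the graph of tails. Edges
have distinct tails, hence a member of a closed set with at most K elements has degree at most K. A
phase with bound K ignores vertices of larger degree and costs O(nK), where n is the number of atoms
not yet false. When a component without leaving edges is met, or an edge into a finished vertex, the
whole path is abandoned: all its vertices lead there, so they lie in no smaller closed set. The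
bound K is doubled until the best set found has at most K elements or K ≥ n; the geometric sum gives
O(n|D|) if D ≠ ∅ is returned, and O(n² + 1) otherwise (`wp_findClosed`). The sets returned are
disjoint, so all calls together take O(n² + 1) steps, n now being the number of atoms at the start.

Outside the calls, truth values are propagated with a counter of unsatisfied literals for each rule.
An occurrence is told of each truth value of its atom at most once, so all propagations together are
linear in size(P) (`wp_propagate`). The lists of tails of the remaining program are kept up to date
by deletions in constant time (`wp_killRule`). The step count belongs to the state, so every time
bound is part of a loop invariant, usually in the form of a potential. -/

set_option linter.unusedSimpArgs false

namespace WFS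

/-! ## Least models and the operator `GL` -/

theorem LM_model {α : Type} {Q : Set (HornRule α)} {r : HornRule α} (hr : r ∈ Q)
    (hb : ∀ b ∈ r.body, b ∈ LM Q) : r.head ∈ LM Q := by
  intro M hM
  exact hM r hr fun b hbb => hb b hbb M hM

theorem LM_subset {α : Type} {Q : Set (HornRule α)} {M : Set α}
    (h : ∀ r ∈ Q, (∀ b ∈ r.body, b ∈ M) → r.head ∈ M) : LM Q ⊆ M :=
  fun _ ha => ha M h

theorem LM_mono {α : Type} {Q R : Set (HornRule α)} (h : Q ⊆ R) : LM Q ⊆ LM R :=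
  LM_subset fun _ hr hb => LM_model (h hr) hb

theorem reduct_anti (P : Program) {M N : Set ℕ} (h : M ⊆ N) : reduct P N ⊆ reduct P M := by
  rintro _ ⟨r, hr, hn, rfl⟩
  exact ⟨r, hr, fun c hc hm => hn c hc (h hm), rfl⟩

theorem glOp_anti (P : Program) {M N : Set ℕ} (h : M ⊆ N) : glOp P N ⊆ glOp P M :=
  LM_mono (reduct_anti P h)

theorem glOp_subset (P : Program) (M : Set ℕ) : glOp P M ⊆ atoms P := by
  apply LM_subset
  rintro _ ⟨r, hr, -, rfl⟩ -
  exact ⟨r, hr, Or.inl rfl⟩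

theorem atoms_finite (P : Program) : (atoms P).Finite := by
  have : atoms P ⊆ ⋃ r ∈ {r | r ∈ P}, {a | a = r.head ∨ a ∈ r.pos ∨ a ∈ r.neg} := by
    rintro a ⟨r, hr, ha⟩
    exact Set.mem_biUnion hr ha
  refine Set.Finite.subset (Set.Finite.biUnion (List.finite_toSet P) fun r _ => ?_) this
  exact (Set.finite_singleton r.head).union
    ((List.finite_toSet r.pos).union (List.finite_toSet r.neg))

/-- A new atom `inr c` can only come from a fact `c ∈ F`. Since `c` occurs in `P`, this means that
`c` is not in `atoms P \ F`, which is the condition for a rule to survive the reduct. -/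
theorem trueLM_eq (P : Program) (F : Set ℕ) : trueLM P F = glOp P (atoms P \ F) := by
  apply Set.Subset.antisymm
  · intro a ha
    have := ha {x | (∀ a, x = Sum.inl a → a ∈ glOp P (atoms P \ F)) ∧
      ∀ a, x = Sum.inr a → a ∈ F} ?_
    · exact this.1 a rfl
    · rintro _ (⟨r, hr, rfl⟩ | ⟨a, ha, rfl⟩) hb
      · refine ⟨fun b hbb => ?_, fun b hbb => by cases hbb⟩
        cases hbb
        refine LM_model (Q := reduct P (atoms P \ F)) (r := r.horn) ⟨r, hr, ?_, rfl⟩ ?_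
        · intro c hc hcF
          exact hcF.2 ((hb (Sum.inr c) (by simp [Rule.literals, hc])).2 c rfl)
        · intro b hbr
          exact (hb (Sum.inl b) (by
            have : b ∈ r.pos := hbr
            simp [Rule.literals, this])).1 b rfl
      · exact ⟨fun b hbb => (by cases hbb), fun b hbb => by cases hbb; exact ha⟩
  · apply LM_subset
    rintro _ ⟨r, hr, hn, rfl⟩ hb
    refine LM_model (r := r.literals) (Or.inl ⟨r, hr, rfl⟩) ?_
    intro x hx
    simp only [Rule.literals, List.mem_append, List.mem_map] at hx
    rcases hx with ⟨b, hbp, rfl⟩ | ⟨c, hc, rfl⟩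
    · exact hb b hbp
    · have hcF : c ∈ F := by
        by_contra h
        exact hn c hc ⟨⟨r, hr, Or.inr (Or.inr hc)⟩, h⟩
      exact LM_model (r := ⟨Sum.inr c, []⟩) (Or.inr ⟨c, hcF, rfl⟩) (by simp)

theorem trueLM_mono (P : Program) {F G : Set ℕ} (h : F ⊆ G) : trueLM P F ⊆ trueLM P G := by
  rw [trueLM_eq, trueLM_eq]
  exact glOp_anti P (Set.sdiff_subset_sdiff_right h)

theorem hornAtoms_restrict (P : Program) (F T : Set ℕ) :
    hornAtoms (restrict P F T) ⊆ atoms P \ F := by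
  rintro a ⟨_, ⟨r, hr, hh, hp, -, rfl⟩, ha⟩
  rcases ha with rfl | ha
  · exact ⟨⟨r, hr, Or.inl rfl⟩, hh⟩
  · exact ⟨⟨r, hr, Or.inr (Or.inl ha)⟩, hp a ha⟩

theorem restrict_finite (P : Program) (F T : Set ℕ) : (restrict P F T).Finite := by
  refine Set.Finite.subset ((List.finite_toSet P).image Rule.horn) ?_
  rintro _ ⟨r, hr, -, -, -, rfl⟩
  exact ⟨r, hr, rfl⟩

/-- The possible values of `Δ` satisfy the two conditions at the programs met by the template. -/
def AdmissibleRel (P : Program) (Δ : Set ℕ → Set (HornRule ℕ) → Set ℕ → Prop) : Prop :=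
  ∀ F D, F ⊆ atoms P → Δ F (restrict P F (trueLM P F)) D →
    D ⊆ (atoms P \ F) \ LM (restrict P F (trueLM P F)) ∧
    (D = ∅ → (atoms P \ F) \ LM (restrict P F (trueLM P F)) = ∅)

/-- What is preserved by the passes of the template. -/
def TemplateInv (P : Program) (F : Set ℕ) : Prop :=
  F ⊆ atoms P ∧ (∀ a ∈ F, a ∉ glOp P (trueLM P F)) ∧
    ∀ M, M ⊆ atoms P → glOp P (glOp P M) = M → trueLM P F ⊆ M

/-- The rules that `restrict` drops beyond the reduct contain an atom of `F` as head or positive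
body atom. As `F` avoids GL(T), no such rule fires in the computation of GL(T). -/
theorem TemplateInv.glOp_subset_LM {P : Program} {F : Set ℕ} (h : TemplateInv P F) :
    glOp P (trueLM P F) ⊆ LM (restrict P F (trueLM P F)) := by
  -- The induction must know that body atoms lie in GL(T), to see that they are not in `F`; hence
  -- the intersection.
  have : glOp P (trueLM P F) ⊆
      LM (restrict P F (trueLM P F)) ∩ glOp P (trueLM P F) := by
    apply LM_subset
    rintro _ ⟨r, hr, hn, rfl⟩ hb
    have hh : r.horn.head ∈ glOp P (trueLM P F) :=
      LM_model (r := r.horn) ⟨r, hr, hn, rfl⟩ fun b hbr => (hb b hbr).2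
    refine ⟨LM_model (r := r.horn) ⟨r, hr, fun hF => h.2.1 _ hF hh,
      fun b hbr hF => h.2.1 _ hF (hb b hbr).2, hn, rfl⟩ fun b hbr => (hb b hbr).1, hh⟩
  exact fun a ha => (this ha).1

/-- If `F` misses GL(M), then GL(M) ⊆ At(P) \ F, and antitonicity gives GL(At(P) \ F) ⊆ GL(GL(M)) =
M. -/
theorem trueLM_subset_fixpoint {P : Program} {F M : Set ℕ}
    (hfix : glOp P (glOp P M) = M) (h : ∀ a ∈ F, a ∉ glOp P M) : trueLM P F ⊆ M := by
  rw [trueLM_eq, ← hfix]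
  exact glOp_anti P fun a ha => ⟨glOp_subset P M ha, fun hF => h a hF ha⟩

theorem TemplateInv.empty (P : Program) : TemplateInv P ∅ :=
  ⟨Set.empty_subset _, by simp, fun _ _ hfix => trueLM_subset_fixpoint hfix (by simp)⟩

/-- `F ∪ D` avoids GL at the old true set. Both the new true set and every fixpoint `M` contain the
old true set, so GL of either is smaller and is avoided as well. -/
theorem TemplateInv.step {P : Program} {F D : Set ℕ} (h : TemplateInv P F)
    (hD : D ⊆ (atoms P \ F) \ LM (restrict P F (trueLM P F))) : TemplateInv P (F ∪ D) := by
  have hdis : ∀ a ∈ F ∪ D, a ∉ glOp P (trueLM P F) := by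
    rintro a (ha | ha) hg
    · exact h.2.1 a ha hg
    · exact (hD ha).2 (h.glOp_subset_LM hg)
  have hT : trueLM P F ⊆ trueLM P (F ∪ D) := trueLM_mono P Set.subset_union_left
  refine ⟨Set.union_subset h.1 fun a ha => (hD ha).1.1, ?_, ?_⟩
  · exact fun a ha hg => hdis a ha (glOp_anti P hT hg)
  · intro M hM hfix
    exact trueLM_subset_fixpoint hfix fun a ha hg =>
      hdis a ha (glOp_anti P (h.2.2 M hM hfix) hg)

/-- The chain At(P) \ F ⊆ LM(restricted program) ⊆ GL(T) ⊆ At(P) \ F collapses, so GL(GL(T)) =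
GL(At(P) \ F) = T. -/
theorem TemplateInv.wellFounded {P : Program} {F : Set ℕ} (h : TemplateInv P F)
    (he : (atoms P \ F) \ LM (restrict P F (trueLM P F)) = ∅) :
    IsWellFounded P (trueLM P F) F := by
  have h1 : glOp P (trueLM P F) = atoms P \ F := by
    apply Set.Subset.antisymm
    · exact fun a ha => ⟨glOp_subset P _ ha, fun hF => h.2.1 a hF ha⟩
    · refine (Set.sdiff_eq_empty.mp he).trans ?_
      apply LM_mono
      rintro _ ⟨r, hr, -, -, hn, rfl⟩
      exact ⟨r, hr, hn, rfl⟩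
  refine ⟨⟨⟨?_, ?_⟩, fun M hM => h.2.2 M hM.1 hM.2⟩, ?_⟩
  · rw [trueLM_eq]; exact glOp_subset P _
  · rw [h1, ← trueLM_eq]
  · rw [h1, Set.sdiff_sdiff_cancel_left h.1]

theorem Template.wellFounded {P : Program} {Δ : Set ℕ → Set (HornRule ℕ) → Set ℕ → Prop}
    (hΔ : AdmissibleRel P Δ) {T F T' F' : Set ℕ} {passes : List Pass}
    (h : Template P Δ T F passes T' F') (hI : TemplateInv P F) : IsWellFounded P T' F' := by
  induction h with
  | @last T F D hD hF =>
    obtain ⟨h1, h2⟩ := hΔ F D hI.1 hD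
    -- `D` lies outside `F`, so a pass that does not change `F` had an empty increment.
    have hDe : D = ∅ := by
      apply Set.eq_empty_of_forall_notMem
      intro a ha
      exact (h1 ha).1.2 (hF ▸ Or.inr ha)
    rw [hF]
    exact hI.wellFounded (h2 hDe)
  | more hD _ _ ih => exact ih (hI.step (hΔ _ _ hI.1 hD).1)

/-- Every pass but the last makes `atoms P \ F` smaller, so its cardinality bounds the number of
passes. -/
theorem Template.exists_run {P : Program} {Δ : Set ℕ → Set (HornRule ℕ) → Set ℕ}
    (hΔ : ∀ F, F ⊆ atoms P → Δ F (restrict P F (trueLM P F)) ⊆ atoms P \ F)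
    (n : ℕ) (T F : Set ℕ) (hF : F ⊆ atoms P) (hn : (atoms P \ F).ncard ≤ n) :
    ∃ passes T' F', Template P (fun F Q D => D = Δ F Q) T F passes T' F' := by
  induction n generalizing T F with
  | zero =>
    have he : atoms P \ F = ∅ :=
      (Set.ncard_eq_zero ((atoms_finite P).sdiff)).mp (Nat.le_zero.mp hn)
    have := hΔ F hF
    rw [he, Set.subset_empty_iff] at this
    exact ⟨_, _, _, Template.last rfl (by rw [this, Set.union_empty])⟩
  | succ n ih =>
    by_cases h : F ∪ Δ F (restrict P F (trueLM P F)) = F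
    · exact ⟨_, _, _, Template.last rfl h⟩
    · have hsub := hΔ F hF
      have hlt : (atoms P \ (F ∪ Δ F (restrict P F (trueLM P F)))).ncard <
          (atoms P \ F).ncard := by
        apply Set.ncard_lt_ncard _ ((atoms_finite P).sdiff)
        refine ⟨Set.sdiff_subset_sdiff_right Set.subset_union_left, fun hss => h ?_⟩
        apply Set.union_eq_left.mpr
        intro a ha
        exact absurd (Or.inr ha) (hss (hsub ha)).2
      obtain ⟨passes, T', F', ht⟩ := ih (trueLM P F) (F ∪ Δ F (restrict P F (trueLM P F)))
        (Set.union_subset hF (hsub.trans Set.sdiff_subset)) (by omega)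
      exact ⟨_, _, _, Template.more rfl h ht⟩

theorem template_correct (P : Program) (Δ : Set ℕ → Set (HornRule ℕ) → Set ℕ)
    (h : Admissible P Δ) :
    (∃ passes T F, Template P (fun F Q D => D = Δ F Q) ∅ ∅ passes T F) ∧
      ∀ passes T F, Template P (fun F Q D => D = Δ F Q) ∅ ∅ passes T F →
        IsWellFounded P T F := by
  have hP := fun F hF => h F (restrict P F (trueLM P F)) hF (restrict_finite _ _ _)
    (hornAtoms_restrict _ _ _)
  constructor
  · exact Template.exists_run (fun F hF => (hP F hF).1.trans Set.sdiff_subset) _ ∅ ∅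
      (Set.empty_subset _) le_rfl
  · intro passes T F ht
    refine ht.wellFounded (fun F D hF hD => ?_) (TemplateInv.empty P)
    subst hD
    exact ⟨(hP F hF).1, (hP F hF).2.mp⟩

/-! ## The procedure `false` returns any nonempty closed set of least cardinality -/

/-- `U` is closed: every rule with head in `U` has its tail in `U`. -/
def ClosedSet (V : Set ℕ) (Q : Set (HornRule ℕ)) (U : Set ℕ) : Prop :=
  U ⊆ V ∧ ∀ r ∈ Q, r.head ∈ U → ∃ b ∈ U, r.body.head? = some b

/-- Closed sets as vertices, in terms of the lists of tails. -/
def ClosedVertex (V : Set ℕ) (IN : Rest) (W : Vertex) : Prop :=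
  (∀ t ∈ W, ∃ x ∈ V, t = some x) ∧ ∀ x, some x ∈ W → ∀ t ∈ IN x, t ∈ W

/-- What holds of the variables of the procedure when all sets of cardinality at most `k` have a
predecessor and all cycles contain a set of cardinality at least `l`. -/
structure GraphInv (V : Set ℕ) (IN : Rest) (k l : ℕ) (S : Set Vertex) (pred : Pred)
    (w : Rest) : Prop where
  source_mem : source ∈ S
  nonempty : ∀ v ∈ S, v.Nonempty
  atoms : ∀ v ∈ S, v ≠ source → ∀ t ∈ v, ∃ x ∈ V, t = some x
  disj : ∀ u ∈ S, ∀ v ∈ S, ∀ t, t ∈ u → t ∈ v → u = v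
  cover : ∀ x ∈ V, ∃ v ∈ S, some x ∈ v
  conn : ∀ v ∈ S, ∀ W, ClosedVertex V IN W → (∃ t ∈ v, t ∈ W) → v ⊆ W
  pred_mem : ∀ v z, pred v = some z → v ∈ S ∧ z ∈ S ∧ v ≠ source ∧ z ≠ v ∧
    ∀ W, ClosedVertex V IN W → v ⊆ W → z ⊆ W
  passed : ∀ v ∈ S, v ≠ source → ∀ x, some x ∈ v → ∀ t ∈ IN x,
    t ∈ w x ∨ t ∈ v ∨ ∃ z, pred v = some z ∧ t ∈ z
  small : ∀ v ∈ S, v ≠ source → v.ncard ≤ k → pred v ≠ none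
  cyc : ∀ v, Leads pred v v → ∃ z, Leads pred v z ∧ Leads pred z v ∧ l ≤ z.ncard
  rest : ∀ x, ∀ t ∈ w x, t ∈ IN x

/-! ### Contraction of the cycles of `pred` -/

section Cycle

variable {V : Set ℕ} {IN : Rest} {k l : ℕ} {S : Set Vertex} {pred : Pred} {w : Rest}

theorem Leads.pred_ne_none {v z : Vertex} (h : Leads pred v z) : ∃ y, pred v = some y := by
  induction h with
  | single h => exact ⟨_, h⟩
  | tail _ _ ih => exact ih

/-- `v` and `z` are equal or lie on the same cycle. -/
def SameCycle (pred : Pred) (v z : Vertex) : Prop := z = v ∨ (Leads pred v z ∧ Leads pred z v)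

theorem SameCycle.symm {v z : Vertex} (h : SameCycle pred v z) : SameCycle pred z v := by
  rcases h with h | h
  · exact Or.inl h.symm
  · exact Or.inr h.symm

theorem SameCycle.trans {v y z : Vertex} (h : SameCycle pred v y) (h' : SameCycle pred y z) :
    SameCycle pred v z := by
  rcases h with rfl | h
  · exact h'
  · rcases h' with rfl | h'
    · exact Or.inr h
    · exact Or.inr ⟨h.1.trans h'.1, h'.2.trans h.2⟩

/-- A uniform description, on and off cycles: `glue` forms the union of the `SameCycle` class. -/
theorem mem_glue {v : Vertex} (hv : v ∈ S) {t : Option ℕ} :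
    t ∈ glue S pred v ↔ ∃ z ∈ S, t ∈ z ∧ SameCycle pred v z := by
  unfold glue
  split_ifs with h
  · constructor
    · rintro ⟨z, ⟨hz, h1, h2⟩, ht⟩
      exact ⟨z, hz, ht, Or.inr ⟨h1, h2⟩⟩
    · rintro ⟨z, hz, ht, rfl | ⟨h1, h2⟩⟩
      · exact ⟨z, ⟨hz, h, h⟩, ht⟩
      · exact ⟨z, ⟨hz, h1, h2⟩, ht⟩
  · constructor
    · exact fun ht => ⟨v, hv, ht, Or.inl rfl⟩
    · rintro ⟨z, hz, ht, rfl | ⟨h1, h2⟩⟩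
      · exact ht
      · exact absurd (h1.trans h2) h

theorem subset_glue {v : Vertex} (hv : v ∈ S) : v ⊆ glue S pred v :=
  fun _ ht => (mem_glue hv).mpr ⟨v, hv, ht, Or.inl rfl⟩

theorem glue_of_not_leads {v : Vertex} (h : ¬ Leads pred v v) : glue S pred v = v := if_neg h

theorem glue_eq {v z : Vertex} (hv : v ∈ S) (hz : z ∈ S) (h : SameCycle pred v z) :
    glue S pred v = glue S pred z := by
  ext t
  rw [mem_glue hv, mem_glue hz]
  exact ⟨fun ⟨y, hy, ht, hh⟩ => ⟨y, hy, ht, h.symm.trans hh⟩,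
    fun ⟨y, hy, ht, hh⟩ => ⟨y, hy, ht, h.trans hh⟩⟩

theorem GraphInv.sameCycle_of_mem (h : GraphInv V IN k l S pred w) {v z : Vertex} (hv : v ∈ S)
    (hz : z ∈ S) {t : Option ℕ} (h1 : t ∈ glue S pred v) (h2 : t ∈ glue S pred z) :
    SameCycle pred v z := by
  obtain ⟨v', hv', htv, e⟩ := (mem_glue hv).mp h1
  obtain ⟨z', hz', htz, e'⟩ := (mem_glue hz).mp h2
  obtain rfl := h.disj _ hv' _ hz' t htv htz
  exact e.trans e'.symm

theorem GraphInv.sameCycle_of_glue_eq (h : GraphInv V IN k l S pred w) {v z : Vertex}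
    (hv : v ∈ S) (hz : z ∈ S) (he : glue S pred v = glue S pred z) : SameCycle pred v z := by
  obtain ⟨t, ht⟩ := h.nonempty v hv
  have := subset_glue (pred := pred) hv ht
  exact h.sameCycle_of_mem hv hz this (he ▸ this)

theorem GraphInv.not_leads_source (h : GraphInv V IN k l S pred w) (z : Vertex) :
    ¬ Leads pred source z := by
  intro hl
  obtain ⟨y, hy⟩ := hl.pred_ne_none
  exact (h.pred_mem _ _ hy).2.2.1 rfl

theorem GraphInv.leads_subset (h : GraphInv V IN k l S pred w) {v z : Vertex}
    (hl : Leads pred v z) {W : Vertex} (hW : ClosedVertex V IN W) (hv : v ⊆ W) : z ⊆ W := by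
  induction hl with
  | single e => exact (h.pred_mem _ _ e).2.2.2.2 W hW hv
  | tail _ e ih => exact (h.pred_mem _ _ e).2.2.2.2 W hW ih

/-- A closed set that meets one member of the cycle contains it by `conn`, and then contains the
other members along `pred`. -/
theorem GraphInv.glue_subset (h : GraphInv V IN k l S pred w) {v : Vertex} (hv : v ∈ S)
    {W : Vertex} (hW : ClosedVertex V IN W) (hm : ∃ t ∈ glue S pred v, t ∈ W) :
    glue S pred v ⊆ W := by
  obtain ⟨t, ht, htW⟩ := hm
  obtain ⟨y, hy, hty, e⟩ := (mem_glue hv).mp ht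
  have hyW := h.conn y hy W hW ⟨t, hty, htW⟩
  intro t' ht'
  obtain ⟨z, hz, htz, e'⟩ := (mem_glue hv).mp ht'
  rcases e.symm.trans e' with rfl | ⟨hl, -⟩
  · exact hyW htz
  · exact h.leads_subset hl hW hyW htz

theorem Leads.next {v y z : Vertex} (h : Leads pred v z) (hy : pred v = some y) :
    z = y ∨ Leads pred y z := by
  induction h with
  | single e => exact Or.inl (Option.some.inj (e.symm.trans hy))
  | tail _ e ih =>
    rcases ih with rfl | ih
    · exact Or.inr (Relation.TransGen.single e)
    · exact Or.inr (ih.tail e)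

theorem GraphInv.glue_ne_source (h : GraphInv V IN k l S pred w) {v : Vertex} (hv : v ∈ S)
    (hs : v ≠ source) : none ∉ glue S pred v := by
  intro hn
  have hg : none ∈ glue S pred source := by
    rw [glue_of_not_leads (h.not_leads_source _)]; exact rfl
  rcases h.sameCycle_of_mem hv h.source_mem hn hg with e | ⟨-, e⟩
  · exact hs e.symm
  · exact h.not_leads_source _ e

theorem GraphInv.finite (h : GraphInv V IN k l S pred w) (hV : V.Finite) {v : Vertex}
    (hv : v ∈ S) (hs : v ≠ source) : v.Finite :=
  (hV.image some).subset fun t ht => by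
    obtain ⟨x, hx, rfl⟩ := h.atoms v hv hs t ht
    exact ⟨x, hx, rfl⟩

theorem GraphInv.glue_atoms (h : GraphInv V IN k l S pred w) {v : Vertex} (hv : v ∈ S)
    (hs : v ≠ source) (t : Option ℕ) (ht : t ∈ glue S pred v) : ∃ x ∈ V, t = some x := by
  obtain ⟨z, hz, htz, -⟩ := (mem_glue hv).mp ht
  refine h.atoms z hz ?_ t htz
  rintro rfl
  obtain rfl : t = none := htz
  exact h.glue_ne_source hv hs ht

theorem cyclePred_eq_some {v z : Vertex} (h : cyclePred S pred v = some z) :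
    v ∈ S ∧ ¬ Leads pred v v ∧ ∃ y, pred v = some y ∧ z = glue S pred y := by
  unfold cyclePred at h
  split_ifs at h with hc
  obtain ⟨y, hy, rfl⟩ := Option.map_eq_some_iff.mp h
  exact ⟨hc.1, hc.2, y, hy, rfl⟩

/-- After the contraction `pred` is undefined at glued vertices, so a path that ends in an unglued
vertex meets none of them, and its edges are old edges. In particular a cycle would be an old cycle
of unglued vertices, which is absurd. -/
theorem GraphInv.leads_of_cyclePred (h : GraphInv V IN k l S pred w) {v z : Vertex}
    (hl : Leads (cyclePred S pred) v z) (hz : z ∈ S) (hn : ¬ Leads pred z z) :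
    Leads pred v z := by
  have key : ∀ y z, cyclePred S pred y = some z → z ∈ S → ¬ Leads pred z z →
      pred y = some z := by
    intro y z e hz hn
    obtain ⟨hy, -, z0, e0, hz0⟩ := cyclePred_eq_some e
    have hz0S := (h.pred_mem _ _ e0).2.1
    have : glue S pred z = glue S pred z0 := by rw [glue_of_not_leads hn, hz0]
    rcases h.sameCycle_of_glue_eq hz hz0S this with rfl | ⟨a, b⟩
    · exact e0
    · exact absurd (a.trans b) hn
  induction hl with
  | single e => exact Relation.TransGen.single (key _ _ e hz hn)
  | @tail y z _ e ih =>
    obtain ⟨hy, hyn, -⟩ := cyclePred_eq_some e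
    exact (ih hy hyn).tail (key _ _ e hz hn)

theorem GraphInv.cycle_acyclic (h : GraphInv V IN k l S pred w) (v : Vertex) :
    ¬ Leads (cyclePred S pred) v v := by
  intro hl
  obtain ⟨y, hy⟩ := hl.pred_ne_none
  obtain ⟨hv, hn, -⟩ := cyclePred_eq_some hy
  exact hn (h.leads_of_cyclePred hl hv hn)

/-- No cycle is left, so the bound on cycles holds vacuously and can be raised to `k + 1`. The glued
vertices have no predecessor, but they do not violate `small`: a cycle has a member with at least
`k` elements and another member that is nonempty and disjoint from it. -/
theorem GraphInv.cycle (hV : V.Finite) (h : GraphInv V IN k k S pred w) :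
    GraphInv V IN k (k + 1) (cycleS S pred) (cyclePred S pred) w where
  source_mem := ⟨source, h.source_mem, glue_of_not_leads (h.not_leads_source _)⟩
  nonempty := by
    rintro _ ⟨v, hv, rfl⟩
    exact (h.nonempty v hv).mono (subset_glue hv)
  atoms := by
    rintro _ ⟨v, hv, rfl⟩ hs t ht
    refine h.glue_atoms hv ?_ t ht
    rintro rfl
    exact hs (glue_of_not_leads (h.not_leads_source _))
  disj := by
    rintro _ ⟨u, hu, rfl⟩ _ ⟨v, hv, rfl⟩ t h1 h2
    exact glue_eq hu hv (h.sameCycle_of_mem hu hv h1 h2)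
  cover := by
    intro x hx
    obtain ⟨v, hv, hxv⟩ := h.cover x hx
    exact ⟨_, ⟨v, hv, rfl⟩, subset_glue hv hxv⟩
  conn := by
    rintro _ ⟨v, hv, rfl⟩ W hW hm
    exact h.glue_subset hv hW hm
  pred_mem := by
    intro v z e
    obtain ⟨hv, hn, y, hy, rfl⟩ := cyclePred_eq_some e
    obtain ⟨-, hyS, hvs, hyv, hc⟩ := h.pred_mem _ _ hy
    refine ⟨⟨v, hv, glue_of_not_leads hn⟩, ⟨y, hyS, rfl⟩, hvs, ?_, ?_⟩
    · intro he
      have : glue S pred y = glue S pred v := by rw [he, glue_of_not_leads hn]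
      rcases h.sameCycle_of_glue_eq hyS hv this with rfl | ⟨a, b⟩
      · exact hyv rfl
      · exact hn (b.trans a)
    · intro W hW hvW
      obtain ⟨t, ht⟩ := h.nonempty y hyS
      exact h.glue_subset hyS hW ⟨t, subset_glue hyS ht, hc W hW hvW ht⟩
  passed := by
    rintro _ ⟨v, hv, rfl⟩ hs x hx t ht
    have hvs : v ≠ source := by
      rintro rfl
      exact hs (glue_of_not_leads (h.not_leads_source _))
    obtain ⟨v1, hv1, hxv, e⟩ := (mem_glue hv).mp hx
    have hv1s : v1 ≠ source := by
      rintro rfl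
      cases hxv
    rw [glue_eq hv hv1 e]
    rcases h.passed v1 hv1 hv1s x hxv t ht with h1 | h1 | ⟨z, hz, htz⟩
    · exact Or.inl h1
    · exact Or.inr (Or.inl (subset_glue hv1 h1))
    · right
      have hzS := (h.pred_mem _ _ hz).2.1
      by_cases hc : Leads pred v1 v1
      · left
        refine (mem_glue hv1).mpr ⟨z, hzS, htz, Or.inr ⟨Relation.TransGen.single hz, ?_⟩⟩
        rcases hc.next hz with e' | e'
        · exact absurd e'.symm (h.pred_mem _ _ hz).2.2.2.1
        · exact e'
      · right
        rw [glue_of_not_leads hc]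
        refine ⟨glue S pred z, ?_, subset_glue hzS htz⟩
        simp [cyclePred, hv1, hc, hz]
  small := by
    rintro _ ⟨v, hv, rfl⟩ hs hk
    have hvs : v ≠ source := by
      rintro rfl
      exact hs (glue_of_not_leads (h.not_leads_source _))
    by_cases hc : Leads pred v v
    · exfalso
      obtain ⟨z, h1, h2, hkz⟩ := h.cyc v hc
      obtain ⟨y, hy⟩ := h2.pred_ne_none
      obtain ⟨hzS, hyS, -, hyz, -⟩ := h.pred_mem _ _ hy
      -- The vertex `y = pred z` lies on the cycle too and differs from `z`, which makes the union
      -- strictly larger than `z`.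
      have hyv : Leads pred y v ∨ v = y := (h2.next hy).symm
      have hycyc : SameCycle pred v y := by
        rcases hyv with e | e
        · exact Or.inr ⟨h1.tail hy, e⟩
        · exact Or.inl e.symm
      have hfin : (glue S pred v).Finite :=
        (hV.image some).subset fun t ht => by
          obtain ⟨x, hx, rfl⟩ := h.glue_atoms hv hvs t ht
          exact ⟨x, hx, rfl⟩
      have hlt : z.ncard < (glue S pred v).ncard := by
        refine Set.ncard_lt_ncard ⟨?_, ?_⟩ hfin
        · exact fun t ht => (mem_glue hv).mpr ⟨z, hzS, ht, Or.inr ⟨h1, h2⟩⟩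
        · intro hss
          obtain ⟨t, ht⟩ := h.nonempty y hyS
          exact hyz (h.disj y hyS z hzS t ht (hss ((mem_glue hv).mpr ⟨y, hyS, ht, hycyc⟩)))
      omega
    · rw [glue_of_not_leads hc] at hk ⊢
      have := h.small v hv hvs hk
      simpa [cyclePred, hv, hc] using this
  cyc := fun v hl => absurd hl (h.cycle_acyclic v)
  rest := h.rest

end Cycle

/-! ### Scanning the lists of tails -/

section Scan

/-- A skipped tail lies in `v`, and otherwise only `t` leaves the lists. This is what
`GraphInv.passed` needs when `pred v` becomes the set that contains `t`. -/
theorem scan_some {v : Vertex} {us : List ℕ} {w w' : Rest} {t : Option ℕ}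
    (h : scan v us w = (some t, w')) :
    (∃ u ∈ us, t ∈ w u) ∧ t ∉ v ∧ (∀ x, x ∉ us → w' x = w x) ∧
      (∀ x, ∀ y ∈ w' x, y ∈ w x) ∧ ∀ x, ∀ y ∈ w x, y ∈ w' x ∨ y ∈ v ∨ y = t := by
  classical
  induction us generalizing w with
  | nil => simp [scan] at h
  | cons u us ih =>
    have hsplit := List.takeWhile_append_dropWhile (p := fun t => decide (t ∈ v)) (l := w u)
    have htake : ∀ y ∈ (w u).takeWhile (fun t => decide (t ∈ v)), y ∈ v := by
      intro y hy
      simpa using List.mem_takeWhile_imp hy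
    rw [scan] at h
    split at h
    · rename_i hd
      rw [hd, List.append_nil] at hsplit
      rw [hsplit] at htake
      obtain ⟨⟨u', hu', ht'⟩, h1, h2, h3, h4⟩ := ih h
      have hu'u : u' ≠ u := by rintro rfl; simp at ht'
      rw [Function.update_of_ne hu'u] at ht'
      refine ⟨⟨u', List.mem_cons_of_mem _ hu', ht'⟩, h1, ?_, ?_, ?_⟩
      · intro x hx
        rw [h2 x fun hh => hx (List.mem_cons_of_mem _ hh),
          Function.update_of_ne (by rintro rfl; exact hx List.mem_cons_self)]
      · intro x y hy
        have := h3 x y hy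
        by_cases hx : x = u
        · subst hx; simp at this
        · rwa [Function.update_of_ne hx] at this
      · intro x y hy
        by_cases hx : x = u
        · subst hx; exact Or.inr (Or.inl (htake y hy))
        · exact h4 x y (by rwa [Function.update_of_ne hx])
    · rename_i t' ts hd
      simp only [Prod.mk.injEq, Option.some.injEq] at h
      obtain ⟨rfl, rfl⟩ := h
      rw [hd] at hsplit
      refine ⟨⟨u, List.mem_cons_self, by rw [← hsplit]; simp⟩, ?_, ?_, ?_, ?_⟩
      · have := List.head?_dropWhile_not (fun t => decide (t ∈ v)) (w u)
        rw [hd] at this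
        simpa using this
      · intro x hx
        rw [Function.update_of_ne (by rintro rfl; exact hx List.mem_cons_self)]
      · intro x y hy
        by_cases hx : x = u
        · subst hx
          rw [Function.update_self] at hy
          rw [← hsplit]; simp [hy]
        · rwa [Function.update_of_ne hx] at hy
      · intro x y hy
        by_cases hx : x = u
        · subst hx
          rw [← hsplit] at hy
          rw [Function.update_self]
          rcases List.mem_append.mp hy with hy | hy
          · exact Or.inr (Or.inl (htake y hy))
          · rcases List.mem_cons.mp hy with hy | hy
            · exact Or.inr (Or.inr hy)
            · exact Or.inl hy
        · rw [Function.update_of_ne hx]; exact Or.inl hy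

theorem scan_none {v : Vertex} {us : List ℕ} {w w' : Rest} (hus : us.Nodup)
    (h : scan v us w = (none, w')) : ∀ x ∈ us, ∀ y ∈ w x, y ∈ v := by
  classical
  induction us generalizing w with
  | nil => simp
  | cons u us ih =>
    rw [scan] at h
    split at h
    · rename_i hd
      intro x hx y hy
      rcases List.mem_cons.mp hx with rfl | hx
      · simpa using List.dropWhile_eq_nil_iff.mp hd y hy
      · have hxu : x ≠ u := fun e => (List.nodup_cons.mp hus).1 (e ▸ hx)
        exact ih (List.nodup_cons.mp hus).2 h x hx y (by rwa [Function.update_of_ne hxu])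
    · simp at h

theorem exists_scan_none {v : Vertex} {us : List ℕ} {w : Rest}
    (h : ∀ x ∈ us, ∀ y ∈ w x, y ∈ v) : ∃ w', scan v us w = (none, w') := by
  classical
  induction us generalizing w with
  | nil => exact ⟨w, rfl⟩
  | cons u us ih =>
    have hd : (w u).dropWhile (fun t => decide (t ∈ v)) = [] :=
      List.dropWhile_eq_nil_iff.mpr fun y hy => by
        simpa using h u List.mem_cons_self y hy
    obtain ⟨w', hw'⟩ := ih (w := Function.update w u []) (by
      intro x hx y hy
      by_cases hxu : x = u
      · subst hxu; simp at hy
      · rw [Function.update_of_ne hxu] at hy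
        exact h x (List.mem_cons_of_mem _ hx) y hy)
    exact ⟨w', by rw [scan, hd]; exact hw'⟩

end Scan

/-! ### The stages of the procedure -/

section Main

variable {V : Set ℕ} {IN : Rest} {k : ℕ} {S : Set Vertex} {pred : Pred} {w : Rest}

theorem exists_listing {v : Vertex} (hf : v.Finite) : ∃ us, IsListing v us := by
  have : {u | some u ∈ v}.Finite := hf.preimage (fun _ _ _ _ h => Option.some.inj h)
  exact ⟨this.toFinset.toList, Finset.nodup_toList _, fun u => by simp⟩

/-- A path that uses the new edge passes through `v` and can be cut there. Hence every new cycle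
contains `v`. -/
theorem leads_update {v z : Vertex} {a b : Vertex}
    (h : Leads (Function.update pred v (some z)) a b) :
    Leads pred a b ∨ ((a = v ∨ Leads (Function.update pred v (some z)) a v) ∧
      Leads (Function.update pred v (some z)) v b) := by
  induction h with
  | @single b e =>
    by_cases ha : a = v
    · subst ha
      exact Or.inr ⟨Or.inl rfl, Relation.TransGen.single e⟩
    · rw [Function.update_of_ne ha] at e
      exact Or.inl (Relation.TransGen.single e)
  | @tail b c hab e ih =>
    by_cases hb : b = v
    · subst hb
      exact Or.inr ⟨Or.inr hab, Relation.TransGen.single e⟩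
    · rcases ih with ih | ih
      · rw [Function.update_of_ne hb] at e
        exact Or.inl (ih.tail e)
      · exact Or.inr ⟨ih.1, ih.2.tail e⟩

theorem leads_update_of_leads {v z : Vertex} (hv : pred v = none) {a b : Vertex}
    (h : Leads pred a b) : Leads (Function.update pred v (some z)) a b := by
  have key : ∀ x y, pred x = some y → Function.update pred v (some z) x = some y := by
    intro x y e
    rwa [Function.update_of_ne (by rintro rfl; rw [hv] at e; cases e)]
  induction h with
  | single e => exact Relation.TransGen.single (key _ _ e)
  | tail _ e ih => exact ih.tail (key _ _ e)

/-- The new cycles contain `v`, which has `k + 1` elements. The new edge respects closed sets: `t`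
is a tail of an atom of `v`, so a closed set that includes `v` meets `z` and includes it by `conn`.
-/
theorem GraphInv.set_pred (h : GraphInv V IN k (k + 1) S pred w) {v z : Vertex} (hv : v ∈ S)
    (hvs : v ≠ source) (hvp : pred v = none) (hk : v.ncard = k + 1) {us : List ℕ}
    (hus : IsListing v us) {t : Option ℕ} {w' : Rest} (hsc : scan v us w = (some t, w'))
    (hz : z ∈ S) (ht : t ∈ z) :
    GraphInv V IN k (k + 1) S (Function.update pred v (some z)) w' := by
  obtain ⟨⟨u, hu, htu⟩, htv, hw1, hw2, hw3⟩ := scan_some hsc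
  have huv := (hus.2 u).mp hu
  refine { h with pred_mem := ?_, passed := ?_, small := ?_, cyc := ?_, rest := ?_ }
  · intro a b e
    by_cases ha : a = v
    · subst ha
      rw [Function.update_self] at e
      cases e
      refine ⟨hv, hz, hvs, fun e => htv (e ▸ ht), fun W hW haW => ?_⟩
      exact h.conn z hz W hW ⟨t, ht, hW.2 u (haW huv) t (h.rest u t htu)⟩
    · rw [Function.update_of_ne ha] at e
      exact h.pred_mem a b e
  · intro a ha has x hx y hy
    by_cases hav : a = v
    · subst hav
      rw [Function.update_self]
      rcases h.passed a ha has x hx y hy with h1 | h1 | ⟨b, h1, -⟩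
      · rcases hw3 x y h1 with h2 | h2 | rfl
        · exact Or.inl h2
        · exact Or.inr (Or.inl h2)
        · exact Or.inr (Or.inr ⟨z, rfl, ht⟩)
      · exact Or.inr (Or.inl h1)
      · rw [hvp] at h1; cases h1
    · rw [Function.update_of_ne hav, hw1 x]
      · exact h.passed a ha has x hx y hy
      · intro hxu
        exact hav (h.disj a ha v hv _ hx ((hus.2 x).mp hxu))
  · intro a ha has hak
    by_cases hav : a = v
    · subst hav; simp
    · rw [Function.update_of_ne hav]
      exact h.small a ha has hak
  · intro a hl
    rcases leads_update hl with h1 | ⟨h1, h2⟩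
    · obtain ⟨b, hb1, hb2, hb3⟩ := h.cyc a h1
      exact ⟨b, leads_update_of_leads hvp hb1, leads_update_of_leads hvp hb2, hb3⟩
    · refine ⟨v, ?_, h2, hk.ge⟩
      rcases h1 with rfl | h1
      · exact hl
      · exact h1
  · exact fun x y hy => h.rest x y (hw2 x y hy)

/-- By `passed`, as `pred v` is undefined, a tail outside `v` would still be ahead of the pointers,
and the scan would have met it. -/
theorem GraphInv.closed_of_scan_none (h : GraphInv V IN k (k + 1) S pred w) {v : Vertex}
    (hv : v ∈ S) (hvs : v ≠ source) (hvp : pred v = none) {us : List ℕ}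
    (hus : IsListing v us) {w' : Rest} (hsc : scan v us w = (none, w')) :
    ClosedVertex V IN v := by
  refine ⟨h.atoms v hv hvs, fun x hx t ht => ?_⟩
  rcases h.passed v hv hvs x hx t ht with h1 | h1 | ⟨z, hz, -⟩
  · exact scan_none hus.1 hsc x ((hus.2 x).mpr hx) t h1
  · exact h1
  · rw [hvp] at hz; cases hz

/-- A failing scan would exhibit a closed set of `k + 1` elements, which `hno` excludes; so the loop
gives every listed set a predecessor. -/
theorem GraphInv.exists_forLoop (hV : V.Finite)
    (hIN : ∀ x, ∀ t ∈ IN x, t = none ∨ ∃ b ∈ V, t = some b)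
    (hno : ∀ v, ClosedVertex V IN v → v.Nonempty → v.ncard ≠ k + 1)
    (L : List Vertex) (h : GraphInv V IN k (k + 1) S pred w) (hL : L.Nodup)
    (hL1 : ∀ v ∈ L, v ∈ S ∧ v ≠ source ∧ pred v = none ∧ v.ncard = k + 1)
    (hL2 : ∀ v ∈ S, v ≠ source → pred v = none → v.ncard = k + 1 → v ∈ L) :
    ∃ pred' w', ForLoop S L pred w (Sum.inr (pred', w')) ∧
      GraphInv V IN (k + 1) (k + 1) S pred' w' := by
  induction L generalizing pred w with
  | nil =>
    refine ⟨pred, w, ForLoop.done, { h with small := ?_ }⟩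
    intro v hv hvs hk hp
    rcases Nat.lt_or_ge v.ncard (k + 1) with h1 | h1
    · exact h.small v hv hvs (by omega) hp
    · simpa using hL2 v hv hvs hp (by omega)
  | cons v L ih =>
    obtain ⟨hv, hvs, hvp, hvk⟩ := hL1 v List.mem_cons_self
    obtain ⟨us, hus⟩ := exists_listing (h.finite hV hv hvs)
    rcases hsc : scan v us w with ⟨_ | t, w'⟩
    · exact absurd hvk (hno v (h.closed_of_scan_none hv hvs hvp hus hsc) (h.nonempty v hv))
    · obtain ⟨⟨u, hu, htu⟩, -⟩ := scan_some hsc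
      have : ∃ z ∈ S, t ∈ z := by
        rcases hIN u t (h.rest u t htu) with rfl | ⟨b, hb, rfl⟩
        · exact ⟨source, h.source_mem, rfl⟩
        · exact h.cover b hb
      obtain ⟨z, hz, htz⟩ := this
      have hvL := (List.nodup_cons.mp hL).1
      obtain ⟨p', w'', hf, hg⟩ := ih (h.set_pred hv hvs hvp hvk hus hsc hz htz)
        (List.nodup_cons.mp hL).2
        (fun a ha => by
          have := hL1 a (List.mem_cons_of_mem _ ha)
          rwa [Function.update_of_ne (by rintro rfl; exact hvL ha)])
        (fun a ha has hap hak => by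
          have hav : a ≠ v := by rintro rfl; simp at hap
          rw [Function.update_of_ne hav] at hap
          exact (List.mem_cons.mp (hL2 a ha has hap hak)).resolve_left hav)
      exact ⟨p', w'', ForLoop.success hus hsc hz htz hf, hg⟩

/-- If `W` were not in `S`, every member of `S` inside `W` would have at most `k` elements, hence a
predecessor, which is inside `W` again because `W` is closed. In a finite acyclic graph this cannot
go on. -/
theorem GraphInv.mem_of_closed (hV : V.Finite) (h : GraphInv V IN k (k + 1) S pred w)
    (hac : ∀ v, ¬ Leads pred v v) {W : Vertex} (hW : ClosedVertex V IN W) (hne : W.Nonempty)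
    (hk : W.ncard = k + 1) : W ∈ S := by
  by_contra hWS
  have hWfin : W.Finite := (hV.image some).subset fun t ht => by
    obtain ⟨x, hx, rfl⟩ := hW.1 t ht
    exact ⟨x, hx, rfl⟩
  have hstep : ∀ v, v ∈ S → v ⊆ W → ∃ z, pred v = some z ∧ z ∈ S ∧ z ⊆ W := by
    intro v hv hvW
    have hvs : v ≠ source := by
      rintro rfl
      obtain ⟨x, -, hx⟩ := hW.1 none (hvW rfl)
      cases hx
    have hlt : v.ncard < W.ncard := by
      refine Set.ncard_lt_ncard ⟨hvW, fun hss => hWS ?_⟩ hWfin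
      rwa [← Set.Subset.antisymm hvW hss]
    obtain ⟨z, hz⟩ := Option.ne_none_iff_exists'.mp (h.small v hv hvs (by omega))
    exact ⟨z, hz, (h.pred_mem _ _ hz).2.1, (h.pred_mem _ _ hz).2.2.2.2 W hW hvW⟩
  have hfin : {v | v ∈ S ∧ v ⊆ W}.Finite := hWfin.finite_subsets.subset fun v hv => hv.2
  -- Reachability is transitive, irreflexive and lives on a finite set, so it has a minimal element;
  -- `hstep` contradicts its minimality.
  have hwf : WellFounded (fun a b : {v | v ∈ S ∧ v ⊆ W} => Leads pred b.1 a.1) := by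
    have := hfin.to_subtype
    have : IsTrans {v | v ∈ S ∧ v ⊆ W} (fun a b => Leads pred b.1 a.1) :=
      ⟨fun a b c h1 h2 => Relation.TransGen.trans h2 h1⟩
    have : Std.Irrefl (α := {v | v ∈ S ∧ v ⊆ W}) (fun a b => Leads pred b.1 a.1) :=
      ⟨fun a => hac a.1⟩
    exact Finite.wellFounded_of_trans_of_irrefl _
  obtain ⟨t, ht⟩ := hne
  obtain ⟨x, hx, rfl⟩ := hW.1 t ht
  obtain ⟨v, hv, hxv⟩ := h.cover x hx
  have hvW := h.conn v hv W hW ⟨_, hxv, ht⟩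
  obtain ⟨m, -, hm⟩ := hwf.has_min Set.univ ⟨⟨v, hv, hvW⟩, trivial⟩
  obtain ⟨z, hz, hzS, hzW⟩ := hstep m.1 m.2.1 m.2.2
  exact hm ⟨z, hzS, hzW⟩ trivial (Relation.TransGen.single hz)

theorem GraphInv.exists_activeList (hV : V.Finite) {l : ℕ} (h : GraphInv V IN k l S pred w)
    (j : ℕ) : ∃ L, IsActiveList S pred j L := by
  have hfin : {v | v ∈ S ∧ v ≠ source ∧ pred v = none ∧ v.ncard = j}.Finite := by
    refine (hV.image some).finite_subsets.subset ?_
    rintro v ⟨hv, hvs, -⟩ t ht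
    obtain ⟨x, hx, rfl⟩ := h.atoms v hv hvs t ht
    exact ⟨x, hx, rfl⟩
  exact ⟨hfin.toFinset.toList, Finset.nodup_toList _, fun v => by
    rw [Finset.mem_toList, Set.Finite.mem_toFinset, Set.mem_ofPred_eq]⟩

/-- `W` is the intended result: a smallest nonempty closed set, or `∅` if there is none. In stage
`|W|` it is an active member of the partition and can be listed before the others. In any other
stage that is reached no closed set has the cardinality in question, so the stage completes. -/
theorem GraphInv.mainLoop (hV : V.Finite)
    (hIN : ∀ x, ∀ t ∈ IN x, t = none ∨ ∃ b ∈ V, t = some b) {W : Vertex}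
    (hmin : ∀ v, ClosedVertex V IN v → v.Nonempty → W.Nonempty ∧ W.ncard ≤ v.ncard)
    (hW : W = ∅ ∨ (ClosedVertex V IN W ∧ k < W.ncard))
    (h : GraphInv V IN k k S pred w) : MainLoop V.ncard k S pred w W := by
  obtain ⟨d, hd⟩ : ∃ d, d = V.ncard - k := ⟨_, rfl⟩
  induction d generalizing k S pred w with
  | zero =>
    rcases hW with rfl | ⟨hW, hk⟩
    · exact MainLoop.finish (by omega)
    · have : W.ncard ≤ (some '' V).ncard := Set.ncard_le_ncard (fun t ht => by
        obtain ⟨x, hx, rfl⟩ := hW.1 t ht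
        exact ⟨x, hx, rfl⟩) (hV.image some)
      rw [Set.ncard_image_of_injective V (Option.some_injective ℕ)] at this
      omega
  | succ d ih =>
    have hk : k < V.ncard := by omega
    have hc := h.cycle hV
    by_cases hWk : W.ncard = k + 1
    · have hWne : W ≠ ∅ := by rintro rfl; simp at hWk
      have hWc := (hW.resolve_left hWne).1
      have hne := Set.nonempty_iff_ne_empty.mpr hWne
      have hWS := hc.mem_of_closed hV h.cycle_acyclic hWc hne hWk
      have hWs : W ≠ source := by
        rintro rfl
        obtain ⟨x, -, hx⟩ := hWc.1 none rfl
        cases hx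
      obtain ⟨us, hus⟩ := exists_listing (hc.finite hV hWS hWs)
      obtain ⟨w', hw'⟩ := exists_scan_none (v := W) (us := us) (w := w) fun x hx y hy =>
        hWc.2 x ((hus.2 x).mp hx) y (h.rest x y hy)
      -- A predecessor of the closed set `W` would be included in `W`, but distinct members of the
      -- partition are disjoint.
      have hWp : cyclePred S pred W = none := by
        by_contra hne'
        obtain ⟨z, hz⟩ := Option.ne_none_iff_exists'.mp hne'
        obtain ⟨-, hzS, -, hzW, hcl⟩ := hc.pred_mem _ _ hz
        obtain ⟨t, ht⟩ := hc.nonempty z hzS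
        exact hzW (hc.disj z hzS W hWS t ht (hcl W hWc subset_rfl ht))
      obtain ⟨L, hL⟩ := hc.exists_activeList hV (k + 1)
      have hWL : W ∈ L := (hL.2 W).mpr ⟨hWS, hWs, hWp, hWk⟩
      classical
      -- The freedom in the order of the list is used here: `W` is moved to the front.
      refine MainLoop.found (L := W :: L.erase W) hk ⟨?_, ?_⟩ (ForLoop.failure hus hw')
      · exact (List.perm_cons_erase hWL).nodup_iff.mp hL.1
      · intro v
        rw [← (List.perm_cons_erase hWL).mem_iff]
        exact hL.2 v
    · obtain ⟨L, hL⟩ := hc.exists_activeList hV (k + 1)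
      have hno : ∀ v, ClosedVertex V IN v → v.Nonempty → v.ncard ≠ k + 1 := by
        intro v hv hne hvk
        obtain ⟨h1, h2⟩ := hmin v hv hne
        have := (hW.resolve_left h1.ne_empty).2
        omega
      obtain ⟨p', w', hf, hg⟩ := hc.exists_forLoop hV hIN hno L hL.1
        (fun v hv => (hL.2 v).mp hv) (fun v h1 h2 h3 h4 => (hL.2 v).mpr ⟨h1, h2, h3, h4⟩)
      refine MainLoop.again hk hL hf (ih ?_ hg (by omega))
      rcases hW with hW | ⟨h1, h2⟩
      · exact Or.inl hW
      · exact Or.inr ⟨h1, by omega⟩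

/-- The only link between the procedure and the machine: a set `D` with these properties may be
computed by any method whatever. -/
theorem falseReturns_of_minimal {Q : Set (HornRule ℕ)} {D : Set ℕ} (hV : V.Finite)
    (hQ : Q.Finite) (hQV : hornAtoms Q ⊆ V) (hD : D = ∅ ∨ ClosedSet V Q D)
    (hmin : ∀ U, ClosedSet V Q U → U.Nonempty → D.Nonempty ∧ D.ncard ≤ U.ncard) :
    FalseReturns V Q D := by
  have hfin : ∀ a, {t | ∃ r ∈ Q, r.head = a ∧ r.body.head? = t}.Finite := fun a =>
    (hQ.image fun r => r.body.head?).subset (by rintro t ⟨r, hr, -, rfl⟩; exact ⟨r, hr, rfl⟩)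
  obtain ⟨IN, hINdef⟩ : ∃ IN : Rest, IN = fun a => (hfin a).toFinset.toList := ⟨_, rfl⟩
  have hmem : ∀ a t, t ∈ IN a ↔ ∃ r ∈ Q, r.head = a ∧ r.body.head? = t := by
    intro a t; simp [hINdef]
  have hIN : IsIN Q IN := fun a => ⟨by simp [hINdef, Finset.nodup_toList], hmem a⟩
  have hcl : ∀ v, ClosedVertex V IN v → ClosedSet V Q {a | some a ∈ v} ∧
      v = some '' {a | some a ∈ v} := by
    intro v hv
    refine ⟨⟨fun a ha => ?_, fun r hr ha => ?_⟩, ?_⟩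
    · obtain ⟨x, hx, e⟩ := hv.1 _ ha
      cases e; exact hx
    · have := hv.2 r.head ha r.body.head? ((hmem _ _).mpr ⟨r, hr, rfl, rfl⟩)
      obtain ⟨x, -, e⟩ := hv.1 _ this
      exact ⟨x, by rw [e] at this; exact this, e⟩
    · ext t
      constructor
      · intro ht
        obtain ⟨x, -, rfl⟩ := hv.1 t ht
        exact ⟨x, ht, rfl⟩
      · rintro ⟨x, hx, rfl⟩
        exact hx
  have hcard : ∀ U : Set ℕ, (some '' U : Vertex).ncard = U.ncard := fun U =>
    Set.ncard_image_of_injective U (Option.some_injective ℕ)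
  refine ⟨IN, some '' D, hIN, ?_, by ext; simp⟩
  refine GraphInv.mainLoop (IN := IN) (k := 0) hV ?_ ?_ ?_ ?_
  · intro x t ht
    obtain ⟨r, hr, -, rfl⟩ := (hmem _ _).mp ht
    rcases hb : r.body.head? with _ | b
    · exact Or.inl rfl
    · exact Or.inr ⟨b, hQV ⟨r, hr, Or.inr (List.mem_of_mem_head? (by rw [hb]; rfl))⟩, rfl⟩
  · intro v hv hne
    obtain ⟨h1, h2⟩ := hcl v hv
    have := hmin _ h1 (by rw [h2] at hne; exact hne.of_image)
    refine ⟨this.1.image _, ?_⟩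
    rw [h2, hcard, hcard]
    exact this.2
  · rcases hD with rfl | hD
    · exact Or.inl (Set.image_empty _)
    · rcases D.eq_empty_or_nonempty with rfl | hne
      · exact Or.inl (Set.image_empty _)
      · refine Or.inr ⟨⟨?_, ?_⟩, ?_⟩
        · rintro _ ⟨x, hx, rfl⟩
          exact ⟨x, hD.1 hx, rfl⟩
        · rintro x ⟨_, hx, e⟩ t ht
          cases e
          obtain ⟨r, hr, rfl, rfl⟩ := (hmem _ _).mp ht
          obtain ⟨b, hb, e⟩ := hD.2 r hr hx
          exact ⟨b, hb, e.symm⟩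
        · rw [hcard]
          exact (Set.ncard_pos (hV.subset hD.1)).mpr hne
  · have hS : ∀ v : Vertex, v ∈ ({v | ∃ x ∈ V, v = {some x}} ∪ {source} : Set Vertex) →
        ∃ t, v = {t} ∧ (v ≠ source → ∃ x ∈ V, t = some x) := by
      rintro v (⟨x, hx, rfl⟩ | rfl)
      · exact ⟨_, rfl, fun _ => ⟨x, hx, rfl⟩⟩
      · exact ⟨none, rfl, fun h => absurd rfl h⟩
    -- The invariant holds for `k = l = 0`: singletons have positive cardinality, and there are no
    -- edges and no cycles.
    refine ⟨Or.inr rfl, ?_, ?_, ?_, ?_, ?_, ?_, ?_, ?_, ?_, ?_⟩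
    · intro v hv
      obtain ⟨t, rfl, -⟩ := hS v hv
      exact Set.singleton_nonempty t
    · intro v hv hs t ht
      obtain ⟨t', rfl, h⟩ := hS v hv
      obtain rfl : t = t' := ht
      exact h hs
    · intro u hu v hv t h1 h2
      obtain ⟨t1, rfl, -⟩ := hS u hu
      obtain ⟨t2, rfl, -⟩ := hS v hv
      obtain rfl : t = t1 := h1
      obtain rfl : t = t2 := h2
      rfl
    · exact fun x hx => ⟨_, Or.inl ⟨x, hx, rfl⟩, rfl⟩
    · rintro v hv W - ⟨t, ht, htW⟩
      obtain ⟨t1, rfl, -⟩ := hS v hv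
      obtain rfl : t = t1 := ht
      exact Set.singleton_subset_iff.mpr htW
    · intro v z e; cases e
    · exact fun v _ _ x _ t ht => Or.inl ht
    · intro v hv hs hk
      obtain ⟨t, rfl, -⟩ := hS v hv
      simp at hk
    · intro v hl
      obtain ⟨y, hy⟩ := hl.pred_ne_none
      cases hy
    · exact fun _ _ h => h

end Main

/-! ## A weakest-precondition calculus for the machine -/

/-- Started in `σ`, the program `c` terminates in a state that satisfies `Q`. -/
def wp (c : Code) (Q : State → Prop) (σ : State) : Prop := ∃ σ', Exec c σ σ' ∧ Q σ'

theorem wp_mono {c : Code} {Q R : State → Prop} {σ : State} (h : wp c Q σ)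
    (hQR : ∀ σ', Q σ' → R σ') : wp c R σ := by
  obtain ⟨σ', h1, h2⟩ := h
  exact ⟨σ', h1, hQR σ' h2⟩

theorem wp_instr {i : Instr} {Q : State → Prop} {σ : State} :
    wp (Code.instr i) Q σ ↔ Q (i.effect σ).tick := by
  constructor
  · rintro ⟨σ', h, hQ⟩
    cases h
    exact hQ
  · exact fun h => ⟨_, Exec.instr, h⟩

theorem wp_seq {c d : Code} {Q : State → Prop} {σ : State} :
    wp (Code.seq c d) Q σ ↔ wp c (wp d Q) σ := by
  constructor
  · rintro ⟨σ', h, hQ⟩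
    cases h with
    | seq h1 h2 => exact ⟨_, h1, _, h2, hQ⟩
  · rintro ⟨σ₁, h1, σ₂, h2, hQ⟩
    exact ⟨σ₂, Exec.seq h1 h2, hQ⟩

theorem wp_cond {b : Cond} {c d : Code} {Q : State → Prop} {σ : State} :
    wp (Code.cond b c d) Q σ ↔
      (b.holds σ → wp c Q σ.tick) ∧ (¬ b.holds σ → wp d Q σ.tick) := by
  constructor
  · rintro ⟨σ', h, hQ⟩
    cases h with
    | condTrue hb h => exact ⟨fun _ => ⟨_, h, hQ⟩, fun hn => absurd hb hn⟩
    | condFalse hb h => exact ⟨fun hn => absurd hn hb, fun _ => ⟨_, h, hQ⟩⟩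
  · rintro ⟨h1, h2⟩
    by_cases hb : b.holds σ
    · obtain ⟨σ', h, hQ⟩ := h1 hb
      exact ⟨σ', Exec.condTrue hb h, hQ⟩
    · obtain ⟨σ', h, hQ⟩ := h2 hb
      exact ⟨σ', Exec.condFalse hb h, hQ⟩

theorem wp_loop_step {b : Cond} {c : Code} {Q : State → Prop} {σ : State}
    (h1 : b.holds σ → wp c (wp (Code.loop b c) Q) σ.tick)
    (h2 : ¬ b.holds σ → Q σ.tick) : wp (Code.loop b c) Q σ := by
  by_cases hb : b.holds σ
  · obtain ⟨σ₁, e1, σ₂, e2, hQ⟩ := h1 hb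
    exact ⟨σ₂, Exec.loopTrue hb e1 e2, hQ⟩
  · exact ⟨_, Exec.loopFalse hb, h2 hb⟩

theorem Exec.time_le {c : Code} {σ σ' : State} (h : Exec c σ σ') : σ.time ≤ σ'.time := by
  induction h with
  | @instr i σ => cases i <;> simp [Instr.effect, State.tick]
  | seq _ _ h1 h2 => exact h1.trans h2
  | condTrue _ _ h => exact (Nat.le_succ _).trans h
  | condFalse _ _ h => exact (Nat.le_succ _).trans h
  | loopFalse _ => exact Nat.le_succ _
  | loopTrue _ _ _ h1 h2 => exact ((Nat.le_succ _).trans h1).trans h2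

/-- A loop terminates if its invariant bounds the step count. -/
theorem wp_loop {b : Cond} {c : Code} {Q : State → Prop} {σ : State} (I : State → Prop) (B : ℕ)
    (hB : ∀ σ, I σ → σ.time ≤ B) (h0 : I σ)
    (hstep : ∀ σ, I σ → b.holds σ → wp c I σ.tick)
    (hQ : ∀ σ, I σ → ¬ b.holds σ → Q σ.tick) : wp (Code.loop b c) Q σ := by
  obtain ⟨n, hn⟩ : ∃ n, n = B - σ.time := ⟨_, rfl⟩
  induction n using Nat.strong_induction_on generalizing σ with
  | _ n ih =>
    refine wp_loop_step (fun hb => ?_) (hQ σ h0)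
    obtain ⟨σ₁, e1, hI⟩ := hstep σ h0 hb
    -- The test of the condition alone costs a step, so the distance of the clock from `B` decreases
    -- in every round.
    have ht : σ.time + 1 ≤ σ₁.time := e1.time_le
    have := hB σ₁ hI
    exact ⟨σ₁, e1, ih (B - σ₁.time) (by omega) hI rfl⟩

/-! ### Frames -/

/-- The registers that an instruction may change. -/
def Instr.regs : Instr → List ℕ
  | const x _ => [x]
  | copy x _ => [x]
  | succ x _ => [x]
  | pred x _ => [x]
  | load x _ _ => [x]
  | _ => []

/-- The arrays that an instruction may change. -/
def Instr.arrs : Instr → List ℕ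
  | store m _ _ => [m]
  | _ => []

/-- Whether an instruction writes output. -/
def Instr.emits : Instr → Bool
  | emit _ _ => true
  | mark _ => true
  | _ => false

/-- The registers that a program may change. -/
def Code.regs : Code → List ℕ
  | instr i => i.regs
  | seq c d => c.regs ++ d.regs
  | cond _ c d => c.regs ++ d.regs
  | loop _ c => c.regs

/-- The arrays that a program may change. -/
def Code.arrs : Code → List ℕ
  | instr i => i.arrs
  | seq c d => c.arrs ++ d.arrs
  | cond _ c d => c.arrs ++ d.arrs
  | loop _ c => c.arrs

/-- Whether a program may write output. -/
def Code.emits : Code → Bool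
  | instr i => i.emits
  | seq c d => c.emits || d.emits
  | cond _ c d => c.emits || d.emits
  | loop _ c => c.emits

/-- What a program cannot have changed. -/
structure Frame (c : Code) (σ σ' : State) : Prop where
  reg : ∀ x, x ∉ c.regs → σ'.reg x = σ.reg x
  arr : ∀ m, m ∉ c.arrs → σ'.arr m = σ.arr m
  out : c.emits = false → σ'.out = σ.out
  time : σ.time ≤ σ'.time

/-- The footprint of a program is computed from its syntax, so specifications need not mention what
stays fixed; that a register or array is outside the footprint is usually decided by evaluation. -/
theorem Exec.frame {c : Code} {σ σ' : State} (h : Exec c σ σ') : Frame c σ σ' := by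
  induction h with
  | @instr i σ =>
    constructor
    · intro x hx
      cases i <;> simp_all [Instr.effect, State.tick, Code.regs, Instr.regs]
    · intro m hm
      cases i <;> simp_all [Instr.effect, State.tick, Code.arrs, Instr.arrs]
    · intro he
      cases i <;> simp_all [Instr.effect, State.tick, Code.emits, Instr.emits]
    · cases i <;> simp [Instr.effect, State.tick]
  | seq _ _ h1 h2 =>
    refine ⟨fun x hx => ?_, fun m hm => ?_, fun he => ?_, h1.time.trans h2.time⟩
    · simp only [Code.regs, List.mem_append, not_or] at hx
      rw [h2.reg x hx.2, h1.reg x hx.1]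
    · simp only [Code.arrs, List.mem_append, not_or] at hm
      rw [h2.arr m hm.2, h1.arr m hm.1]
    · simp only [Code.emits, Bool.or_eq_false_iff] at he
      rw [h2.out he.2, h1.out he.1]
  | condTrue _ _ h =>
    refine ⟨fun x hx => ?_, fun m hm => ?_, fun he => ?_, (Nat.le_succ _).trans h.time⟩
    · simp only [Code.regs, List.mem_append, not_or] at hx
      exact h.reg x hx.1
    · simp only [Code.arrs, List.mem_append, not_or] at hm
      exact h.arr m hm.1
    · simp only [Code.emits, Bool.or_eq_false_iff] at he
      exact h.out he.1
  | condFalse _ _ h =>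
    refine ⟨fun x hx => ?_, fun m hm => ?_, fun he => ?_, (Nat.le_succ _).trans h.time⟩
    · simp only [Code.regs, List.mem_append, not_or] at hx
      exact h.reg x hx.2
    · simp only [Code.arrs, List.mem_append, not_or] at hm
      exact h.arr m hm.2
    · simp only [Code.emits, Bool.or_eq_false_iff] at he
      exact h.out he.2
  | loopFalse _ => exact ⟨fun _ _ => rfl, fun _ _ => rfl, fun _ => rfl, Nat.le_succ _⟩
  | loopTrue _ _ _ h1 h2 =>
    exact ⟨fun x hx => (h2.reg x hx).trans (h1.reg x hx),
      fun m hm => (h2.arr m hm).trans (h1.arr m hm), fun he => (h2.out he).trans (h1.out he),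
      ((Nat.le_succ _).trans h1.time).trans h2.time⟩

theorem wp_frame {c : Code} {Q R : State → Prop} {σ : State} (h : wp c Q σ)
    (hQR : ∀ σ', Frame c σ σ' → Q σ' → R σ') : wp c R σ := by
  obtain ⟨σ', h1, h2⟩ := h
  exact ⟨σ', h1, hQR σ' h1.frame h2⟩

/-! ### Instructions -/

@[reducible] def cst (x k : ℕ) : Code := Code.instr (Instr.const x k)
@[reducible] def cpy (x y : ℕ) : Code := Code.instr (Instr.copy x y)
@[reducible] def inc (x y : ℕ) : Code := Code.instr (Instr.succ x y)
@[reducible] def dec (x y : ℕ) : Code := Code.instr (Instr.pred x y)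
@[reducible] def ld (x m y : ℕ) : Code := Code.instr (Instr.load x m y)
@[reducible] def sto (m x y : ℕ) : Code := Code.instr (Instr.store m x y)

infixr:60 " ;; " => Code.seq

section

variable {x y k m : ℕ} {Q : State → Prop} {r : ℕ → ℕ} {A : ℕ → ℕ → ℕ} {o : List Event} {t : ℕ}

theorem wp_cst : wp (cst x k) Q ⟨r, A, o, t⟩ ↔ Q ⟨Function.update r x k, A, o, t + 1⟩ := wp_instr

theorem wp_cpy : wp (cpy x y) Q ⟨r, A, o, t⟩ ↔ Q ⟨Function.update r x (r y), A, o, t + 1⟩ :=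
  wp_instr

theorem wp_inc :
    wp (inc x y) Q ⟨r, A, o, t⟩ ↔ Q ⟨Function.update r x (r y + 1), A, o, t + 1⟩ := wp_instr

theorem wp_dec :
    wp (dec x y) Q ⟨r, A, o, t⟩ ↔ Q ⟨Function.update r x (r y - 1), A, o, t + 1⟩ := wp_instr

theorem wp_ld :
    wp (ld x m y) Q ⟨r, A, o, t⟩ ↔ Q ⟨Function.update r x (A m (r y)), A, o, t + 1⟩ := wp_instr

theorem wp_sto : wp (sto m x y) Q ⟨r, A, o, t⟩ ↔
    Q ⟨r, Function.update A m (Function.update (A m) (r x) (r y)), o, t + 1⟩ := wp_instr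

theorem wp_emit : wp (Code.instr (Instr.emit k x)) Q ⟨r, A, o, t⟩ ↔
    Q ⟨r, A, o ++ [Event.value k (r x)], t + 1⟩ := wp_instr

theorem wp_mark : wp (Code.instr (Instr.mark k)) Q ⟨r, A, o, t⟩ ↔
    Q ⟨r, A, o ++ [Event.mark k t], t + 1⟩ := wp_instr

theorem wp_ite_eq {c d : Code} : wp (Code.cond (Cond.eq x y) c d) Q ⟨r, A, o, t⟩ ↔
    (r x = r y → wp c Q ⟨r, A, o, t + 1⟩) ∧ (r x ≠ r y → wp d Q ⟨r, A, o, t + 1⟩) := wp_cond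

theorem wp_ite_lt {c d : Code} : wp (Code.cond (Cond.lt x y) c d) Q ⟨r, A, o, t⟩ ↔
    (r x < r y → wp c Q ⟨r, A, o, t + 1⟩) ∧ (¬ r x < r y → wp d Q ⟨r, A, o, t + 1⟩) := wp_cond

theorem tick_mk : State.tick ⟨r, A, o, t⟩ = ⟨r, A, o, t + 1⟩ := rfl

theorem holds_lt : (Cond.lt x y).holds ⟨r, A, o, t⟩ ↔ r x < r y := Iff.rfl

theorem update_reg {v z : ℕ} (h : z ≠ x) : Function.update r x v z = r z :=
  Function.update_of_ne h v r

theorem update_arr {v : ℕ → ℕ} {z : ℕ} (h : z ≠ x) : Function.update A x v z = A z :=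
  Function.update_of_ne h v A

end

/-- The rules for symbolic execution. -/
theorem exec_rules :
    type_of% @wp_seq ∧ type_of% @wp_cst ∧ type_of% @wp_cpy ∧ type_of% @wp_inc ∧
    type_of% @wp_dec ∧ type_of% @wp_ld ∧ type_of% @wp_sto ∧ type_of% @wp_emit ∧
    type_of% @wp_mark ∧ type_of% @wp_ite_eq ∧ type_of% @wp_ite_lt ∧ type_of% @tick_mk ∧
    type_of% @holds_lt ∧ type_of% @update_reg ∧ type_of% @update_arr ∧
    (∀ (f : ℕ → ℕ) (a v : ℕ), Function.update f a v a = v) ∧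
    (∀ (f : ℕ → ℕ → ℕ) (a : ℕ) (v : ℕ → ℕ), Function.update f a v a = v) ∧
    (∀ a b : ℕ, (a ≠ b) = ¬ a = b) ∧ (¬ False) = True :=
  ⟨@wp_seq, @wp_cst, @wp_cpy, @wp_inc, @wp_dec, @wp_ld, @wp_sto, @wp_emit, @wp_mark,
    @wp_ite_eq, @wp_ite_lt, @tick_mk, @holds_lt, @update_reg, @update_arr,
    fun _ _ _ => Function.update_self .., fun _ _ _ => Function.update_self ..,
    fun _ _ => rfl, not_false_eq_true⟩

end WFS

/-! ## The machine program -/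

-- Names of the registers; `rZ` holds zero throughout

notation "rZ" => (0 : ℕ)
notation "rM" => (1 : ℕ)
notation "rN" => (2 : ℕ)
notation "rP" => (3 : ℕ)
notation "rR" => (4 : ℕ)
notation "rO" => (5 : ℕ)
notation "rX" => (6 : ℕ)
notation "rA" => (7 : ℕ)
notation "rC" => (8 : ℕ)
notation "rI" => (9 : ℕ)
notation "rS" => (10 : ℕ)
notation "rT" => (11 : ℕ)
notation "rU" => (12 : ℕ)
notation "rQh" => (13 : ℕ)
notation "rQt" => (14 : ℕ)
notation "rK" => (15 : ℕ)
notation "rBz" => (16 : ℕ)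
notation "rLo" => (17 : ℕ)
notation "rHi" => (18 : ℕ)
notation "rTop" => (19 : ℕ)
notation "rBase" => (20 : ℕ)
notation "rBt" => (21 : ℕ)
notation "rUt" => (22 : ℕ)
notation "rJ" => (23 : ℕ)
notation "rGo" => (24 : ℕ)
notation "rMain" => (25 : ℕ)
notation "rW" => (26 : ℕ)
notation "rY" => (27 : ℕ)
notation "rE" => (28 : ℕ)
notation "rB" => (29 : ℕ)

-- Names of the working arrays; the array `0` is the input, `1` and `2` are the results

notation "aHd" => (3 : ℕ)
notation "aTl" => (4 : ℕ)
notation "aCnt" => (5 : ℕ)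
notation "aDead" => (6 : ℕ)
notation "aRule" => (7 : ℕ)
notation "aSgn" => (8 : ℕ)
notation "aAtm" => (9 : ℕ)
notation "aOnext" => (10 : ℕ)
notation "aOfst" => (11 : ℕ)
notation "aHfst" => (12 : ℕ)
notation "aHnext" => (13 : ℕ)
notation "aSeen" => (14 : ℕ)
notation "aVarr" => (15 : ℕ)
notation "aStart" => (16 : ℕ)
notation "aEnd" => (17 : ℕ)
notation "aDeg" => (18 : ℕ)
notation "aEnt" => (19 : ℕ)
notation "aLoc" => (20 : ℕ)
notation "aEtl" => (21 : ℕ)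
notation "aOwn" => (22 : ℕ)
notation "aGcnt" => (23 : ℕ)
notation "aEof" => (24 : ℕ)
notation "aMark" => (25 : ℕ)
notation "aSlot" => (26 : ℕ)
notation "aQa" => (27 : ℕ)
notation "aQs" => (28 : ℕ)
notation "aIdx" => (29 : ℕ)
notation "aPtr" => (30 : ℕ)
notation "aSt" => (31 : ℕ)
notation "aUs" => (32 : ℕ)
notation "aBs" => (33 : ℕ)

namespace WFS

open Cond in
/-- Enter the code in `rX` into the list of atoms, if it is new. -/
def enterAtom : Code :=
  ld rA aSeen rX ;;
  Code.cond (eq rA rZ) (cst rA 1 ;; sto aSeen rX rA ;; sto aVarr rN rX ;; inc rN rN) (cst rA 0)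

/-- Read one body literal of the rule `rR`, of sign `rS`. -/
def readLiteral : Code :=
  ld rX 0 rP ;; inc rP rP ;; inc rX rX ;; enterAtom ;;
  inc rO rO ;; sto aRule rO rR ;; sto aSgn rO rS ;; sto aAtm rO rX ;;
  ld rA aOfst rX ;; sto aOnext rO rA ;; sto aOfst rX rO ;;
  ld rA aCnt rR ;; inc rA rA ;; sto aCnt rR rA ;; inc rI rI

/-- Read a list of body literals of sign `rS`. -/
def readLiterals : Code :=
  ld rC 0 rP ;; inc rP rP ;; cst rI 0 ;; Code.loop (Cond.lt rI rC) readLiteral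

/-- Read one rule. -/
def readRule : Code :=
  inc rR rR ;; ld rX 0 rP ;; inc rP rP ;; inc rX rX ;; enterAtom ;;
  sto aHd rR rX ;; ld rA aHfst rX ;; sto aHnext rR rA ;; sto aHfst rX rR ;;
  cst rX 0 ;; cst rS 1 ;; readLiterals ;; sto aTl rR rX ;; cst rS 0 ;; readLiterals

/-- Read the program. -/
def readProgram : Code :=
  ld rM 0 rZ ;; cst rP 1 ;; Code.loop (Cond.lt rR rM) readRule

/-- Enter the tail of the rule `rR` into the segment of its head `rX`. -/
def buildRule : Code :=
  ld rT aTl rR ;; ld rA aMark rT ;;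
  -- `aMark` holds the last head for which this tail was met. The slot is valid exactly if that is
  -- the current head; otherwise a new entry is made, and no clearing between heads is necessary.
  Code.cond (Cond.eq rA rX) (ld rW aSlot rT)
    (sto aMark rT rX ;; sto aSlot rT rE ;; sto aEtl rE rT ;; sto aOwn rE rX ;;
      sto aEnt rE rE ;; sto aLoc rE rE ;; cpy rW rE ;; inc rE rE ;; sto aEnd rX rE ;;
      ld rA aDeg rX ;; inc rA rA ;; sto aDeg rX rA) ;;
  sto aEof rR rW ;; ld rA aGcnt rW ;; inc rA rA ;; sto aGcnt rW rA ;; ld rR aHnext rR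

/-- Lay out the segment of one atom. -/
def buildHead : Code :=
  ld rX aVarr rJ ;; sto aStart rX rE ;; sto aEnd rX rE ;; ld rR aHfst rX ;;
  Code.loop (Cond.lt rZ rR) buildRule ;; inc rJ rJ

/-- Lay out the lists of tails. -/
def buildLists : Code :=
  cst rJ 0 ;; Code.loop (Cond.lt rJ rN) buildHead

/-- The atom with code `rX` becomes true, unless it is true already. -/
def makeTrue : Code :=
  dec rY rX ;; ld rA 1 rY ;;
  Code.cond (Cond.eq rA rZ)
    (cst rA 1 ;; sto 1 rY rA ;; Code.instr (Instr.emit 0 rY) ;; sto aQa rQt rX ;;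
      sto aQs rQt rA ;; inc rQt rQt)
    (cst rA 0)

/-- The heads of the rules with empty body become true. -/
def initFacts : Code :=
  cst rR 0 ;; Code.loop (Cond.lt rR rM)
    (inc rR rR ;; ld rA aCnt rR ;;
      Code.cond (Cond.eq rA rZ) (ld rX aHd rR ;; makeTrue) (cst rA 0))

/-- Remove the entry `rE` from its segment. -/
def removeEntry : Code :=
  ld rX aOwn rE ;; ld rP aLoc rE ;; ld rT aEnd rX ;; dec rT rT ;; ld rW aEnt rT ;;
  sto aEnt rP rW ;; sto aLoc rW rP ;; sto aEnd rX rT ;;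
  ld rA aDeg rX ;; dec rA rA ;; sto aDeg rX rA

/-- Delete the rule `rR`. -/
def killRule : Code :=
  ld rA aDead rR ;;
  Code.cond (Cond.eq rA rZ)
    (cst rA 1 ;; sto aDead rR rA ;; ld rE aEof rR ;; ld rA aGcnt rE ;; dec rA rA ;;
      sto aGcnt rE rA ;; Code.cond (Cond.eq rA rZ) removeEntry (cst rA 0))
    (cst rA 0)

/-- One literal of the rule `rR` has become true. -/
def satisfyLiteral : Code :=
  ld rA aCnt rR ;; dec rA rA ;; sto aCnt rR rA ;;
  Code.cond (Cond.eq rA rZ) (ld rX aHd rR ;; makeTrue) (cst rA 0)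

/-- Inspect the occurrence `rO` of an atom that has got the truth value `rS`. -/
def visitOccurrence : Code :=
  ld rR aRule rO ;; ld rA aSgn rO ;;
  -- Signs and truth values are coded alike (`1` positive and true, `0` negative and false), so
  -- equality means that the literal has become true.
  Code.cond (Cond.eq rA rS) satisfyLiteral killRule ;; ld rO aOnext rO

/-- Handle the first event of the queue. -/
def handleEvent : Code :=
  ld rX aQa rQh ;; ld rS aQs rQh ;; inc rQh rQh ;; ld rO aOfst rX ;;
  Code.loop (Cond.lt rZ rO) visitOccurrence

/-- Propagate truth values until the queue is empty. -/
def propagate : Code := Code.loop (Cond.lt rQh rQt) handleEvent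

/-- Prepare a search: vertices of degree above `rK` count as finished. -/
def resetVertex : Code :=
  ld rX aVarr rI ;; ld rA aDeg rX ;;
  -- Index `0` means new, `1` discarded in advance; larger indices are places on the path.
  Code.cond (Cond.lt rK rA)
    (cst rA 1 ;; sto aIdx rX rA ;; ld rA aEnd rX ;; sto aPtr rX rA)
    (sto aIdx rX rZ ;; ld rA aStart rX ;; sto aPtr rX rA) ;; inc rI rI

/-- Push the vertex `rX` onto the path, as a block of its own. -/
def pushVertex : Code :=
  sto aSt rTop rX ;; sto aIdx rX rTop ;; sto aUs rUt rTop ;; inc rUt rUt ;;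
  sto aBs rBt rTop ;; inc rBt rBt ;; inc rTop rTop

/-- Drop the whole path. -/
def clearPath : Code := cpy rBase rTop ;; cst rUt 1 ;; cst rBt 0

/-- The top block of the path is closed: keep it if it is the smallest one so far. -/
def blockFound : Code :=
  cpy rI rB ;; cst rC 0 ;; Code.loop (Cond.lt rI rTop) (inc rI rI ;; inc rC rC) ;;
  Code.cond (Cond.lt rC rBz) (cpy rBz rC ;; cpy rLo rB ;; cpy rHi rTop) (cst rA 0) ;; clearPath

/-- Merge the blocks of the path above the position `rI`. -/
def mergeBlocks : Code :=
  Code.loop (Cond.lt rI rB) (dec rBt rBt ;; dec rA rBt ;; ld rB aBs rA)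

/-- Follow the next edge into the vertex `rX`. -/
def followEdge : Code :=
  ld rW aEnt rP ;; ld rW aEtl rW ;; ld rI aIdx rW ;; inc rP rP ;; sto aPtr rX rP ;;
  Code.cond (Cond.eq rI rZ) (cpy rX rW ;; pushVertex)
    -- An index below `rBase` belongs to a finished vertex. All of the path leads to it, so the path
    -- is given up as well.
    (Code.cond (Cond.lt rI rBase) clearPath mergeBlocks)

/-- One step of the search. -/
def searchStep : Code :=
  dec rT rUt ;; ld rU aUs rT ;; dec rA rBt ;; ld rB aBs rA ;;
  -- If the highest place with possibly unexplored edges lies below the top block, that block is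
  -- fully explored. The bottom entry `0` of `aUs` is a sentinel below all blocks.
  Code.cond (Cond.lt rU rB) blockFound
    (ld rX aSt rU ;; ld rP aPtr rX ;; ld rA aEnd rX ;;
      Code.cond (Cond.eq rP rA) (cpy rUt rT) followEdge)

/-- Search from the vertex number `rJ`. -/
def searchFrom : Code :=
  ld rX aVarr rJ ;; ld rA aIdx rX ;;
  Code.cond (Cond.eq rA rZ) (pushVertex ;; Code.loop (Cond.lt rBase rTop) searchStep)
    (cst rA 0) ;; inc rJ rJ

/-- Search for closed sets of cardinality at most `rK`. -/
def searchPhase : Code :=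
  -- The code `0` stands for `s`, which lies in no closed set of atoms; it counts as finished. The
  -- path begins at place `2`, beyond the special indices.
  cst rA 1 ;; sto aIdx rZ rA ;; cst rI 0 ;; Code.loop (Cond.lt rI rN) resetVertex ;;
  cst rTop 2 ;; clearPath ;; inc rBz rN ;; cst rLo 0 ;; cst rHi 0 ;; cst rJ 0 ;;
  Code.loop (Cond.lt rJ rN) searchFrom

/-- Double `rK`. -/
def doubleBound : Code :=
  cpy rC rK ;; cst rI 0 ;; Code.loop (Cond.lt rI rC) (inc rK rK ;; inc rI rI)

/-- Find a smallest nonempty closed set. -/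
def findClosed : Code :=
  cst rK 1 ;; cst rGo 1 ;;
  Code.loop (Cond.lt rZ rGo)
    -- A set larger than `rK` need not be smallest, because discarded vertices were ignored; it is
    -- accepted only when `rK` has reached `rN`.
    (searchPhase ;; Code.cond (Cond.lt rK rBz)
      (Code.cond (Cond.lt rK rN) doubleBound (cst rGo 0)) (cst rGo 0))

/-- The atoms of the set found become false. -/
def makeFalse : Code :=
  cpy rI rLo ;; Code.loop (Cond.lt rI rHi)
    (ld rX aSt rI ;; dec rY rX ;; cst rA 1 ;; sto 2 rY rA ;; Code.instr (Instr.emit 1 rY) ;;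
      sto aQa rQt rX ;; sto aQs rQt rZ ;; inc rQt rQt ;; inc rI rI)

/-- Remove the false atoms from the list of atoms. -/
def compactAtoms : Code :=
  cst rI 0 ;; cst rC 0 ;; Code.loop (Cond.lt rI rN)
    (ld rX aVarr rI ;; dec rY rX ;; ld rA 2 rY ;;
      Code.cond (Cond.eq rA rZ) (sto aVarr rC rX ;; inc rC rC) (cst rA 0) ;; inc rI rI) ;;
  cpy rN rC

/-- One pass of the template. -/
def templatePass : Code :=
  propagate ;; Code.instr (Instr.mark 0) ;; findClosed ;; makeFalse ;; compactAtoms ;;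
  Code.instr (Instr.mark 1) ;; Code.cond (Cond.lt rLo rHi) (cst rA 0) (cst rMain 0)

/-- The whole program. -/
def wfsMachine : Code :=
  readProgram ;; buildLists ;; initFacts ;; cst rMain 1 ;;
  Code.loop (Cond.lt rZ rMain) templatePass

/-! ## Linked lists and tables -/

/-- `l` is the list that starts at `x`, linked by `next`; `0` is the null pointer. -/
def Chain (next : ℕ → ℕ) : ℕ → List ℕ → Prop
  | x, [] => x = 0
  | x, y :: l => x = y ∧ 0 < y ∧ Chain next (next y) l

theorem Chain.update {next : ℕ → ℕ} {x y z : ℕ} {l : List ℕ} (h : Chain next x l) (hy : y ∉ l) :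
    Chain (Function.update next y z) x l := by
  induction l generalizing x with
  | nil => exact h
  | cons a l ih =>
    obtain ⟨rfl, h1, h2⟩ := h
    rw [List.mem_cons, not_or] at hy
    refine ⟨rfl, h1, ?_⟩
    rw [Function.update_of_ne (Ne.symm hy.1)]
    exact ih h2 hy.2

/-- The items `1, …, n` are linked in lists, one for each key. -/
def MultiMap (n : ℕ) (key first next : ℕ → ℕ) : Prop :=
  ∀ x, ∃ l, Chain next (first x) l ∧ l.Nodup ∧ ∀ i, i ∈ l ↔ 1 ≤ i ∧ i ≤ n ∧ key i = x

/-- The new item becomes the first one of the list of its key. Its number exceeds `n`, so it lies in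
no old list, and setting its link disturbs none. -/
theorem MultiMap.insert {n : ℕ} {key first next : ℕ → ℕ} (h : MultiMap n key first next) (y : ℕ) :
    MultiMap (n + 1) (Function.update key (n + 1) y) (Function.update first y (n + 1))
      (Function.update next (n + 1) (first y)) := by
  intro x
  obtain ⟨l, h1, h2, h3⟩ := h x
  have hn : n + 1 ∉ l := by
    rw [h3]; omega
  by_cases hx : x = y
  · subst hx
    refine ⟨(n + 1) :: l, ⟨by simp, by omega, ?_⟩, List.nodup_cons.mpr ⟨hn, h2⟩, fun i => ?_⟩
    · rw [Function.update_self]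
      exact h1.update hn
    · rw [List.mem_cons, h3]
      by_cases hi : i = n + 1
      · subst hi; simp
      · rw [Function.update_of_ne hi]
        constructor
        · rintro (h | h)
          · exact absurd h hi
          · exact ⟨h.1, by omega, h.2.2⟩
        · exact fun h => Or.inr ⟨h.1, by omega, h.2.2⟩
  · refine ⟨l, ?_, h2, fun i => ?_⟩
    · rw [Function.update_of_ne hx]
      exact h1.update hn
    · rw [h3]
      by_cases hi : i = n + 1
      · subst hi
        rw [Function.update_self]
        constructor
        · intro h; omega
        · intro h; exact absurd h.2.2.symm hx
      · rw [Function.update_of_ne hi]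
        constructor
        · exact fun h => ⟨h.1, by omega, h.2.2⟩
        · exact fun h => ⟨h.1, by omega, h.2.2⟩

/-- The first `n` places of `varr` list the elements of `V`. -/
structure Enumerates (varr : ℕ → ℕ) (n : ℕ) (V : Finset ℕ) : Prop where
  inj : ∀ i < n, ∀ j < n, varr i = varr j → i = j
  mem : ∀ x, x ∈ V ↔ ∃ i < n, varr i = x

theorem Enumerates.card {varr : ℕ → ℕ} {n : ℕ} {V : Finset ℕ} (h : Enumerates varr n V) :
    V.card = n := by
  have : V = (Finset.range n).image varr := by
    ext x
    simp [h.mem]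
  rw [this, Finset.card_image_of_injOn, Finset.card_range]
  intro i hi j hj e
  exact h.inj i (by simpa using hi) j (by simpa using hj) e

theorem Enumerates.insert {varr : ℕ → ℕ} {n : ℕ} {V : Finset ℕ} (h : Enumerates varr n V) {x : ℕ}
    (hx : x ∉ V) : Enumerates (Function.update varr n x) (n + 1) (insert x V) := by
  have hne : ∀ i < n, varr i ≠ x := fun i hi e => hx ((h.mem x).mpr ⟨i, hi, e⟩)
  constructor
  · intro i hi j hj e
    by_cases h1 : i = n <;> by_cases h2 : j = n
    · omega
    · subst h1
      rw [Function.update_self, Function.update_of_ne h2] at e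
      exact absurd e.symm (hne j (by omega))
    · subst h2
      rw [Function.update_self, Function.update_of_ne h1] at e
      exact absurd e (hne i (by omega))
    · rw [Function.update_of_ne h1, Function.update_of_ne h2] at e
      exact h.inj i (by omega) j (by omega) e
  · intro y
    rw [Finset.mem_insert, h.mem]
    constructor
    · rintro (rfl | ⟨i, hi, rfl⟩)
      · exact ⟨n, by omega, by simp⟩
      · exact ⟨i, by omega, by rw [Function.update_of_ne (by omega)]⟩
    · rintro ⟨i, hi, rfl⟩
      by_cases h1 : i = n
      · subst h1; simp
      · rw [Function.update_of_ne h1]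
        exact Or.inr ⟨i, by omega, rfl⟩

/-! ## Reading the input -/

/-- The input list `f` continues with `l` at position `p`. -/
def Input (f : ℕ → ℕ) : ℕ → List ℕ → Prop
  | _, [] => True
  | p, a :: l => f p = a ∧ Input f (p + 1) l

theorem input_getD (l : List ℕ) (k : ℕ) (pre : List ℕ) (hk : k = pre.length) :
    Input (fun i => (pre ++ l).getD i 0) k l := by
  induction l generalizing k pre with
  | nil => trivial
  | cons a l ih =>
    subst hk
    refine ⟨by simp, ?_⟩
    have := ih (pre.length + 1) (pre ++ [a]) (by simp)
    simpa using this

/-- Stated for an arbitrary postcondition, so that symbolic execution of the code that follows can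
continue inside `Q`. -/
theorem wp_enterAtom {σ : State} {Q : State → Prop} {V : Finset ℕ} (h0 : σ.reg rZ = 0)
    (hV : Enumerates (σ.arr aVarr) (σ.reg rN) V) (hs : ∀ x, σ.arr aSeen x = 0 ↔ x ∉ V)
    (h : ∀ σ', Frame enterAtom σ σ' →
      Enumerates (σ'.arr aVarr) (σ'.reg rN) (insert (σ.reg rX) V) →
      (∀ x, σ'.arr aSeen x = 0 ↔ x ∉ insert (σ.reg rX) V) → σ'.time ≤ σ.time + 6 → Q σ') :
    wp enterAtom Q σ := by
  suffices hw : wp enterAtom (fun σ' =>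
      Enumerates (σ'.arr aVarr) (σ'.reg rN) (insert (σ.reg rX) V) ∧
      (∀ x, σ'.arr aSeen x = 0 ↔ x ∉ insert (σ.reg rX) V) ∧ σ'.time ≤ σ.time + 6) σ from
    wp_frame hw fun σ' hf hh => h σ' hf hh.1 hh.2.1 hh.2.2
  obtain ⟨r, A, o, t⟩ := σ
  dsimp only at *
  simp only [enterAtom, exec_rules, Nat.reduceEqDiff, h0]
  refine ⟨fun hx => ?_, fun hx => ?_⟩
  · have hxV := (hs _).mp hx
    refine ⟨hV.insert hxV, fun x => ?_, by omega⟩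
    by_cases hxx : x = r rX
    · subst hxx; simp
    · rw [Function.update_of_ne hxx, hs, Finset.mem_insert]
      simp [hxx]
  · have hxV : r rX ∈ V := by
      by_contra hc
      exact hx ((hs _).mpr hc)
    rw [Finset.insert_eq_of_mem hxV]
    exact ⟨hV, hs, by omega⟩

/-- The tables after reading the heads `Hs` and the body literals `L` (rule, sign, code). -/
structure ParseInv (A : ℕ → ℕ → ℕ) (n N : ℕ) (L : List (ℕ × ℕ × ℕ)) (Hs : List ℕ) : Prop where
  len : L.length = N
  occ : ∀ i < N, L[i]? = some (A aRule (i + 1), A aSgn (i + 1), A aAtm (i + 1))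
  omap : MultiMap N (A aAtm) (A aOfst) (A aOnext)
  cnt : ∀ r, A aCnt r = ((Finset.Icc 1 N).filter fun o => A aRule o = r).card
  heads : ∀ i < Hs.length, Hs[i]? = some (A aHd (i + 1))
  hmap : MultiMap Hs.length (A aHd) (A aHfst) (A aHnext)
  enum : Enumerates (A aVarr) n (Hs ++ L.map fun o => o.2.2).toFinset
  seen : ∀ x, A aSeen x = 0 ↔ x ∉ (Hs ++ L.map fun o => o.2.2).toFinset

/-- For the counters of body literals: a new occurrence raises the counter of its own rule only. -/
theorem card_filter_update (f : ℕ → ℕ) (N r r' : ℕ) :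
    ((Finset.Icc 1 (N + 1)).filter fun o => Function.update f (N + 1) r o = r').card =
      ((Finset.Icc 1 N).filter fun o => f o = r').card + if r = r' then 1 else 0 := by
  have h1 : Finset.Icc 1 (N + 1) = insert (N + 1) (Finset.Icc 1 N) := by
    ext; simp only [Finset.mem_Icc, Finset.mem_insert]; omega
  have h2 : ((Finset.Icc 1 N).filter fun o => Function.update f (N + 1) r o = r') =
      (Finset.Icc 1 N).filter fun o => f o = r' := by
    apply Finset.filter_congr
    intro o ho
    rw [Function.update_of_ne]
    have := Finset.mem_Icc.mp ho
    omega
  rw [h1, Finset.filter_insert, Function.update_self, h2]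
  split_ifs
  · rw [Finset.card_insert_of_notMem]
    simp
  · rfl

theorem wp_readLiteral {σ : State} {L : List (ℕ × ℕ × ℕ)} {Hs : List ℕ} {a : ℕ}
    (h0 : σ.reg rZ = 0) (hI : ParseInv σ.arr (σ.reg rN) (σ.reg rO) L Hs)
    (ha : σ.arr 0 (σ.reg rP) = a) :
    wp readLiteral (fun σ' =>
      ParseInv σ'.arr (σ'.reg rN) (σ'.reg rO) (L ++ [(σ.reg rR, σ.reg rS, a + 1)]) Hs ∧
      σ'.reg rP = σ.reg rP + 1 ∧ σ'.reg rI = σ.reg rI + 1 ∧ σ'.reg rX = a + 1 ∧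
      σ'.time ≤ σ.time + 20) σ := by
  obtain ⟨r, A, o, t⟩ := σ
  dsimp only at *
  simp only [readLiteral, exec_rules, Nat.reduceEqDiff]
  refine wp_enterAtom (V := (Hs ++ L.map fun o => o.2.2).toFinset) ?_ ?_ ?_ ?_
  · simpa using h0
  · simpa using hI.enum
  · simpa using hI.seen
  rintro ⟨r', A', o', t'⟩ ⟨hr, hA, -⟩ hV hs ht
  simp only [exec_rules, Nat.reduceEqDiff, ha] at hr hA hV hs ht ⊢
  have e4 := hr rR (by decide)
  have e5 := hr rO (by decide)
  have e6 := hr rX (by decide)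
  have e10 := hr rS (by decide)
  have e3 := hr rP (by decide)
  have e9 := hr rI (by decide)
  have a7 := hA aRule (by decide)
  have a8 := hA aSgn (by decide)
  have a9 := hA aAtm (by decide)
  have a10 := hA aOnext (by decide)
  have a11 := hA aOfst (by decide)
  have a5 := hA aCnt (by decide)
  have a3 := hA aHd (by decide)
  have a12 := hA aHfst (by decide)
  have a13 := hA aHnext (by decide)
  simp only [exec_rules, Nat.reduceEqDiff] at e3 e4 e5 e6 e9 e10
  simp only [e3, e4, e5, e6, e9, e10, a7, a8, a9, a10, a11, a5]
  have hset : (Hs ++ (L ++ [(r rR, r rS, a + 1)]).map fun o => o.2.2).toFinset =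
      insert (a + 1) (Hs ++ L.map fun o => o.2.2).toFinset := by
    ext x; simp only [List.map_append, List.mem_toFinset, List.mem_append, Finset.mem_insert,
      List.map_cons, List.map_nil, List.mem_singleton]
    tauto
  refine ⟨⟨?_, ?_, ?_, ?_, ?_, ?_, ?_, ?_⟩, trivial, trivial, trivial, by omega⟩
  · simp [hI.len]
  · intro i hi
    simp only [exec_rules, Nat.reduceEqDiff]
    by_cases h : i = r rO
    · subst h
      rw [List.getElem?_append_right hI.len.le, hI.len]
      simp
    · rw [List.getElem?_append_left (by have := hI.len; omega), hI.occ i (by omega)]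
      simp [h]
  · simp only [exec_rules, Nat.reduceEqDiff]
    exact hI.omap.insert (a + 1)
  · intro x
    simp only [exec_rules, Nat.reduceEqDiff]
    rw [card_filter_update, Function.update_apply]
    split_ifs with h1 h2 h2
    · subst h1; rw [hI.cnt]
    · exact absurd h1.symm h2
    · exact absurd h2.symm h1
    · rw [hI.cnt]; rfl
  · simpa only [exec_rules, Nat.reduceEqDiff, a3] using hI.heads
  · simpa only [exec_rules, Nat.reduceEqDiff, a3, a12, a13] using hI.hmap
  · simpa only [exec_rules, Nat.reduceEqDiff, hset] using hV
  · simpa only [exec_rules, Nat.reduceEqDiff, hset] using hs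

theorem Input.append {f : ℕ → ℕ} {p : ℕ} {l l' : List ℕ} :
    Input f p (l ++ l') ↔ Input f p l ∧ Input f (p + l.length) l' := by
  induction l generalizing p with
  | nil => simp [Input]
  | cons a l ih =>
    simp only [List.cons_append, Input, ih, List.length_cons, and_assoc]
    rw [Nat.add_right_comm, Nat.add_assoc]

/-- `rX` is tracked because after the positive part it is the code of the tail: the last positive
atom, or the initial value zero if there is none. -/
theorem wp_readLiterals {σ : State} {L : List (ℕ × ℕ × ℕ)} {Hs l : List ℕ}
    (h0 : σ.reg rZ = 0) (hI : ParseInv σ.arr (σ.reg rN) (σ.reg rO) L Hs)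
    (hin : Input (σ.arr 0) (σ.reg rP) (l.length :: l)) :
    wp readLiterals (fun σ' =>
      ParseInv σ'.arr (σ'.reg rN) (σ'.reg rO)
        (L ++ l.map fun a => (σ.reg rR, σ.reg rS, a + 1)) Hs ∧
      σ'.reg rP = σ.reg rP + (l.length + 1) ∧
      σ'.reg rX = (l.getLast?.map (· + 1)).getD (σ.reg rX) ∧
      σ'.time ≤ σ.time + 4 + 21 * l.length) σ := by
  obtain ⟨r, A, o, t⟩ := σ
  dsimp only at *
  obtain ⟨hlen, hin⟩ := hin
  simp only [readLiterals, exec_rules, Nat.reduceEqDiff, hlen]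
  refine wp_loop (fun σ => ∃ l₁ l₂, l = l₁ ++ l₂ ∧ σ.reg rI = l₁.length ∧
      σ.reg rC = l.length ∧ σ.reg rR = r rR ∧ σ.reg rS = r rS ∧ σ.reg rZ = 0 ∧
      ParseInv σ.arr (σ.reg rN) (σ.reg rO) (L ++ l₁.map fun a => (r rR, r rS, a + 1)) Hs ∧
      σ.reg rP = r rP + 1 + l₁.length ∧ Input (σ.arr 0) (σ.reg rP) l₂ ∧
      σ.reg rX = (l₁.getLast?.map (· + 1)).getD (r rX) ∧
      σ.time ≤ t + 3 + 21 * l₁.length) (t + 3 + 21 * l.length) ?_ ?_ ?_ ?_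
  · rintro σ ⟨l₁, l₂, rfl, -, -, -, -, -, -, -, -, -, h⟩
    rw [List.length_append]
    omega
  · exact ⟨[], l, rfl, by simp, by simp, by simp, by simp, by simpa using h0,
      by simpa using hI, by simp, by simpa using hin, by simp, by simp⟩
  · rintro σ ⟨l₁, l₂, rfl, h1, h2, h3, h4, h5, h6, h7, h8, h9, h10⟩ hb
    have hb' : σ.reg rI < σ.reg rC := hb
    rw [h1, h2, List.length_append] at hb'
    obtain _ | ⟨a, l₂⟩ := l₂
    · simp at hb'
    refine wp_frame (wp_readLiteral (σ := σ.tick) h5 h6 h8.1) ?_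
    rintro σ' hf ⟨g1, g2, g3, g4, g5⟩
    refine ⟨l₁ ++ [a], l₂, by simp, ?_, ?_, ?_, ?_, ?_, ?_, ?_, ?_, ?_, ?_⟩
    · rw [g3]; simpa [State.tick] using h1
    · rw [hf.reg rC (by decide)]; exact h2
    · rw [hf.reg rR (by decide)]; exact h3
    · rw [hf.reg rS (by decide)]; exact h4
    · rw [hf.reg rZ (by decide)]; exact h5
    · have e3 : σ.tick.reg rR = r rR := h3
      have e4 : σ.tick.reg rS = r rS := h4
      rw [e3, e4] at g1
      simpa using g1
    · have : σ.tick.reg rP = σ.reg rP := rfl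
      rw [g2, this, h7, List.length_append, List.length_singleton]; omega
    · rw [hf.arr 0 (by decide), g2]; exact h8.2
    · rw [g4]; simp
    · have : σ.tick.time = σ.time + 1 := rfl
      rw [List.length_append, List.length_singleton]; omega
  · rintro σ ⟨l₁, l₂, rfl, h1, h2, h3, h4, h5, h6, h7, h8, h9, h10⟩ hb
    have hb' : ¬ σ.reg rI < σ.reg rC := hb
    rw [h1, h2, List.length_append] at hb'
    obtain rfl : l₂ = [] := List.length_eq_zero_iff.mp (by omega)
    simp only [List.append_nil, State.tick]
    exact ⟨h6, by omega, h9, by omega⟩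

/-- The body literals of the rules of `P`, numbered from `r`. -/
def literalsFrom : ℕ → Program → List (ℕ × ℕ × ℕ)
  | _, [] => []
  | r, ρ :: P => (ρ.pos.map fun a => (r, 1, a + 1)) ++ (ρ.neg.map fun a => (r, 0, a + 1)) ++
      literalsFrom (r + 1) P

theorem literalsFrom_append (r : ℕ) (P Q : Program) :
    literalsFrom r (P ++ Q) = literalsFrom r P ++ literalsFrom (r + P.length) Q := by
  induction P generalizing r with
  | nil => simp [literalsFrom]
  | cons ρ P ih =>
    simp only [List.cons_append, literalsFrom, ih, List.length_cons, List.append_assoc]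
    rw [Nat.add_assoc, Nat.add_comm 1]

/-- The code of the tail of a rule. -/
def tailCode (ρ : Rule) : ℕ := (ρ.pos.getLast?.map (· + 1)).getD 0

/-- The rules of `P` have been read. -/
structure ReadInv (A : ℕ → ℕ → ℕ) (n N m : ℕ) (P : Program) : Prop where
  len : P.length = m
  parse : ParseInv A n N (literalsFrom 1 P) (P.map fun ρ => ρ.head + 1)
  tails : ∀ i < m, P[i]?.map tailCode = some (A aTl (i + 1))

theorem wp_readRule {σ : State} {P : Program} {ρ : Rule} (h0 : σ.reg rZ = 0)
    (hI : ReadInv σ.arr (σ.reg rN) (σ.reg rO) (σ.reg rR) P)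
    (hin : Input (σ.arr 0) (σ.reg rP)
      (ρ.head :: ρ.pos.length :: (ρ.pos ++ ρ.neg.length :: ρ.neg))) :
    wp readRule (fun σ' =>
      ReadInv σ'.arr (σ'.reg rN) (σ'.reg rO) (σ'.reg rR) (P ++ [ρ]) ∧
      σ'.reg rR = σ.reg rR + 1 ∧
      σ'.reg rP = σ.reg rP + (ρ.pos.length + ρ.neg.length + 3) ∧
      σ'.time ≤ σ.time + 30 + 21 * (ρ.pos.length + ρ.neg.length)) σ := by
  obtain ⟨r, A, o, t⟩ := σ
  dsimp only at *
  obtain ⟨hhd, hin⟩ := hin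
  rw [← List.cons_append, Input.append] at hin
  obtain ⟨hin1, hin2⟩ := hin
  obtain ⟨hm, hpar, htl⟩ := hI
  simp only [readRule, exec_rules, Nat.reduceEqDiff, hhd]
  have hset : ((P ++ [ρ]).map (fun ρ : Rule => ρ.head + 1) ++
      (literalsFrom 1 P).map fun o : ℕ × ℕ × ℕ => o.2.2).toFinset = insert (ρ.head + 1)
        (P.map (fun ρ : Rule => ρ.head + 1) ++
          (literalsFrom 1 P).map fun o : ℕ × ℕ × ℕ => o.2.2).toFinset := by
    ext x
    simp only [List.map_append, List.mem_toFinset, List.mem_append, Finset.mem_insert,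
      List.map_cons, List.map_nil, List.mem_singleton]
    tauto
  refine wp_enterAtom (V := ((P.map fun ρ : Rule => ρ.head + 1) ++
      (literalsFrom 1 P).map fun o : ℕ × ℕ × ℕ => o.2.2).toFinset) ?_ ?_ ?_ ?_
  · simpa [exec_rules] using h0
  · simpa [exec_rules] using hpar.enum
  · simpa [exec_rules] using hpar.seen
  rintro ⟨r', A', o', t'⟩ ⟨hr, hA, -⟩ hV hs ht
  simp only [exec_rules, Nat.reduceEqDiff] at hr hA hV hs ht ⊢
  have e0 := hr rZ (by decide)
  have e4 := hr rR (by decide)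
  have e5 := hr rO (by decide)
  have e6 := hr rX (by decide)
  have e3 := hr rP (by decide)
  have a0 := hA 0 (by decide)
  have a4 := hA aTl (by decide)
  have a7 := hA aRule (by decide)
  have a8 := hA aSgn (by decide)
  have a9 := hA aAtm (by decide)
  have a10 := hA aOnext (by decide)
  have a11 := hA aOfst (by decide)
  have a5 := hA aCnt (by decide)
  have a3 := hA aHd (by decide)
  have a12 := hA aHfst (by decide)
  have a13 := hA aHnext (by decide)
  simp only [exec_rules, Nat.reduceEqDiff] at e0 e3 e4 e5 e6
  -- The tables between the head and the body: the new head is entered, its literals are not.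
  have hP1 : ParseInv (Function.update
      (Function.update (Function.update A' aHd (Function.update (A' aHd) (r' rR) (r' rX))) aHnext
        (Function.update (A' aHnext) (r' rR) (A' aHfst (r' rX))))
      aHfst (Function.update (A' aHfst) (r' rX) (r' rR))) (r' rN) (r' rO) (literalsFrom 1 P)
      ((P ++ [ρ]).map fun ρ => ρ.head + 1) := by
    refine ⟨?_, ?_, ?_, ?_, ?_, ?_, ?_, ?_⟩
    · rw [e5]; exact hpar.len
    · simp only [exec_rules, Nat.reduceEqDiff, e5, a7, a8, a9]; exact hpar.occ
    · simp only [exec_rules, Nat.reduceEqDiff, e5, a10, a11, a9]; exact hpar.omap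
    · simp only [exec_rules, Nat.reduceEqDiff, e5, a5, a7]; exact hpar.cnt
    · simp only [exec_rules, Nat.reduceEqDiff, a3, e4, e6]
      intro i hi
      simp only [List.map_append, List.length_append, List.length_map, List.map_cons,
        List.map_nil, List.length_singleton] at hi ⊢
      by_cases h : i = P.length
      · subst h
        rw [List.getElem?_append_right (by simp), ← hm]
        simp
      · rw [List.getElem?_append_left (by simp; omega), hpar.heads i (by simp; omega),
          Function.update_of_ne (by omega)]
    · simp only [exec_rules, Nat.reduceEqDiff, a3, a12, a13, e4, e6]
      have := hpar.hmap.insert (ρ.head + 1)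
      simpa [hm] using this
    · simp only [exec_rules, Nat.reduceEqDiff, hset]; exact hV
    · simp only [exec_rules, Nat.reduceEqDiff, hset]; exact hs
  refine wp_frame (wp_readLiterals (L := literalsFrom 1 P)
    (Hs := (P ++ [ρ]).map fun ρ => ρ.head + 1) (l := ρ.pos) ?_ ?_ ?_) ?_
  · simp only [exec_rules, Nat.reduceEqDiff]; rw [e0]; exact h0
  · simp only [exec_rules, Nat.reduceEqDiff]; exact hP1
  · simp only [exec_rules, Nat.reduceEqDiff, a0, e3]; exact hin1
  rintro ⟨r₂, A₂, o₂, t₂⟩ ⟨hr₂, hA₂, -⟩ ⟨g1, g2, g3, g4⟩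
  simp only [exec_rules, Nat.reduceEqDiff] at hr₂ hA₂ g1 g2 g3 g4 ⊢
  have f0 := hr₂ rZ (by decide)
  have f4 := hr₂ rR (by decide)
  have b0 := hA₂ 0 (by decide)
  have b4 := hA₂ aTl (by decide)
  simp only [exec_rules, Nat.reduceEqDiff] at f0 f4 b0 b4
  refine wp_frame (wp_readLiterals (L := literalsFrom 1 P ++
    ρ.pos.map fun a => (r rR + 1, 1, a + 1))
    (Hs := (P ++ [ρ]).map fun ρ => ρ.head + 1) (l := ρ.neg) ?_ ?_ ?_) ?_
  · simp only [exec_rules, Nat.reduceEqDiff]; rw [f0, e0]; exact h0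
  · simp only [exec_rules, Nat.reduceEqDiff]
    obtain ⟨c1, c2, c3, c4, c5, c6, c7, c8⟩ := g1
    rw [e4] at c1 c2 c7 c8
    constructor <;> try simp only [exec_rules, Nat.reduceEqDiff]
    all_goals assumption
  · simp only [exec_rules, Nat.reduceEqDiff, b0, a0, g2, e3]
    exact hin2
  rintro ⟨r₃, A₃, o₃, t₃⟩ ⟨hr₃, hA₃, -⟩ ⟨k1, k2, -, k4⟩
  simp only [exec_rules, Nat.reduceEqDiff] at hr₃ hA₃ k1 k2 k4 ⊢
  have d4 := hr₃ rR (by decide)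
  have l4 := hA₃ aTl (by decide)
  simp only [exec_rules, Nat.reduceEqDiff] at d4 l4
  refine ⟨⟨?_, ?_, ?_⟩, ?_, ?_, ?_⟩
  · simp only [List.length_append, List.length_singleton, d4, f4, e4, hm]
  · rw [literalsFrom_append]
    simp only [literalsFrom, List.append_nil]
    rw [f4, e4] at k1
    rw [hm, Nat.add_comm 1]
    rwa [List.append_assoc] at k1
  · intro i hi
    rw [l4, b4, a4, f4, e4, g3]
    rw [d4, f4, e4] at hi
    by_cases h : i = r rR
    · subst h
      rw [List.getElem?_append_right hm.le, hm]
      simp [tailCode]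
    · rw [List.getElem?_append_left (by omega), htl i (by omega),
        Function.update_of_ne (by omega)]
  · rw [d4, f4, e4]
  · rw [k2, g2, e3]; omega
  · omega

theorem size_append (P Q : Program) : size (P ++ Q) = size P + size Q := by
  simp [size]

/-- The head occurrence pays for the 30 steps of a rule and the loop test, and every body occurrence
for its 21 steps. -/
theorem wp_readProgram (P : Program) :
    wp readProgram (fun σ =>
      ReadInv σ.arr (σ.reg rN) (σ.reg rO) (σ.reg rM) P ∧ σ.time ≤ 3 + 31 * size P)
      (startState P) := by
  have hin := input_getD (encode P) 0 [] rfl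
  rw [encode] at hin
  obtain ⟨hlen, hin⟩ := hin
  simp only [List.nil_append, List.getD_cons_zero] at hlen hin
  rw [startState]
  simp only [readProgram, exec_rules, Nat.reduceEqDiff, if_true, encode, List.getD_cons_zero]
  refine wp_loop (fun σ => ∃ P₁ P₂, P = P₁ ++ P₂ ∧ σ.reg rM = P.length ∧ σ.reg rZ = 0 ∧
      ReadInv σ.arr (σ.reg rN) (σ.reg rO) (σ.reg rR) P₁ ∧
      Input (σ.arr 0) (σ.reg rP) (P₂.flatMap fun r =>
        r.head :: r.pos.length :: (r.pos ++ r.neg.length :: r.neg)) ∧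
      σ.time ≤ 2 + 31 * size P₁) (2 + 31 * size P) ?_ ?_ ?_ ?_
  · rintro σ ⟨P₁, P₂, rfl, -, -, -, -, h⟩
    rw [size_append]
    omega
  · refine ⟨[], P, rfl, by simp, by simp, ⟨by simp, ?_, by simp⟩, ?_, by simp⟩
    · refine ⟨rfl, by simp, fun x => ⟨[], rfl, by simp, ?_⟩, by simp, by simp,
        fun x => ⟨[], rfl, by simp, ?_⟩, ⟨by simp, by simp [literalsFrom]⟩,
        by simp [literalsFrom]⟩
      · intro i; simp; omega
      · intro i; simp; omega
    · simpa [exec_rules] using hin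
  · rintro σ ⟨P₁, P₂, rfl, h1, h2, h3, h4, h5⟩ hb
    have hb' : σ.reg rR < σ.reg rM := hb
    rw [h1, ← h3.len, List.length_append] at hb'
    obtain _ | ⟨ρ, P₂⟩ := P₂
    · simp at hb'
    rw [List.flatMap_cons, Input.append] at h4
    refine wp_frame (wp_readRule (σ := σ.tick) h2 h3 h4.1) ?_
    rintro σ' hf ⟨g1, g2, g3, g4⟩
    refine ⟨P₁ ++ [ρ], P₂, by simp, ?_, ?_, g1, ?_, ?_⟩
    · rw [hf.reg rM (by decide)]; exact h1
    · rw [hf.reg rZ (by decide)]; exact h2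
    · rw [hf.arr 0 (by decide), g3]
      have e : σ.tick.reg rP + (ρ.pos.length + ρ.neg.length + 3) = σ.reg rP +
          (ρ.head :: ρ.pos.length :: (ρ.pos ++ ρ.neg.length :: ρ.neg)).length := by
        change σ.reg rP + _ = σ.reg rP + _
        simp only [List.length_cons, List.length_append]
        omega
      rw [e]
      exact h4.2
    · have : σ.tick.time = σ.time + 1 := rfl
      have e : size [ρ] = 1 + ρ.pos.length + ρ.neg.length := by simp [size]
      rw [size_append, e]; omega
  · rintro σ ⟨P₁, P₂, rfl, h1, h2, h3, h4, h5⟩ hb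
    have hb' : ¬ σ.reg rR < σ.reg rM := hb
    rw [h1, ← h3.len, List.length_append] at hb'
    obtain rfl : P₂ = [] := List.length_eq_zero_iff.mp (by omega)
    simp only [List.append_nil, State.tick] at h1 ⊢
    rw [h1]
    refine ⟨by rw [h3.len]; exact h3, by omega⟩

/-! ### The tables of a program -/

/-- The tables describe the rule `ρ` under the number `r`. -/
structure Represents (A : ℕ → ℕ → ℕ) (N : ℕ) (ρ : Rule) (r : ℕ) : Prop where
  head : A aHd r = ρ.head + 1
  pos : ∀ a, a ∈ ρ.pos ↔ ∃ o, 1 ≤ o ∧ o ≤ N ∧ A aRule o = r ∧ A aSgn o = 1 ∧ A aAtm o = a + 1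
  neg : ∀ a, a ∈ ρ.neg ↔ ∃ o, 1 ≤ o ∧ o ≤ N ∧ A aRule o = r ∧ A aSgn o = 0 ∧ A aAtm o = a + 1
  tail : (A aTl r = 0 ∧ ρ.pos = []) ∨ ∃ a ∈ ρ.pos, A aTl r = a + 1

/-- The tables describe the program `P`, with `m` rules, `N` body literals and the codes `V`. -/
structure Tables (P : Program) (A : ℕ → ℕ → ℕ) (m N : ℕ) (V : Finset ℕ) : Prop where
  exists_num : ∀ ρ ∈ P, ∃ r, 1 ≤ r ∧ r ≤ m ∧ Represents A N ρ r
  exists_rule : ∀ r, 1 ≤ r → r ≤ m → ∃ ρ ∈ P, Represents A N ρ r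
  omap : MultiMap N (A aAtm) (A aOfst) (A aOnext)
  lit : ∀ o, 1 ≤ o → o ≤ N → 1 ≤ A aRule o ∧ A aRule o ≤ m ∧ A aSgn o ≤ 1 ∧ A aAtm o ∈ V
  codes : ∀ x, x ∈ V ↔ ∃ a ∈ atoms P, x = a + 1
  size : N + m = size P

theorem Tables.congr {P : Program} {A A' : ℕ → ℕ → ℕ} {m N : ℕ} {V : Finset ℕ}
    (h : Tables P A m N V) (hA : ∀ k ∈ [aHd, aTl, aRule, aSgn, aAtm, aOnext, aOfst], A' k = A k) :
    Tables P A' m N V := by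
  simp only [List.mem_cons, List.not_mem_nil, or_false, forall_eq_or_imp, forall_eq] at hA
  obtain ⟨h3, h4, h7, h8, h9, h10, h11⟩ := hA
  have hrep : ∀ ρ r, Represents A N ρ r → Represents A' N ρ r := by
    rintro ρ r ⟨g1, g2, g3, g4⟩
    constructor <;> simpa only [h3, h4, h7, h8, h9]
  refine ⟨fun ρ hρ => ?_, fun r h1 h2 => ?_, by rw [h9, h10, h11]; exact h.omap,
    by rw [h7, h8, h9]; exact h.lit, h.codes, h.size⟩
  · obtain ⟨r, h1, h2, h3⟩ := h.exists_num ρ hρ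
    exact ⟨r, h1, h2, hrep _ _ h3⟩
  · obtain ⟨ρ, h3, h4⟩ := h.exists_rule r h1 h2
    exact ⟨ρ, h3, hrep _ _ h4⟩

theorem mem_literalsFrom {k : ℕ} {P : Program} {r s x : ℕ} :
    (r, s, x) ∈ literalsFrom k P ↔ ∃ i ρ, P[i]? = some ρ ∧ r = k + i ∧
      ((s = 1 ∧ ∃ a ∈ ρ.pos, x = a + 1) ∨ (s = 0 ∧ ∃ a ∈ ρ.neg, x = a + 1)) := by
  induction P generalizing k with
  | nil => simp [literalsFrom]
  | cons ρ P ih =>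
    simp only [literalsFrom, List.mem_append, List.mem_map, Prod.mk.injEq, ih]
    constructor
    · rintro ((⟨a, ha, rfl, rfl, rfl⟩ | ⟨a, ha, rfl, rfl, rfl⟩) | ⟨i, ρ', h1, rfl, h2⟩)
      · exact ⟨0, ρ, rfl, rfl, Or.inl ⟨rfl, a, ha, rfl⟩⟩
      · exact ⟨0, ρ, rfl, rfl, Or.inr ⟨rfl, a, ha, rfl⟩⟩
      · exact ⟨i + 1, ρ', h1, by omega, h2⟩
    · rintro ⟨_ | i, ρ', h1, rfl, h2⟩
      · obtain rfl : ρ = ρ' := by simpa using h1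
        rcases h2 with ⟨rfl, a, ha, rfl⟩ | ⟨rfl, a, ha, rfl⟩
        · exact Or.inl (Or.inl ⟨a, ha, rfl, rfl, rfl⟩)
        · exact Or.inl (Or.inr ⟨a, ha, rfl, rfl, rfl⟩)
      · exact Or.inr ⟨i, ρ', by simpa using h1, by omega, h2⟩

theorem length_literalsFrom (k : ℕ) (P : Program) :
    (literalsFrom k P).length + P.length = size P := by
  induction P generalizing k with
  | nil => rfl
  | cons ρ P ih =>
    have := ih (k + 1)
    simp only [size, List.map_cons, List.sum_cons, literalsFrom, List.length_append,
      List.length_map, List.length_cons] at this ⊢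
    omega

/-- Forgets the order of the input: henceforth only the correspondence between numbers of rules and
occurrences and the program matters. -/
theorem ReadInv.tables {A : ℕ → ℕ → ℕ} {n N m : ℕ} {P : Program} (h : ReadInv A n N m P) :
    ∃ V, Tables P A m N V ∧ Enumerates (A aVarr) n V ∧ ∀ r, 1 ≤ r → r ≤ m → A aHd r ∈ V := by
  obtain ⟨hlen, hp, htl⟩ := h
  have hmem : ∀ r s x, (r, s, x) ∈ literalsFrom 1 P ↔
      ∃ o, 1 ≤ o ∧ o ≤ N ∧ A aRule o = r ∧ A aSgn o = s ∧ A aAtm o = x := by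
    intro r s x
    rw [List.mem_iff_getElem?]
    constructor
    · rintro ⟨i, hi⟩
      have hiN : i < N := by
        rw [← hp.len]; exact (List.getElem?_eq_some_iff.mp hi).1
      rw [hp.occ i hiN] at hi
      simp only [Option.some.injEq, Prod.mk.injEq] at hi
      exact ⟨i + 1, by omega, by omega, hi⟩
    · rintro ⟨o, h1, h2, h3⟩
      refine ⟨o - 1, ?_⟩
      rw [hp.occ _ (by omega), Nat.sub_add_cancel h1, h3.1, h3.2.1, h3.2.2]
  have hrep : ∀ i ρ, P[i]? = some ρ → i < m ∧ Represents A N ρ (i + 1) := by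
    intro i ρ hi
    have him : i < m := by
      rw [← hlen]; exact (List.getElem?_eq_some_iff.mp hi).1
    have hlit : ∀ s x, (i + 1, s, x) ∈ literalsFrom 1 P ↔
        ((s = 1 ∧ ∃ a ∈ ρ.pos, x = a + 1) ∨ (s = 0 ∧ ∃ a ∈ ρ.neg, x = a + 1)) := by
      intro s x
      rw [mem_literalsFrom]
      constructor
      · rintro ⟨j, ρ', h1, h2, h3⟩
        obtain rfl : i = j := by omega
        rw [hi] at h1
        cases h1
        exact h3
      · exact fun h => ⟨i, ρ, hi, by omega, h⟩
    refine ⟨him, ⟨?_, fun a => ?_, fun a => ?_, ?_⟩⟩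
    · have := hp.heads i (by simpa [hlen] using him)
      rw [List.getElem?_map, hi] at this
      simpa using this.symm
    · rw [← hmem, hlit]; simp
    · rw [← hmem, hlit]; simp
    · have := htl i him
      rw [hi] at this
      simp only [Option.map_some, Option.some.injEq, tailCode] at this
      rw [← this]
      rcases hl : ρ.pos.getLast? with _ | a
      · left; simpa using hl
      · right; exact ⟨a, List.mem_of_getLast? hl, by simp⟩
  have hcodes : ∀ x, x ∈ (P.map (fun ρ : Rule => ρ.head + 1) ++
      (literalsFrom 1 P).map fun o => o.2.2).toFinset ↔ ∃ a ∈ atoms P, x = a + 1 := by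
    intro x
    simp only [List.mem_toFinset, List.mem_append, List.mem_map, Prod.exists]
    constructor
    · rintro (⟨ρ, hρ, rfl⟩ | ⟨r, s, y, hL, rfl⟩)
      · exact ⟨_, ⟨ρ, hρ, Or.inl rfl⟩, rfl⟩
      · obtain ⟨i, ρ, hi, -, ⟨-, a, ha, rfl⟩ | ⟨-, a, ha, rfl⟩⟩ := mem_literalsFrom.mp hL
        · exact ⟨a, ⟨ρ, List.mem_of_getElem? hi, Or.inr (Or.inl ha)⟩, rfl⟩
        · exact ⟨a, ⟨ρ, List.mem_of_getElem? hi, Or.inr (Or.inr ha)⟩, rfl⟩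
    · rintro ⟨a, ⟨ρ, hρ, ha⟩, rfl⟩
      obtain ⟨i, hi⟩ := List.mem_iff_getElem?.mp hρ
      rcases ha with rfl | ha | ha
      · exact Or.inl ⟨ρ, hρ, rfl⟩
      · exact Or.inr ⟨1 + i, 1, _, mem_literalsFrom.mpr
          ⟨i, ρ, hi, rfl, Or.inl ⟨rfl, a, ha, rfl⟩⟩, rfl⟩
      · exact Or.inr ⟨1 + i, 0, _, mem_literalsFrom.mpr
          ⟨i, ρ, hi, rfl, Or.inr ⟨rfl, a, ha, rfl⟩⟩, rfl⟩
  refine ⟨_, ⟨?_, ?_, hp.omap, ?_, hcodes, ?_⟩, hp.enum, ?_⟩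
  · intro ρ hρ
    obtain ⟨i, hi⟩ := List.mem_iff_getElem?.mp hρ
    obtain ⟨h1, h2⟩ := hrep i ρ hi
    exact ⟨i + 1, by omega, by omega, h2⟩
  · intro r h1 h2
    have hi : P[r - 1]? = some P[r - 1] := List.getElem?_eq_getElem (by omega)
    refine ⟨P[r - 1]'(by omega), List.getElem_mem _, ?_⟩
    have := (hrep _ _ hi).2
    rwa [Nat.sub_add_cancel h1] at this
  · intro o h1 h2
    have := (hmem _ _ _).mpr ⟨o, h1, h2, rfl, rfl, rfl⟩
    obtain ⟨i, ρ, hi, hr, hs⟩ := mem_literalsFrom.mp this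
    have him := (hrep i ρ hi).1
    refine ⟨by omega, by omega, ?_, ?_⟩
    · rcases hs with hs | hs <;> omega
    · rw [List.mem_toFinset, List.mem_append, List.mem_map]
      exact Or.inr (List.mem_map.mpr ⟨_, this, rfl⟩)
  · rw [← hp.len, ← hlen, length_literalsFrom]
  · intro r h1 h2
    have hi : P[r - 1]? = some P[r - 1] := List.getElem?_eq_getElem (by omega)
    have := (hrep _ _ hi).2
    rw [Nat.sub_add_cancel h1] at this
    rw [this.head, hcodes]
    exact ⟨_, ⟨_, List.getElem_mem (by omega), Or.inl rfl⟩, rfl⟩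

/-! ## The lists of tails -/

/-- The segments `start x, …, end x - 1` hold the entries of the lists of tails that belong to the
rules in `R`; an entry stands for all rules with the same head and the same tail. -/
structure ListInv (A : ℕ → ℕ → ℕ) (E : ℕ) (V R : Finset ℕ) : Prop where
  eof : ∀ r ∈ R, A aEof r < E ∧ A aOwn (A aEof r) = A aHd r ∧ A aEtl (A aEof r) = A aTl r
  uniq : ∀ e < E, ∀ e' < E, A aOwn e = A aOwn e' → A aEtl e = A aEtl e' → e = e'
  gcnt : ∀ e < E, A aGcnt e = (R.filter fun r => A aEof r = e).card
  loc : ∀ e < E, 0 < A aGcnt e → A aOwn e ∈ V ∧ A aStart (A aOwn e) ≤ A aLoc e ∧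
    A aLoc e < A aEnd (A aOwn e) ∧ A aEnt (A aLoc e) = e
  seg : ∀ x ∈ V, A aDeg x + A aStart x = A aEnd x
  ent : ∀ x ∈ V, ∀ p, A aStart x ≤ p → p < A aEnd x →
    A aEnt p < E ∧ A aOwn (A aEnt p) = x ∧ A aLoc (A aEnt p) = p ∧ 0 < A aGcnt (A aEnt p)

/-- The invariant of the construction of the segments. -/
structure BuildInv (A : ℕ → ℕ → ℕ) (E : ℕ) (V R : Finset ℕ) : Prop where
  eof : ∀ r ∈ R, A aEof r < E ∧ A aOwn (A aEof r) = A aHd r ∧ A aEtl (A aEof r) = A aTl r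
  uniq : ∀ e < E, ∀ e' < E, A aOwn e = A aOwn e' → A aEtl e = A aEtl e' → e = e'
  gcnt : ∀ e, A aGcnt e = (R.filter fun r => A aEof r = e).card
  pos : ∀ e < E, 0 < A aGcnt e
  ident : ∀ e < E, A aEnt e = e ∧ A aLoc e = e
  own : ∀ e < E, A aOwn e ∈ V ∧ A aStart (A aOwn e) ≤ e ∧ e < A aEnd (A aOwn e)
  seg : ∀ x ∈ V, A aDeg x + A aStart x = A aEnd x ∧ A aEnd x ≤ E
  ent : ∀ x ∈ V, ∀ p, A aStart x ≤ p → p < A aEnd x → A aOwn p = x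
  deg : ∀ x, x ∉ V → A aDeg x = 0
  mark : ∀ t, A aMark t = 0 ∨ A aMark t ∈ V

/-- When the segments are new, entry `e` sits at place `e`; `aEnt` and `aLoc` are inverse to each
other because both are identities. -/
theorem BuildInv.listInv {A : ℕ → ℕ → ℕ} {E : ℕ} {V R : Finset ℕ} (h : BuildInv A E V R) :
    ListInv A E V R where
  eof := h.eof
  uniq := h.uniq
  gcnt := fun e _ => h.gcnt e
  loc := by
    intro e he _
    obtain ⟨h1, h2⟩ := h.ident e he
    rw [h2, h1]
    exact ⟨(h.own e he).1, (h.own e he).2.1, (h.own e he).2.2, rfl⟩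
  seg := fun x hx => (h.seg x hx).1
  ent := by
    intro x hx p h1 h2
    have hp : p < E := h2.trans_le (h.seg x hx).2
    obtain ⟨h3, h4⟩ := h.ident p hp
    rw [h3, h4]
    exact ⟨hp, h.ent x hx p h1 h2, rfl, h.pos p hp⟩

/-- The entries of the current atom `x` can be found by their tails. -/
structure StampInv (A : ℕ → ℕ → ℕ) (E x : ℕ) : Prop where
  last : A aEnd x = E
  slot : ∀ t, A aMark t = x → A aSlot t < E ∧ A aOwn (A aSlot t) = x ∧ A aEtl (A aSlot t) = t
  find : ∀ e < E, A aOwn e = x → A aMark (A aEtl e) = x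

theorem card_filter_insert_update {R : Finset ℕ} {r : ℕ} (hr : r ∉ R) (f : ℕ → ℕ) (v e : ℕ) :
    ((insert r R).filter fun i => Function.update f r v i = e).card =
      (R.filter fun i => f i = e).card + if v = e then 1 else 0 := by
  have h2 : (R.filter fun i => Function.update f r v i = e) = R.filter fun i => f i = e := by
    apply Finset.filter_congr
    intro i hi
    rw [Function.update_of_ne]
    rintro rfl
    exact hr hi
  rw [Finset.filter_insert, Function.update_self, h2]
  split_ifs
  · rw [Finset.card_insert_of_notMem]
    simp [hr]
  · rfl

/-- A tail met before under the same head raises the counter of its entry. Otherwise the entry `E`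
is appended to the segment of `x`, which ends at `E`, so no other segment is affected. -/
theorem wp_buildRule {σ : State} {V R : Finset ℕ} {r x : ℕ} (hr0 : σ.reg rR = r)
    (hx0 : σ.reg rX = x) (hB : BuildInv σ.arr (σ.reg rE) V R) (hS : StampInv σ.arr (σ.reg rE) x)
    (hx : x ∈ V) (hpos : 0 < x) (hr : r ∉ R) (hhd : σ.arr aHd r = x) :
    wp buildRule (fun σ' => BuildInv σ'.arr (σ'.reg rE) V (insert r R) ∧
      StampInv σ'.arr (σ'.reg rE) x ∧ σ'.reg rR = σ.arr aHnext r ∧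
      σ'.time ≤ σ.time + 20) σ := by
  obtain ⟨reg, A, o, t⟩ := σ
  dsimp only at *
  simp only [buildRule, exec_rules, Nat.reduceEqDiff, hr0, hx0]
  obtain ⟨b1, b2, b3, b4, b5, b6, b7, b8, b9, b10⟩ := hB
  obtain ⟨s1, s2, s3⟩ := hS
  generalize hE : reg rE = E at *
  have hfresh : A aGcnt E = 0 := by
    rw [b3, Finset.card_eq_zero, Finset.filter_eq_empty_iff]
    intro r' hr' he
    have := (b1 r' hr').1
    omega
  refine ⟨fun hm => ?_, fun hm => ?_⟩
  · obtain ⟨t1, t2, t3⟩ := s2 _ hm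
    refine ⟨⟨?_, ?_, ?_, ?_, ?_, ?_, ?_, ?_, ?_, ?_⟩, ⟨?_, ?_, ?_⟩, trivial, by omega⟩ <;>
      simp only [exec_rules, Nat.reduceEqDiff] <;> try assumption
    · intro r' hr'
      by_cases h : r' = r
      · subst h
        rw [Function.update_self, hhd]
        exact ⟨t1, t2, t3⟩
      · rw [Function.update_of_ne h]
        exact b1 r' ((Finset.mem_insert.mp hr').resolve_left h)
    · intro e
      rw [card_filter_insert_update hr, Function.update_apply, b3, b3]
      by_cases h : e = A aSlot (A aTl r)
      · subst h; simp
      · rw [if_neg h, if_neg (Ne.symm h)]; rfl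
    · intro e he
      rw [Function.update_apply]
      split_ifs
      · omega
      · exact b4 e he
  · refine ⟨⟨?_, ?_, ?_, ?_, ?_, ?_, ?_, ?_, ?_, ?_⟩, ⟨?_, ?_, ?_⟩, trivial, by omega⟩ <;>
      simp only [exec_rules, Nat.reduceEqDiff]
    · intro r' hr'
      by_cases h : r' = r
      · subst h
        simp [hhd]
      · rw [Function.update_of_ne h]
        have := b1 r' ((Finset.mem_insert.mp hr').resolve_left h)
        rw [Function.update_of_ne (by omega), Function.update_of_ne (by omega)]
        exact ⟨by omega, this.2⟩
    · intro e he e' he'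
      simp only [Function.update_apply]
      -- An earlier entry with this head and tail would have left its stamp on the tail.
      have h3 : ∀ e < E, A aOwn e = x → A aEtl e ≠ A aTl r := by
        intro e he h1 h2
        have := s3 e he h1
        rw [h2] at this
        exact hm this
      split_ifs with h1 h2 h2
      · omega
      · exact fun h4 h5 => absurd h5.symm (h3 e' (by omega) h4.symm)
      · exact fun h4 h5 => absurd h5 (h3 e (by omega) h4)
      · exact b2 e (by omega) e' (by omega)
    · intro e
      rw [card_filter_insert_update hr, Function.update_apply, b3, b3]
      by_cases h : e = E
      · subst h; simp
      · rw [if_neg h, if_neg (Ne.symm h)]; rfl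
    · intro e he
      rw [Function.update_apply]
      split_ifs
      · omega
      · exact b4 e (by omega)
    · intro e he
      simp only [Function.update_apply]
      split_ifs with h
      · exact ⟨h.symm, h.symm⟩
      · exact b5 e (by omega)
    · intro e he
      by_cases h : e = E
      · subst h
        simp only [Function.update_self]
        have := b7 x hx
        exact ⟨hx, by omega, by omega⟩
      · obtain ⟨c1, c2, c3⟩ := b6 e (by omega)
        rw [Function.update_of_ne h]
        refine ⟨c1, c2, ?_⟩
        rw [Function.update_apply]
        split_ifs
        · omega
        · exact c3
    · intro y hy
      have := b7 y hy
      have := b7 x hx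
      simp only [Function.update_apply]
      split_ifs with h
      · subst h; omega
      · omega
    · intro y hy p h1 h2
      by_cases h : p = E
      · subst h
        rw [Function.update_self]
        by_contra hc
        rw [Function.update_of_ne (Ne.symm hc)] at h2
        have := b7 y hy
        omega
      · rw [Function.update_of_ne h]
        by_cases hyx : y = x
        · subst hyx
          rw [Function.update_self] at h2
          exact b8 y hy p h1 (by omega)
        · rw [Function.update_of_ne hyx] at h2
          exact b8 y hy p h1 h2
    · intro y hy
      rw [Function.update_of_ne (by rintro rfl; exact hy hx)]
      exact b9 y hy
    · intro y
      rw [Function.update_apply]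
      split_ifs
      · exact Or.inr hx
      · exact b10 y
    · intro y hy
      by_cases h : y = A aTl r
      · subst h; simp
      · rw [Function.update_of_ne h] at hy ⊢
        have := s2 y hy
        rw [Function.update_of_ne (by omega), Function.update_of_ne (by omega)]
        exact ⟨by omega, this.2⟩
    · intro e he h1
      by_cases h : e = E
      · subst h; simp
      · rw [Function.update_of_ne h] at h1 ⊢
        rw [Function.update_apply]
        split_ifs
        · rfl
        · exact s3 e (by omega) h1

theorem wp_buildHead {σ : State} {m : ℕ} {V R : Finset ℕ} {x : ℕ} (h0 : σ.reg rZ = 0)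
    (hx : σ.arr aVarr (σ.reg rJ) = x) (hB : BuildInv σ.arr (σ.reg rE) V R) (hxV : x ∉ V)
    (hpos : 0 < x) (hmap : MultiMap m (σ.arr aHd) (σ.arr aHfst) (σ.arr aHnext))
    (hR : ∀ r, r ∈ R ↔ 1 ≤ r ∧ r ≤ m ∧ σ.arr aHd r ∈ V) :
    wp buildHead (fun σ' => ∃ R', BuildInv σ'.arr (σ'.reg rE) (insert x V) R' ∧
      (∀ r, r ∈ R' ↔ 1 ≤ r ∧ r ≤ m ∧ σ.arr aHd r ∈ insert x V) ∧
      σ'.reg rJ = σ.reg rJ + 1 ∧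
      σ'.time + 21 * R.card ≤ σ.time + 6 + 21 * R'.card) σ := by
  obtain ⟨reg, A, o, t⟩ := σ
  dsimp only at *
  obtain ⟨l, hch, hnd, hl⟩ := hmap x
  simp only [buildHead, exec_rules, Nat.reduceEqDiff, hx]
  obtain ⟨b1, b2, b3, b4, b5, b6, b7, b8, b9, b10⟩ := hB
  generalize hE : reg rE = E at *
  have hdis : ∀ r ∈ l, r ∉ R := by
    intro r hr hrR
    have h1 := (hl r).mp hr
    have h2 := (hR r).mp hrR
    rw [h1.2.2] at h2
    exact hxV h2.2.2
  have hne : ∀ e < E, A aOwn e ≠ x := fun e he h => hxV (h ▸ (b6 e he).1)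
  refine wp_loop (fun σ => ∃ l₁ l₂, l = l₁ ++ l₂ ∧ Chain (A aHnext) (σ.reg rR) l₂ ∧
      BuildInv σ.arr (σ.reg rE) (insert x V) (R ∪ l₁.toFinset) ∧ StampInv σ.arr (σ.reg rE) x ∧
      σ.reg rX = x ∧ σ.reg rZ = 0 ∧ σ.arr aHd = A aHd ∧ σ.arr aHnext = A aHnext ∧
      σ.reg rJ = reg rJ ∧
      σ.time ≤ t + 4 + 21 * l₁.length) (t + 4 + 21 * l.length) ?_ ?_ ?_ ?_
  · rintro σ ⟨l₁, l₂, rfl, -, -, -, -, -, -, -, -, h⟩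
    rw [List.length_append]; omega
  · refine ⟨[], l, rfl, ?_, ?_, ?_, ?_, ?_, ?_, ?_, ?_, by simp⟩ <;>
      simp only [exec_rules, Nat.reduceEqDiff]
    · exact hch
    · simp only [List.toFinset_nil, Finset.union_empty, hE]
      refine ⟨?_, ?_, ?_, ?_, ?_, ?_, ?_, ?_, ?_, ?_⟩ <;>
        simp only [exec_rules, Nat.reduceEqDiff] <;> try assumption
      · intro e he
        obtain ⟨c1, c2, c3⟩ := b6 e he
        rw [Function.update_of_ne (hne e he), Function.update_of_ne (hne e he)]
        exact ⟨Finset.mem_insert_of_mem c1, c2, c3⟩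
      · intro y hy
        by_cases h : y = x
        · subst h
          simp [b9 y hxV]
        · rw [Function.update_of_ne h, Function.update_of_ne h]
          exact b7 y ((Finset.mem_insert.mp hy).resolve_left h)
      · intro y hy p
        by_cases h : y = x
        · subst h
          simp only [Function.update_self]
          intro h1 h2; omega
        · rw [Function.update_of_ne h, Function.update_of_ne h]
          exact b8 y ((Finset.mem_insert.mp hy).resolve_left h) p
      · exact fun y hy => b9 y fun h => hy (Finset.mem_insert_of_mem h)
      · exact fun y => (b10 y).imp_right Finset.mem_insert_of_mem
    · refine ⟨?_, ?_, ?_⟩ <;> simp only [exec_rules, Nat.reduceEqDiff, hE]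
      -- No stamp of `x` is present yet: stamps are zero or heads already treated, and `x` is
      -- positive and not among these.
      · intro y hy
        exfalso
        rcases b10 y with h | h
        · omega
        · exact hxV (hy ▸ h)
      · exact fun e he h => absurd h (hne e he)
    · exact h0
  · rintro σ ⟨l₁, l₂, rfl, h1, h2, h3, h4, h5, h6, h7, h8, h9⟩ hb
    obtain _ | ⟨r, l₂⟩ := l₂
    · have e : σ.reg rR = 0 := h1
      have hb' : σ.reg rZ < σ.reg rR := hb
      omega
    obtain ⟨e1, e2, e3⟩ := h1
    have hrl : r ∉ R ∪ l₁.toFinset := by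
      rw [Finset.mem_union, not_or, List.mem_toFinset]
      refine ⟨hdis r (by simp), ?_⟩
      intro hr
      exact (List.nodup_append.mp hnd).2.2 r hr r (by simp) rfl
    refine wp_frame (wp_buildRule (σ := σ.tick) (V := insert x V) (R := R ∪ l₁.toFinset)
      (r := r) (x := x) e1 h4 h2 h3 (Finset.mem_insert_self _ _) hpos hrl ?_) ?_
    · change σ.arr aHd r = x
      rw [h6]
      exact ((hl r).mp (by simp)).2.2
    rintro σ' hf ⟨g1, g2, g3, g4⟩
    refine ⟨l₁ ++ [r], l₂, by simp, ?_, ?_, g2, ?_, ?_, ?_, ?_, ?_, ?_⟩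
    · rw [g3]
      change Chain (A aHnext) (σ.arr aHnext r) l₂
      rw [h7]; exact e3
    · convert g1 using 1
      simp [Finset.union_insert]
    · rw [hf.reg rX (by decide)]; exact h4
    · rw [hf.reg rZ (by decide)]; exact h5
    · rw [hf.arr aHd (by decide)]; exact h6
    · rw [hf.arr aHnext (by decide)]; exact h7
    · rw [hf.reg rJ (by decide)]; exact h8
    · have : σ.tick.time = σ.time + 1 := rfl
      rw [List.length_append, List.length_singleton]; omega
  · rintro ⟨r', A', o', t'⟩ ⟨l₁, l₂, rfl, h1, h2, h3, h4, h5, h6, h7, h8, h9⟩ hb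
    obtain _ | ⟨r, l₂⟩ := l₂
    · simp only [exec_rules, Nat.reduceEqDiff] at h2 h8 h9 ⊢
      rw [List.append_nil] at *
      refine ⟨_, h2, fun r => ?_, by rw [h8], ?_⟩
      · rw [Finset.mem_union, List.mem_toFinset, hR, hl, Finset.mem_insert]
        tauto
      · rw [Finset.card_union_of_disjoint, List.toFinset_card_of_nodup hnd]
        · omega
        · rw [Finset.disjoint_right]
          intro r hr
          exact hdis r (List.mem_toFinset.mp hr)
    · obtain ⟨e1, e2, e3⟩ := h1
      have hb' : ¬ r' rZ < r' rR := hb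
      simp only at e1 h5
      omega

theorem wp_buildLists {σ : State} {m : ℕ} {V : Finset ℕ} (h0 : σ.reg rZ = 0)
    (hE : σ.reg rE = 0) (hA : ∀ k, aDeg ≤ k → ∀ i, σ.arr k i = 0)
    (hV : Enumerates (σ.arr aVarr) (σ.reg rN) V) (hpos : ∀ x ∈ V, 0 < x)
    (hhd : ∀ r, 1 ≤ r → r ≤ m → σ.arr aHd r ∈ V)
    (hmap : MultiMap m (σ.arr aHd) (σ.arr aHfst) (σ.arr aHnext)) :
    wp buildLists (fun σ' => ListInv σ'.arr (σ'.reg rE) V (Finset.Icc 1 m) ∧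
      σ'.time ≤ σ.time + 2 + 7 * σ.reg rN + 21 * m) σ := by
  obtain ⟨reg, A, o, t⟩ := σ
  dsimp only at *
  simp only [buildLists, exec_rules, Nat.reduceEqDiff]
  have hmono : ∀ (R : Finset ℕ) (W : Finset ℕ), (∀ r, r ∈ R ↔ 1 ≤ r ∧ r ≤ m ∧ A aHd r ∈ W) →
      R.card ≤ m := by
    intro R W h
    have : R ⊆ Finset.Icc 1 m := fun r hr =>
      Finset.mem_Icc.mpr ⟨((h r).mp hr).1, ((h r).mp hr).2.1⟩
    simpa using Finset.card_le_card this
  refine wp_loop (fun σ => ∃ W R, Enumerates (A aVarr) (σ.reg rJ) W ∧ σ.reg rJ ≤ reg rN ∧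
      BuildInv σ.arr (σ.reg rE) W R ∧ (∀ r, r ∈ R ↔ 1 ≤ r ∧ r ≤ m ∧ A aHd r ∈ W) ∧
      σ.reg rZ = 0 ∧ σ.reg rN = reg rN ∧ σ.arr aVarr = A aVarr ∧ σ.arr aHd = A aHd ∧
      σ.arr aHfst = A aHfst ∧ σ.arr aHnext = A aHnext ∧
      σ.time ≤ t + 1 + 7 * σ.reg rJ + 21 * R.card) (t + 1 + 7 * reg rN + 21 * m) ?_ ?_ ?_ ?_
  · rintro σ ⟨W, R, -, h1, -, h2, -, -, -, -, -, -, h3⟩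
    have := hmono R W h2
    omega
  · refine ⟨∅, ∅, ?_, ?_, ?_, by simp, ?_, ?_, rfl, rfl, rfl, rfl, ?_⟩ <;>
      simp only [exec_rules, Nat.reduceEqDiff]
    · exact ⟨by simp, by simp⟩
    · omega
    · rw [hE]
      constructor <;> simp [hA]
    · exact h0
    · simp
  · rintro σ ⟨W, R, h1, h2, h3, h4, h5, h6, h7, h8, h9, h10, h11⟩ hb
    have hb' : σ.reg rJ < σ.reg rN := hb
    rw [h6] at hb'
    have hxW : A aVarr (σ.reg rJ) ∉ W := by
      rw [h1.mem]
      rintro ⟨i, hi, e⟩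
      have := hV.inj i (by omega) _ hb' e
      omega
    have hxV : A aVarr (σ.reg rJ) ∈ V := (hV.mem _).mpr ⟨_, hb', rfl⟩
    refine wp_frame (wp_buildHead (σ := σ.tick) (m := m) (x := A aVarr (σ.reg rJ)) h5 ?_ h3 hxW
      (hpos _ hxV) ?_ ?_) ?_
    · change σ.arr aVarr (σ.reg rJ) = _
      rw [h7]
    · change MultiMap m (σ.arr aHd) (σ.arr aHfst) (σ.arr aHnext)
      rw [h8, h9, h10]; exact hmap
    · change ∀ r, r ∈ R ↔ 1 ≤ r ∧ r ≤ m ∧ σ.arr aHd r ∈ W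
      rw [h8]; exact h4
    rintro σ' hf ⟨R', g1, g2, g3, g4⟩
    have e1 : σ'.reg rJ = σ.reg rJ + 1 := g3
    have e2 : σ.tick.time = σ.time + 1 := rfl
    refine ⟨_, R', ?_, ?_, g1, ?_, ?_, ?_, ?_, ?_, ?_, ?_, ?_⟩
    · rw [e1]
      have := h1.insert hxW
      rwa [Function.update_eq_self] at this
    · omega
    · intro r
      rw [g2, show σ.tick.arr aHd = A aHd from h8]
    · rw [hf.reg rZ (by decide)]; exact h5
    · rw [hf.reg rN (by decide)]; exact h6
    · rw [hf.arr aVarr (by decide)]; exact h7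
    · rw [hf.arr aHd (by decide)]; exact h8
    · rw [hf.arr aHfst (by decide)]; exact h9
    · rw [hf.arr aHnext (by decide)]; exact h10
    · omega
  · rintro σ ⟨W, R, h1, h2, h3, h4, h5, h6, h7, h8, h9, h10, h11⟩ hb
    have hb' : ¬ σ.reg rJ < σ.reg rN := hb
    have hj : σ.reg rJ = reg rN := by omega
    have hW : W = V := by
      ext x
      rw [h1.mem, hV.mem, hj]
    subst hW
    have hR : R = Finset.Icc 1 m := by
      ext r
      rw [h4, Finset.mem_Icc]
      exact ⟨fun h => ⟨h.1, h.2.1⟩, fun h => ⟨h.1, h.2, hhd r h.1 h.2⟩⟩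
    subst hR
    refine ⟨h3.listInv, ?_⟩
    have e2 : σ.tick.time = σ.time + 1 := rfl
    simp only [Nat.card_Icc, Nat.add_sub_cancel] at h11
    omega

/-! ## Propagation of truth values -/

/-- The queue holds an event `(a + 1, 1)` for every true atom, and `(a + 1, 0)` for every false
atom. -/
structure QueueInv (A : ℕ → ℕ → ℕ) (q : ℕ) (V T F : Finset ℕ) : Prop where
  arrT : A 1 = Set.indicator ↑T 1
  arrF : A 2 = Set.indicator ↑F 1
  card : q = T.card + F.card
  inj : ∀ i < q, ∀ j < q, A aQa i = A aQa j → A aQs i = A aQs j → i = j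
  mem : ∀ x s, (∃ i < q, A aQa i = x ∧ A aQs i = s) ↔
    (s = 1 ∧ ∃ a ∈ T, x = a + 1) ∨ (s = 0 ∧ ∃ a ∈ F, x = a + 1)
  codesT : ∀ a ∈ T, a + 1 ∈ V
  codesF : ∀ a ∈ F, a + 1 ∈ V

theorem QueueInv.congr {A A' : ℕ → ℕ → ℕ} {q : ℕ} {V T F : Finset ℕ} (h : QueueInv A q V T F)
    (h1 : A' 1 = A 1) (h2 : A' 2 = A 2) (h3 : A' aQa = A aQa) (h4 : A' aQs = A aQs) :
    QueueInv A' q V T F := by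
  obtain ⟨g1, g2, g3, g4, g5, g6, g7⟩ := h
  constructor <;> simpa only [h1, h2, h3, h4]

theorem indicator_insert (T : Finset ℕ) (a : ℕ) :
    Function.update (Set.indicator (↑T : Set ℕ) (1 : ℕ → ℕ)) a 1 =
      Set.indicator (↑(insert a T) : Set ℕ) 1 := by
  funext b
  by_cases h : b = a
  · subst h; simp
  · rw [Function.update_of_ne h]
    simp [Set.indicator_apply, h]

theorem indicator_eq_zero {T : Finset ℕ} {a : ℕ} :
    Set.indicator (↑T : Set ℕ) (1 : ℕ → ℕ) a = 0 ↔ a ∉ T := by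
  simp

/-- An atom enters the queue only when it is new to `T`, so events never repeat and the queue stays
within `2 * V.card`. -/
theorem QueueInv.insertT {A : ℕ → ℕ → ℕ} {q : ℕ} {V T F : Finset ℕ} (h : QueueInv A q V T F)
    {a : ℕ} (ha : a ∉ T) (haV : a + 1 ∈ V) {A' : ℕ → ℕ → ℕ}
    (h1 : A' 1 = Function.update (A 1) a 1) (h2 : A' 2 = A 2)
    (h3 : A' aQa = Function.update (A aQa) q (a + 1))
    (h4 : A' aQs = Function.update (A aQs) q 1) :
    QueueInv A' (q + 1) V (insert a T) F := by
  have hnew : ∀ i < q, A aQa i = a + 1 → A aQs i ≠ 1 := by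
    intro i hi e1 e2
    rcases (h.mem (a + 1) 1).mp ⟨i, hi, e1, e2⟩ with ⟨-, b, hb, e⟩ | ⟨e, -⟩
    · obtain rfl : a = b := by omega
      exact ha hb
    · omega
  refine ⟨?_, by rw [h2, h.arrF], ?_, ?_, ?_, ?_, h.codesF⟩
  · rw [h1, h.arrT, indicator_insert]
  · rw [Finset.card_insert_of_notMem ha, h.card]; omega
  · intro i hi j hj
    rw [h3, h4]
    simp only [Function.update_apply]
    split_ifs with e1 e2 e2
    · omega
    · exact fun g1 g2 => absurd g2.symm (hnew j (by omega) g1.symm)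
    · exact fun g1 g2 => absurd g2 (hnew i (by omega) g1)
    · exact h.inj i (by omega) j (by omega)
  · intro x s
    have := h.mem x s
    constructor
    · rintro ⟨i, hi, e1, e2⟩
      rw [h3] at e1
      rw [h4] at e2
      by_cases hiq : i = q
      · subst hiq
        rw [Function.update_self] at e1 e2
        exact Or.inl ⟨e2.symm, a, Finset.mem_insert_self _ _, e1.symm⟩
      · rw [Function.update_of_ne hiq] at e1 e2
        rcases this.mp ⟨i, by omega, e1, e2⟩ with ⟨g, b, hb, e⟩ | g
        · exact Or.inl ⟨g, b, Finset.mem_insert_of_mem hb, e⟩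
        · exact Or.inr g
    · have key : ((s = 1 ∧ ∃ a ∈ T, x = a + 1) ∨ (s = 0 ∧ ∃ a ∈ F, x = a + 1)) →
          ∃ i < q + 1, A' aQa i = x ∧ A' aQs i = s := by
        intro hh
        obtain ⟨i, hi, e1, e2⟩ := this.mpr hh
        refine ⟨i, by omega, ?_, ?_⟩
        · rw [h3, Function.update_of_ne (by omega), e1]
        · rw [h4, Function.update_of_ne (by omega), e2]
      rintro (⟨g, b, hb, e⟩ | g)
      · rcases Finset.mem_insert.mp hb with rfl | hb
        · exact ⟨q, by omega, by rw [h3, Function.update_self, e],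
            by rw [h4, Function.update_self, g]⟩
        · exact key (Or.inl ⟨g, b, hb, e⟩)
      · exact key (Or.inr g)
  · intro b hb
    rcases Finset.mem_insert.mp hb with rfl | hb
    · exact haV
    · exact h.codesT b hb

theorem QueueInv.insertF {A : ℕ → ℕ → ℕ} {q : ℕ} {V T F : Finset ℕ} (h : QueueInv A q V T F)
    {a : ℕ} (ha : a ∉ F) (haV : a + 1 ∈ V) {A' : ℕ → ℕ → ℕ}
    (h1 : A' 1 = A 1) (h2 : A' 2 = Function.update (A 2) a 1)
    (h3 : A' aQa = Function.update (A aQa) q (a + 1))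
    (h4 : A' aQs = Function.update (A aQs) q 0) :
    QueueInv A' (q + 1) V T (insert a F) := by
  have hnew : ∀ i < q, A aQa i = a + 1 → A aQs i ≠ 0 := by
    intro i hi e1 e2
    rcases (h.mem (a + 1) 0).mp ⟨i, hi, e1, e2⟩ with ⟨e, -⟩ | ⟨-, b, hb, e⟩
    · omega
    · obtain rfl : a = b := by omega
      exact ha hb
  refine ⟨by rw [h1, h.arrT], ?_, ?_, ?_, ?_, h.codesT, ?_⟩
  · rw [h2, h.arrF, indicator_insert]
  · rw [Finset.card_insert_of_notMem ha, h.card]; omega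
  · intro i hi j hj
    rw [h3, h4]
    simp only [Function.update_apply]
    split_ifs with e1 e2 e2
    · omega
    · exact fun g1 g2 => absurd g2.symm (hnew j (by omega) g1.symm)
    · exact fun g1 g2 => absurd g2 (hnew i (by omega) g1)
    · exact h.inj i (by omega) j (by omega)
  · intro x s
    have := h.mem x s
    constructor
    · rintro ⟨i, hi, e1, e2⟩
      rw [h3] at e1
      rw [h4] at e2
      by_cases hiq : i = q
      · subst hiq
        rw [Function.update_self] at e1 e2
        exact Or.inr ⟨e2.symm, a, Finset.mem_insert_self _ _, e1.symm⟩
      · rw [Function.update_of_ne hiq] at e1 e2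
        rcases this.mp ⟨i, by omega, e1, e2⟩ with g | ⟨g, b, hb, e⟩
        · exact Or.inl g
        · exact Or.inr ⟨g, b, Finset.mem_insert_of_mem hb, e⟩
    · have key : ((s = 1 ∧ ∃ a ∈ T, x = a + 1) ∨ (s = 0 ∧ ∃ a ∈ F, x = a + 1)) →
          ∃ i < q + 1, A' aQa i = x ∧ A' aQs i = s := by
        intro hh
        obtain ⟨i, hi, e1, e2⟩ := this.mpr hh
        refine ⟨i, by omega, ?_, ?_⟩
        · rw [h3, Function.update_of_ne (by omega), e1]
        · rw [h4, Function.update_of_ne (by omega), e2]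
      rintro (g | ⟨g, b, hb, e⟩)
      · exact key (Or.inl g)
      · rcases Finset.mem_insert.mp hb with rfl | hb
        · exact ⟨q, by omega, by rw [h3, Function.update_self, e],
            by rw [h4, Function.update_self, g]⟩
        · exact key (Or.inr ⟨g, b, hb, e⟩)
  · intro b hb
    rcases Finset.mem_insert.mp hb with rfl | hb
    · exact haV
    · exact h.codesF b hb

/-- The output `out` extends `out₀` by the elements of `T \ T₀`, under the given label. -/
def Emitted (k : ℕ) (out₀ out : List Event) (T₀ T : Finset ℕ) : Prop :=
  T₀ ⊆ T ∧ ∃ l : List ℕ, out = out₀ ++ l.map (Event.value k) ∧ l.Nodup ∧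
    ∀ a, a ∈ l ↔ a ∈ T ∧ a ∉ T₀

theorem Emitted.refl (k : ℕ) (out : List Event) (T : Finset ℕ) : Emitted k out out T T :=
  ⟨subset_rfl, [], by simp, List.nodup_nil, by simp⟩

theorem Emitted.insert {k : ℕ} {out₀ out : List Event} {T₀ T : Finset ℕ}
    (h : Emitted k out₀ out T₀ T) {a : ℕ} (ha : a ∉ T) :
    Emitted k out₀ (out ++ [Event.value k a]) T₀ (insert a T) := by
  obtain ⟨h0, l, h1, h2, h3⟩ := h
  have hal : a ∉ l := fun hh => ha ((h3 a).mp hh).1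
  refine ⟨h0.trans (Finset.subset_insert _ _), l ++ [a], by simp [h1], ?_, fun b => ?_⟩
  · rw [List.nodup_append]
    refine ⟨h2, by simp, ?_⟩
    intro x hx y hy
    rw [List.mem_singleton] at hy
    rintro rfl
    exact hal (hy ▸ hx)
  · rw [List.mem_append, h3, List.mem_singleton, Finset.mem_insert]
    constructor
    · rintro (⟨g1, g2⟩ | rfl)
      · exact ⟨Or.inr g1, g2⟩
      · exact ⟨Or.inl rfl, fun hh => ha (h0 hh)⟩
    · rintro ⟨rfl | g1, g2⟩
      · exact Or.inr rfl
      · exact Or.inl ⟨g1, g2⟩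

theorem Emitted.trans {k : ℕ} {o₀ o₁ o₂ : List Event} {T₀ T₁ T₂ : Finset ℕ}
    (h : Emitted k o₀ o₁ T₀ T₁) (h' : Emitted k o₁ o₂ T₁ T₂) : Emitted k o₀ o₂ T₀ T₂ := by
  obtain ⟨h0, l, h1, h2, h3⟩ := h
  obtain ⟨h0', l', h1', h2', h3'⟩ := h'
  refine ⟨h0.trans h0', l ++ l', by simp [h1', h1], ?_, fun a => ?_⟩
  · rw [List.nodup_append]
    refine ⟨h2, h2', ?_⟩
    rintro x hx y hy rfl
    exact ((h3' x).mp hy).2 ((h3 x).mp hx).1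
  · rw [List.mem_append, h3, h3']
    constructor
    · rintro (⟨g1, g2⟩ | ⟨g1, g2⟩)
      · exact ⟨h0' g1, g2⟩
      · exact ⟨g1, fun h => g2 (h0 h)⟩
    · rintro ⟨g1, g2⟩
      by_cases h : a ∈ T₁
      · exact Or.inl ⟨h, g2⟩
      · exact Or.inr ⟨g1, h⟩

theorem wp_makeTrue {σ : State} {V T F : Finset ℕ} {a : ℕ} (h0 : σ.reg rZ = 0)
    (hx : σ.reg rX = a + 1) (haV : a + 1 ∈ V) (hq : QueueInv σ.arr (σ.reg rQt) V T F) :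
    wp makeTrue (fun σ' => QueueInv σ'.arr (σ'.reg rQt) V (insert a T) F ∧
      σ.reg rQt ≤ σ'.reg rQt ∧
      (∀ i < σ.reg rQt, σ'.arr aQa i = σ.arr aQa i ∧ σ'.arr aQs i = σ.arr aQs i) ∧
      Emitted 0 σ.out σ'.out T (insert a T) ∧ σ'.time ≤ σ.time + 9) σ := by
  obtain ⟨r, A, o, t⟩ := σ
  dsimp only at *
  simp only [makeTrue, exec_rules, Nat.reduceEqDiff, hx, h0, Nat.add_sub_cancel]
  refine ⟨fun h => ?_, fun h => ?_⟩
  · have haT : a ∉ T := by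
      rw [hq.arrT] at h
      exact indicator_eq_zero.mp h
    refine ⟨hq.insertT haT haV rfl rfl rfl rfl, by omega, fun i hi => ?_,
      (Emitted.refl 0 o T).insert haT, by omega⟩
    rw [Function.update_of_ne (by omega), Function.update_of_ne (by omega)]
    exact ⟨rfl, rfl⟩
  · have haT : a ∈ T := by
      by_contra hc
      rw [hq.arrT] at h
      exact h (indicator_eq_zero.mpr hc)
    rw [Finset.insert_eq_of_mem haT]
    exact ⟨hq, le_rfl, by simp, Emitted.refl 0 o T, by omega⟩

theorem card_filter_erase {R : Finset ℕ} {r : ℕ} (hr : r ∈ R) (f : ℕ → ℕ) (e : ℕ) :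
    ((R.erase r).filter fun i => f i = e).card + (if e = f r then 1 else 0) =
      (R.filter fun i => f i = e).card := by
  rw [Finset.filter_erase]
  split_ifs with h
  · exact Finset.card_erase_add_one (Finset.mem_filter.mpr ⟨hr, h.symm⟩)
  · rw [Finset.erase_eq_of_notMem]
    · rfl
    · rw [Finset.mem_filter]
      exact fun hh => h hh.2.symm

/-- An entry disappears only with the last living rule that it stands for. The last entry `w` of the
segment is moved into the gap `p`; thus segments stay contiguous, `aEnt` and `aLoc` stay inverse to
each other, and a deletion costs a constant number of steps. -/
theorem wp_killRule {σ : State} {E m r : ℕ} {V R : Finset ℕ} (h0 : σ.reg rZ = 0)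
    (hr : σ.reg rR = r) (h1 : 1 ≤ r) (hm : r ≤ m) (hL : ListInv σ.arr E V R)
    (hR : ∀ i, i ∈ R ↔ 1 ≤ i ∧ i ≤ m ∧ σ.arr aDead i = 0) :
    wp killRule (fun σ' => ListInv σ'.arr E V (R.erase r) ∧
      (∀ i, σ'.arr aDead i = 0 ↔ i ≠ r ∧ σ.arr aDead i = 0) ∧ σ'.time ≤ σ.time + 21) σ := by
  obtain ⟨reg, A, o, t⟩ := σ
  dsimp only at *
  simp only [killRule, exec_rules, Nat.reduceEqDiff, hr, h0]
  refine ⟨fun hd => ?_, fun hd => ?_⟩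
  swap
  · have hrR : r ∉ R := fun h => hd ((hR r).mp h).2.2
    rw [Finset.erase_eq_of_notMem hrR]
    refine ⟨hL, fun i => ⟨fun hi => ⟨?_, hi⟩, fun hi => hi.2⟩, by omega⟩
    rintro rfl
    exact hd hi
  have hrR : r ∈ R := (hR r).mpr ⟨h1, hm, hd⟩
  have hdead : ∀ i, Function.update (A aDead) r 1 i = 0 ↔ ¬ i = r ∧ A aDead i = 0 := by
    intro i
    rw [Function.update_apply]
    split_ifs with h <;> simp [h]
  obtain ⟨heE, heo, het⟩ := hL.eof r hrR
  generalize he : A aEof r = e at *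
  have hpos : 0 < A aGcnt e := by
    rw [hL.gcnt e heE, Finset.card_pos]
    exact ⟨r, Finset.mem_filter.mpr ⟨hrR, he⟩⟩
  have hg : ∀ e' < E, Function.update (A aGcnt) e (A aGcnt e - 1) e' =
      ((R.erase r).filter fun i => A aEof i = e').card := by
    intro e' he'
    have := card_filter_erase hrR (A aEof) e'
    rw [he, ← hL.gcnt e' he'] at this
    rw [Function.update_apply]
    split_ifs at this ⊢ with h
    · subst h; omega
    · omega
  refine ⟨fun hz => ?_, fun hz => ?_⟩
  swap
  · refine ⟨⟨?_, ?_, ?_, ?_, ?_, ?_⟩, hdead, by omega⟩ <;>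
      simp only [exec_rules, Nat.reduceEqDiff]
    · exact fun i hi => hL.eof i (Finset.mem_of_mem_erase hi)
    · exact hL.uniq
    · exact hg
    · intro e' he' h
      apply hL.loc e' he'
      rw [Function.update_apply] at h
      split_ifs at h with h'
      · subst h'; exact hpos
      · exact h
    · exact hL.seg
    · intro x hx p g1 g2
      obtain ⟨k1, k2, k3, k4⟩ := hL.ent x hx p g1 g2
      refine ⟨k1, k2, k3, ?_⟩
      rw [Function.update_apply]
      split_ifs
      · omega
      · exact k4
  simp only [removeEntry, exec_rules, Nat.reduceEqDiff]
  obtain ⟨hxV, hp1, hp2, hpe⟩ := hL.loc e heE hpos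
  generalize hx : A aOwn e = x at *
  generalize hp : A aLoc e = p at *
  have hlast : A aEnd x - 1 < A aEnd x := by omega
  have hlast' : A aStart x ≤ A aEnd x - 1 := by omega
  obtain ⟨w1, w2, w3, w4⟩ := hL.ent x hxV _ hlast' hlast
  generalize hl : A aEnd x - 1 = l at *
  generalize hw : A aEnt l = w at *
  refine ⟨⟨?_, ?_, ?_, ?_, ?_, ?_⟩, hdead, by omega⟩ <;>
    simp only [exec_rules, Nat.reduceEqDiff]
  · exact fun i hi => hL.eof i (Finset.mem_of_mem_erase hi)
  · exact hL.uniq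
  · exact hg
  · intro e' he' h
    have hee : e' ≠ e := by
      rintro rfl
      rw [Function.update_self] at h
      omega
    rw [Function.update_of_ne hee] at h
    obtain ⟨g1, g2, g3, g4⟩ := hL.loc e' he' h
    by_cases hew : e' = w
    · subst hew
      rw [Function.update_self, w2, Function.update_self, Function.update_self]
      have : p ≠ l := by
        rintro rfl
        exact hee (hw.symm.trans hpe)
      exact ⟨hxV, hp1, by omega, rfl⟩
    · rw [Function.update_of_ne hew]
      have h5 : A aLoc e' ≠ p := by
        intro h5
        rw [h5] at g4
        exact hee (g4.symm.trans hpe)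
      rw [Function.update_of_ne h5]
      refine ⟨g1, g2, ?_, g4⟩
      rw [Function.update_apply]
      split_ifs with h6
      · rw [h6] at g3
        have : A aLoc e' ≠ l := by
          intro h7
          rw [h7] at g4
          exact hew (g4.symm.trans hw)
        omega
      · exact g3
  · intro y hy
    have := hL.seg y hy
    simp only [Function.update_apply]
    split_ifs with h
    · subst h; omega
    · exact this
  · intro y hy q g1 g2
    by_cases hq : q = p
    · subst hq
      have hyx : y = x := by
        have : q < A aEnd y := by
          rw [Function.update_apply] at g2
          split_ifs at g2 with h
          · subst h; omega
          · exact g2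
        have := (hL.ent y hy q g1 this).2.1
        rw [hpe, hx] at this
        exact this.symm
      subst hyx
      rw [Function.update_self] at g2
      have hwe : w ≠ e := by
        rintro rfl
        omega
      rw [Function.update_self, Function.update_self, Function.update_of_ne hwe]
      exact ⟨w1, w2, rfl, w4⟩
    · have hqy : q < A aEnd y := by
        rw [Function.update_apply] at g2
        split_ifs at g2 with h
        · subst h; omega
        · exact g2
      obtain ⟨k1, k2, k3, k4⟩ := hL.ent y hy q g1 hqy
      rw [Function.update_of_ne hq]
      have h5 : A aEnt q ≠ w := by
        intro h5
        rw [h5] at k2 k3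
        have hyx : y = x := k2.symm.trans w2
        subst hyx
        rw [Function.update_self] at g2
        omega
      have h6 : A aEnt q ≠ e := by
        intro h6
        rw [h6] at k3
        omega
      rw [Function.update_of_ne h5, Function.update_of_ne h6]
      exact ⟨k1, k2, k3, k4⟩

theorem ListInv.congr {A A' : ℕ → ℕ → ℕ} {E : ℕ} {V R : Finset ℕ} (h : ListInv A E V R)
    (hA : ∀ k ∈ [aHd, aTl, aStart, aEnd, aDeg, aEnt, aLoc, aEtl, aOwn, aGcnt, aEof],
      A' k = A k) : ListInv A' E V R := by
  simp only [List.mem_cons, List.not_mem_nil, or_false, forall_eq_or_imp, forall_eq] at hA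
  obtain ⟨h1, h2, h3, h4, h5, h6, h7, h8, h9, h10, h11⟩ := hA
  obtain ⟨g1, g2, g3, g4, g5, g6⟩ := h
  constructor <;> simpa only [h1, h2, h3, h4, h5, h6, h7, h8, h9, h10, h11]

/-- The rules that are not deleted. -/
def aliveRules (A : ℕ → ℕ → ℕ) (m : ℕ) : Finset ℕ :=
  (Finset.Icc 1 m).filter fun r => A aDead r = 0

theorem mem_aliveRules {A : ℕ → ℕ → ℕ} {m r : ℕ} :
    r ∈ aliveRules A m ↔ 1 ≤ r ∧ r ≤ m ∧ A aDead r = 0 := by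
  rw [aliveRules, Finset.mem_filter, Finset.mem_Icc, and_assoc]

/-- The invariant of the propagation. The pairs `(o, s)` in `Z` stand for the occurrences `o` that
have been told of the truth value `s` of their atoms; the first `h` events have been taken from the
queue, and the last one of them has still to be told to the occurrences in `l`. -/
structure PropInv (P : Program) (A : ℕ → ℕ → ℕ) (h q m N E : ℕ) (V : Finset ℕ)
    (Z : Finset (ℕ × ℕ)) (T F : Finset ℕ) (l : List ℕ) : Prop where
  tab : Tables P A m N V
  queue : QueueInv A q V T F
  le : h ≤ q
  told : ∀ o s, (o, s) ∈ Z ↔ 1 ≤ o ∧ o ≤ N ∧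
    ∃ i < h, A aQa i = A aAtm o ∧ A aQs i = s ∧ (i + 1 = h → o ∉ l)
  cnt : ∀ r, 1 ≤ r → r ≤ m → A aCnt r =
    ((Finset.Icc 1 N).filter fun o => A aRule o = r ∧ (o, A aSgn o) ∉ Z).card
  dead : ∀ r, 1 ≤ r → r ≤ m →
    (A aDead r = 0 ↔ ∀ o s, (o, s) ∈ Z → A aRule o = r → s = A aSgn o)
  lists : ListInv A E V (aliveRules A m)
  sound : ∀ a ∈ T, a ∈ trueLM P ↑F

/-- The heads of the rules with true bodies are true. -/
def HeadsTrue (A : ℕ → ℕ → ℕ) (m : ℕ) (T : Finset ℕ) : Prop :=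
  ∀ r, 1 ≤ r → r ≤ m → A aCnt r = 0 → ∃ a ∈ T, A aHd r = a + 1

theorem trueLM_rule {P : Program} {F : Set ℕ} {ρ : Rule} (hρ : ρ ∈ P)
    (hpos : ∀ a ∈ ρ.pos, a ∈ trueLM P F) (hneg : ∀ a ∈ ρ.neg, a ∈ F) :
    ρ.head ∈ trueLM P F := by
  refine LM_model (r := ρ.literals) (Or.inl ⟨ρ, hρ, rfl⟩) ?_
  intro x hx
  simp only [Rule.literals, List.mem_append, List.mem_map] at hx
  rcases hx with ⟨b, hb, rfl⟩ | ⟨c, hc, rfl⟩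
  · exact hpos b hb
  · exact LM_model (r := ⟨Sum.inr c, []⟩) (Or.inr ⟨c, hneg c hc, rfl⟩) (by simp)

section

variable {P : Program} {A A' : ℕ → ℕ → ℕ} {h q m N E : ℕ} {V : Finset ℕ}
  {Z : Finset (ℕ × ℕ)} {T F : Finset ℕ} {l : List ℕ}

/-- A zero counter says that every body occurrence has been told of the truth value equal to its
sign. Positive body atoms are then in `T`, negated ones in `F`, and the head is derivable. -/
theorem PropInv.head_mem (hI : PropInv P A h q m N E V Z T F l) {r : ℕ} (h1 : 1 ≤ r)
    (hm : r ≤ m) (hc : A aCnt r = 0) :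
    ∃ a, A aHd r = a + 1 ∧ a + 1 ∈ V ∧ a ∈ trueLM P ↑F := by
  obtain ⟨ρ, hρ, hrep⟩ := hI.tab.exists_rule r h1 hm
  rw [hI.cnt r h1 hm, Finset.card_eq_zero, Finset.filter_eq_empty_iff] at hc
  have key : ∀ o, 1 ≤ o → o ≤ N → A aRule o = r → ∀ a, A aAtm o = a + 1 →
      (A aSgn o = 1 → a ∈ T) ∧ (A aSgn o = 0 → a ∈ F) := by
    intro o g1 g2 g3 a g4
    have := hc (Finset.mem_Icc.mpr ⟨g1, g2⟩)
    rw [not_and, not_not] at this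
    obtain ⟨-, -, i, hi, e1, e2, -⟩ := (hI.told _ _).mp (this g3)
    rw [g4] at e1
    have hiq := hI.le
    rcases (hI.queue.mem _ _).mp ⟨i, by omega, e1, e2⟩ with ⟨k1, b, hb, k2⟩ | ⟨k1, b, hb, k2⟩
    · obtain rfl : a = b := by omega
      exact ⟨fun _ => hb, fun k => by omega⟩
    · obtain rfl : a = b := by omega
      exact ⟨fun k => by omega, fun _ => hb⟩
  refine ⟨ρ.head, hrep.head, ?_, trueLM_rule hρ ?_ ?_⟩
  · rw [hI.tab.codes]
    exact ⟨_, ⟨ρ, hρ, Or.inl rfl⟩, rfl⟩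
  · intro a ha
    obtain ⟨o, g1, g2, g3, g4, g5⟩ := (hrep.pos a).mp ha
    exact hI.sound a ((key o g1 g2 g3 a g5).1 g4)
  · intro a ha
    obtain ⟨o, g1, g2, g3, g4, g5⟩ := (hrep.neg a).mp ha
    exact (key o g1 g2 g3 a g5).2 g4

/-- Events are only appended, so the pairs told so far do not change. -/
theorem PropInv.setTrue (hI : PropInv P A h q m N E V Z T F l) {a q' : ℕ}
    (ha : a ∈ trueLM P ↑F) (hq : QueueInv A' q' V (insert a T) F) (hqq : q ≤ q')
    (hA : ∀ k, k ∉ [1, aQa, aQs] → A' k = A k)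
    (hold : ∀ i < q, A' aQa i = A aQa i ∧ A' aQs i = A aQs i) :
    PropInv P A' h q' m N E V Z (insert a T) F l := by
  refine ⟨hI.tab.congr ?_, hq, hI.le.trans hqq, ?_, ?_, ?_, ?_, ?_⟩
  · intro k hk
    apply hA
    intro hk'
    simp only [List.mem_cons, List.not_mem_nil, or_false] at hk hk'
    omega
  · intro o s
    rw [hI.told, hA aAtm (by decide)]
    have hle := hI.le
    constructor
    · rintro ⟨g1, g2, i, hi, g3, g4, g5⟩
      have := hold i (by omega)
      exact ⟨g1, g2, i, hi, this.1.trans g3, this.2.trans g4, g5⟩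
    · rintro ⟨g1, g2, i, hi, g3, g4, g5⟩
      have := hold i (by omega)
      exact ⟨g1, g2, i, hi, this.1.symm.trans g3, this.2.symm.trans g4, g5⟩
  · rw [hA aCnt (by decide), hA aRule (by decide), hA aSgn (by decide)]
    exact hI.cnt
  · rw [hA aDead (by decide), hA aRule (by decide), hA aSgn (by decide)]
    exact hI.dead
  · rw [aliveRules, hA aDead (by decide)]
    refine hI.lists.congr ?_
    intro k hk
    apply hA
    intro hk'
    simp only [List.mem_cons, List.not_mem_nil, or_false] at hk hk'
    omega
  · intro b hb
    rcases Finset.mem_insert.mp hb with rfl | hb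
    · exact ha
    · exact hI.sound b hb

/-- The occurrence `o` comes next. -/
structure NextOcc (A : ℕ → ℕ → ℕ) (h N o s : ℕ) (l : List ℕ) : Prop where
  pos : 0 < h
  nodup : (o :: l).Nodup
  le : 1 ≤ o ∧ o ≤ N
  atm : A aQa (h - 1) = A aAtm o
  sgn : A aQs (h - 1) = s

/-- The queue has no repetitions, so the current event is the only one that tells `o` of the value
`s`. Hence each visit adds a pair to `Z`, which pays for it. -/
theorem PropInv.not_told {o s : ℕ} (hI : PropInv P A h q m N E V Z T F (o :: l))
    (ho : NextOcc A h N o s l) : (o, s) ∉ Z := by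
  intro hz
  obtain ⟨-, -, i, hi, e1, e2, e3⟩ := (hI.told _ _).mp hz
  have hpos := ho.pos
  have hle := hI.le
  have := hI.queue.inj i (by omega) (h - 1) (by omega) (e1.trans ho.atm.symm)
    (e2.trans ho.sgn.symm)
  exact e3 (by omega) List.mem_cons_self

theorem PropInv.told_insert {o s : ℕ} (hI : PropInv P A h q m N E V Z T F (o :: l))
    (ho : NextOcc A h N o s l) (o' s' : ℕ) : (o', s') ∈ insert (o, s) Z ↔ 1 ≤ o' ∧ o' ≤ N ∧
      ∃ i < h, A aQa i = A aAtm o' ∧ A aQs i = s' ∧ (i + 1 = h → o' ∉ l) := by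
  have hpos := ho.pos
  rw [Finset.mem_insert, hI.told, Prod.mk.injEq]
  constructor
  · rintro (⟨rfl, rfl⟩ | ⟨g1, g2, i, hi, g3, g4, g5⟩)
    · exact ⟨ho.le.1, ho.le.2, h - 1, by omega, ho.atm, ho.sgn,
        fun _ => (List.nodup_cons.mp ho.nodup).1⟩
    · exact ⟨g1, g2, i, hi, g3, g4, fun e hl => g5 e (List.mem_cons_of_mem _ hl)⟩
  · rintro ⟨g1, g2, i, hi, g3, g4, g5⟩
    by_cases hc : o' = o ∧ s' = s
    · exact Or.inl hc
    · refine Or.inr ⟨g1, g2, i, hi, g3, g4, fun e hl => ?_⟩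
      rcases List.mem_cons.mp hl with rfl | hl
      · have hih : i = h - 1 := by omega
        subst hih
        exact hc ⟨rfl, g4.symm.trans ho.sgn⟩
      · exact g5 e hl

/-- A value equal to the sign removes exactly `o` from the set counted by `cnt`, and is harmless for
`dead`. -/
theorem PropInv.satisfy {o s : ℕ} (hI : PropInv P A h q m N E V Z T F (o :: l))
    (ho : NextOcc A h N o s l) (hs : A aSgn o = s) :
    PropInv P (Function.update A aCnt
      (Function.update (A aCnt) (A aRule o) (A aCnt (A aRule o) - 1)))
      h q m N E V (insert (o, s) Z) T F l := by
  have hnot := hI.not_told ho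
  refine ⟨hI.tab.congr ?_, hI.queue.congr ?_ ?_ ?_ ?_, hI.le, ?_, ?_, ?_, ?_, hI.sound⟩ <;>
    simp only [exec_rules, Nat.reduceEqDiff, aliveRules, List.mem_cons, List.not_mem_nil, or_false,
      forall_eq_or_imp, forall_eq, and_true]
  · exact hI.told_insert ho
  · intro r h1 hm
    have hset : ((Finset.Icc 1 N).filter fun o' =>
        A aRule o' = r ∧ (o', A aSgn o') ∉ insert (o, s) Z) =
        ((Finset.Icc 1 N).filter fun o' => A aRule o' = r ∧ (o', A aSgn o') ∉ Z).erase o := by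
      ext o'
      simp only [Finset.mem_filter, Finset.mem_erase, Finset.mem_insert, Prod.mk.injEq, not_or]
      constructor
      · rintro ⟨g1, g2, g3, g4⟩
        exact ⟨fun e => g3 ⟨e, by rw [e, hs]⟩, g1, g2, g4⟩
      · rintro ⟨g1, g2, g3, g4⟩
        exact ⟨g2, g3, fun e => g1 e.1, g4⟩
    rw [hset, Function.update_apply]
    split_ifs with hr
    · subst hr
      rw [Finset.card_erase_of_mem, hI.cnt _ h1 hm]
      rw [Finset.mem_filter, Finset.mem_Icc, hs]
      exact ⟨ho.le, rfl, hnot⟩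
    · rw [Finset.erase_eq_of_notMem, hI.cnt _ h1 hm]
      rw [Finset.mem_filter]
      exact fun hh => hr hh.2.1.symm
  · intro r h1 hm
    rw [hI.dead r h1 hm]
    constructor
    · intro hh o' s' hz hr
      rcases Finset.mem_insert.mp hz with hz | hz
      · cases hz; exact hs.symm
      · exact hh o' s' hz hr
    · exact fun hh o' s' hz hr => hh o' s' (Finset.mem_insert_of_mem hz) hr
  · exact hI.lists.congr (by simp [exec_rules])

/-- A value different from the sign does not concern the counters, which look at the pairs `(o, A
aSgn o)` only, but it is the criterion for deletion. -/
theorem PropInv.kill {o s : ℕ} (hI : PropInv P A h q m N E V Z T F (o :: l))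
    (ho : NextOcc A h N o s l) (hs : A aSgn o ≠ s)
    (hL : ListInv A' E V ((aliveRules A m).erase (A aRule o)))
    (hd : ∀ i, A' aDead i = 0 ↔ i ≠ A aRule o ∧ A aDead i = 0)
    (hA : ∀ k, k ∉ killRule.arrs → A' k = A k) :
    PropInv P A' h q m N E V (insert (o, s) Z) T F l := by
  refine ⟨hI.tab.congr ?_, hI.queue.congr (hA _ (by decide)) (hA _ (by decide))
    (hA _ (by decide)) (hA _ (by decide)), hI.le, ?_, ?_, ?_, ?_, hI.sound⟩
  · intro k hk
    apply hA
    revert k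
    decide
  · rw [hA aQa (by decide), hA aQs (by decide), hA aAtm (by decide)]
    exact hI.told_insert ho
  · rw [hA aCnt (by decide), hA aRule (by decide), hA aSgn (by decide)]
    intro r h1 hm
    rw [hI.cnt r h1 hm]
    congr 1
    apply Finset.filter_congr
    intro o' _
    rw [Finset.mem_insert, Prod.mk.injEq, not_or]
    constructor
    · rintro ⟨g1, g2⟩
      exact ⟨g1, fun e => hs (e.1 ▸ e.2), g2⟩
    · rintro ⟨g1, -, g2⟩
      exact ⟨g1, g2⟩
  · rw [hA aRule (by decide), hA aSgn (by decide)]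
    intro r h1 hm
    rw [hd, hI.dead r h1 hm]
    constructor
    · rintro ⟨g1, g2⟩ o' s' hz hr
      rcases Finset.mem_insert.mp hz with hz | hz
      · cases hz; exact absurd hr.symm g1
      · exact g2 o' s' hz hr
    · intro hh
      refine ⟨?_, fun o' s' hz hr => hh o' s' (Finset.mem_insert_of_mem hz) hr⟩
      rintro rfl
      exact hs (hh o s (Finset.mem_insert_self _ _) rfl).symm
  · convert hL using 1
    ext r
    rw [Finset.mem_erase, mem_aliveRules, mem_aliveRules, hd]
    tauto

end

theorem wp_satisfyLiteral {σ : State} {P : Program} {m N E o s : ℕ} {V : Finset ℕ}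
    {Z : Finset (ℕ × ℕ)} {T F : Finset ℕ} {l : List ℕ} (h0 : σ.reg rZ = 0)
    (hr : σ.reg rR = σ.arr aRule o)
    (hI : PropInv P σ.arr (σ.reg rQh) (σ.reg rQt) m N E V Z T F (o :: l))
    (ho : NextOcc σ.arr (σ.reg rQh) N o s l) (hs : σ.arr aSgn o = s)
    (hH : HeadsTrue σ.arr m T) :
    wp satisfyLiteral (fun σ' => ∃ T',
      PropInv P σ'.arr (σ'.reg rQh) (σ'.reg rQt) m N E V (insert (o, s) Z) T' F l ∧
      HeadsTrue σ'.arr m T' ∧ Emitted 0 σ.out σ'.out T T' ∧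
      (∀ i < σ.reg rQt, σ'.arr aQa i = σ.arr aQa i ∧ σ'.arr aQs i = σ.arr aQs i) ∧
      σ'.time ≤ σ.time + 14) σ := by
  have hJ := hI.satisfy ho hs
  obtain ⟨h1, hm, -⟩ := hI.tab.lit o ho.le.1 ho.le.2
  obtain ⟨reg, A, out, t⟩ := σ
  dsimp only at *
  simp only [satisfyLiteral, exec_rules, Nat.reduceEqDiff, hr, h0]
  refine ⟨fun hz => ?_, fun hz => ?_⟩
  · have hz' : (Function.update A aCnt
      (Function.update (A aCnt) (A aRule o) (A aCnt (A aRule o) - 1))) aCnt (A aRule o) = 0 := by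
      simpa using hz
    obtain ⟨a, ha1, ha2, ha3⟩ := hJ.head_mem h1 hm hz'
    simp only [exec_rules, Nat.reduceEqDiff] at ha1
    refine wp_frame (wp_makeTrue (V := V) (T := T) (F := F) (a := a) ?_ ?_ ha2 ?_) ?_
    · simpa only [exec_rules, Nat.reduceEqDiff] using h0
    · simpa only [exec_rules, Nat.reduceEqDiff] using ha1
    · simpa only [exec_rules, Nat.reduceEqDiff] using hJ.queue
    rintro ⟨reg', A', out', t'⟩ ⟨fr, fA, -⟩ ⟨g1, g2, g3, g4, g5⟩
    simp only [exec_rules, Nat.reduceEqDiff] at fr fA g1 g2 g3 g4 g5 ⊢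
    have e13 := fr rQh (by decide)
    simp only [exec_rules, Nat.reduceEqDiff] at e13
    refine ⟨insert a T, ?_, ?_, g4, g3, by omega⟩
    · rw [e13]
      refine hJ.setTrue ha3 g1 g2 ?_ ?_
      · intro k hk
        apply fA
        intro hk'
        have : ∀ k ∈ makeTrue.arrs, k ∈ [1, aQa, aQs] := by decide
        exact hk (this k hk')
      · simpa only [exec_rules, Nat.reduceEqDiff] using g3
    · intro r k1 k2
      rw [fA aCnt (by decide), fA aHd (by decide)]
      simp only [exec_rules, Nat.reduceEqDiff]
      intro hc
      by_cases hrr : r = A aRule o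
      · subst hrr
        exact ⟨a, Finset.mem_insert_self _ _, ha1⟩
      · rw [Function.update_of_ne hrr] at hc
        obtain ⟨b, hb, hb'⟩ := hH r k1 k2 hc
        exact ⟨b, Finset.mem_insert_of_mem hb, hb'⟩
  · refine ⟨T, hJ, ?_, Emitted.refl _ _ _, by simp, by omega⟩
    intro r k1 k2
    simp only [exec_rules, Nat.reduceEqDiff]
    intro hc
    by_cases hrr : r = A aRule o
    · subst hrr
      rw [Function.update_self] at hc
      exact absurd hc hz
    · rw [Function.update_of_ne hrr] at hc
      exact hH r k1 k2 hc

theorem wp_visitOccurrence {σ : State} {P : Program} {m N E o : ℕ} {V : Finset ℕ}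
    {Z : Finset (ℕ × ℕ)} {T F : Finset ℕ} {l : List ℕ} (h0 : σ.reg rZ = 0)
    (hro : σ.reg rO = o)
    (hI : PropInv P σ.arr (σ.reg rQh) (σ.reg rQt) m N E V Z T F (o :: l))
    (ho : NextOcc σ.arr (σ.reg rQh) N o (σ.reg rS) l) (hH : HeadsTrue σ.arr m T) :
    wp visitOccurrence (fun σ' => ∃ T',
      PropInv P σ'.arr (σ'.reg rQh) (σ'.reg rQt) m N E V (insert (o, σ.reg rS) Z) T' F l ∧
      HeadsTrue σ'.arr m T' ∧ Emitted 0 σ.out σ'.out T T' ∧ σ'.reg rO = σ.arr aOnext o ∧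
      (∀ i < σ.reg rQt, σ'.arr aQa i = σ.arr aQa i ∧ σ'.arr aQs i = σ.arr aQs i) ∧
      σ'.time ≤ σ.time + 25) σ := by
  obtain ⟨h1, hm, -⟩ := hI.tab.lit o ho.le.1 ho.le.2
  obtain ⟨reg, A, out, t⟩ := σ
  dsimp only at *
  simp only [visitOccurrence, exec_rules, Nat.reduceEqDiff, hro]
  refine ⟨fun hs => ?_, fun hs => ?_⟩
  · refine wp_frame (wp_satisfyLiteral (P := P) (m := m) (N := N) (E := E) (o := o)
      (s := reg rS) (V := V) (Z := Z) (T := T) (F := F) (l := l) ?_ ?_ ?_ ?_ hs hH) ?_ <;>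
      try simp only [exec_rules, Nat.reduceEqDiff]
    · exact h0
    · exact hI
    · exact ho
    rintro ⟨reg', A', out', t'⟩ ⟨fr, fA, -⟩ ⟨T', g1, g2, g3, g6, g4⟩
    have e5 := fr rO (by decide)
    have a10 := fA aOnext (by decide)
    simp only [exec_rules, Nat.reduceEqDiff] at g1 g2 g3 g4 g6 e5 a10 ⊢
    exact ⟨T', g1, g2, g3, by rw [a10, e5, hro], g6, by omega⟩
  · refine wp_frame (wp_killRule (E := E) (m := m) (r := A aRule o) (V := V)
      (R := aliveRules A m) ?_ ?_ h1 hm ?_ ?_) ?_ <;>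
      try simp only [exec_rules, Nat.reduceEqDiff]
    · exact h0
    · exact hI.lists
    · exact fun i => mem_aliveRules
    rintro ⟨reg', A', out', t'⟩ ⟨fr, fA, fo⟩ ⟨g1, g2, g3⟩
    have e5 := fr rO (by decide)
    have e13 := fr rQh (by decide)
    have e14 := fr rQt (by decide)
    have a10 := fA aOnext (by decide)
    have eo := fo (by decide)
    simp only [exec_rules, Nat.reduceEqDiff] at g1 g2 g3 e5 a10 e13 e14 eo ⊢
    refine ⟨T, ?_, ?_, ?_, by rw [a10, e5, hro], ?_, by omega⟩
    · rw [e13, e14]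
      exact hI.kill ho hs g1 g2 fA
    · have b5 := fA aCnt (by decide)
      have b3 := fA aHd (by decide)
      dsimp only at b5 b3
      unfold HeadsTrue
      rw [b5, b3]
      exact hH
    · rw [eo]; exact Emitted.refl _ _ _
    · have b27 := fA aQa (by decide)
      have b28 := fA aQs (by decide)
      dsimp only at b27 b28
      rw [b27, b28]
      exact fun i _ => ⟨rfl, rfl⟩

/-- There are only two values that an occurrence can be told of; that `T` and `F` are disjoint is
not needed. -/
theorem PropInv.card_le {P : Program} {A : ℕ → ℕ → ℕ} {h q m N E : ℕ} {V : Finset ℕ}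
    {Z : Finset (ℕ × ℕ)} {T F : Finset ℕ} {l : List ℕ} (hI : PropInv P A h q m N E V Z T F l) :
    Z.card ≤ 2 * N := by
  have : Z ⊆ Finset.Icc 1 N ×ˢ Finset.range 2 := by
    rintro ⟨o, s⟩ hz
    obtain ⟨g1, g2, i, hi, g3, g4, -⟩ := (hI.told o s).mp hz
    have hle := hI.le
    rw [Finset.mem_product, Finset.mem_Icc, Finset.mem_range]
    refine ⟨⟨g1, g2⟩, ?_⟩
    rcases (hI.queue.mem _ _).mp ⟨i, by omega, g3, g4⟩ with ⟨k, -⟩ | ⟨k, -⟩ <;>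
      (simp only; omega)
  have := Finset.card_le_card this
  rw [Finset.card_product, Nat.card_Icc, Finset.card_range] at this
  omega

theorem wp_handleEvent {σ : State} {P : Program} {m N E : ℕ} {V : Finset ℕ}
    {Z : Finset (ℕ × ℕ)} {T F : Finset ℕ} (h0 : σ.reg rZ = 0)
    (hI : PropInv P σ.arr (σ.reg rQh) (σ.reg rQt) m N E V Z T F [])
    (hH : HeadsTrue σ.arr m T) (hq : σ.reg rQh < σ.reg rQt) :
    wp handleEvent (fun σ' => ∃ Z' T',
      PropInv P σ'.arr (σ'.reg rQh) (σ'.reg rQt) m N E V Z' T' F [] ∧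
      HeadsTrue σ'.arr m T' ∧ Emitted 0 σ.out σ'.out T T' ∧ σ'.reg rQh = σ.reg rQh + 1 ∧
      σ'.time + 26 * Z.card ≤ σ.time + 5 + 26 * Z'.card) σ := by
  obtain ⟨reg, A, out, t⟩ := σ
  dsimp only at *
  obtain ⟨l, hch, hnd, hl⟩ := hI.tab.omap (A aQa (reg rQh))
  simp only [handleEvent, exec_rules, Nat.reduceEqDiff]
  refine wp_loop (fun σ => ∃ l₁ l₂ Z' T', l = l₁ ++ l₂ ∧ Chain (A aOnext) (σ.reg rO) l₂ ∧
      PropInv P σ.arr (σ.reg rQh) (σ.reg rQt) m N E V Z' T' F l₂ ∧ HeadsTrue σ.arr m T' ∧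
      Emitted 0 out σ.out T T' ∧ σ.reg rQh = reg rQh + 1 ∧ σ.reg rS = A aQs (reg rQh) ∧
      σ.reg rZ = 0 ∧ σ.arr aOnext = A aOnext ∧ σ.arr aAtm = A aAtm ∧
      σ.arr aQa (reg rQh) = A aQa (reg rQh) ∧ σ.arr aQs (reg rQh) = A aQs (reg rQh) ∧
      σ.time + 26 * Z.card ≤ t + 4 + 26 * Z'.card) (t + 4 + 52 * N) ?_ ?_ ?_ ?_
  · rintro σ ⟨l₁, l₂, Z', T', rfl, -, hP, -, -, -, -, -, -, -, -, -, h⟩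
    have := hP.card_le
    omega
  · refine ⟨[], l, Z, T, rfl, ?_, ?_, hH, Emitted.refl _ _ _, ?_, ?_, ?_, rfl, rfl, rfl, rfl,
      ?_⟩ <;> simp only [exec_rules, Nat.reduceEqDiff]
    · exact hch
    -- When the event is taken from the queue, all occurrences of its atom are pending, so the pairs
    -- told are still the same.
    · refine { hI with le := by omega, told := ?_ }
      intro o s
      rw [hI.told]
      constructor
      · rintro ⟨g1, g2, i, hi, g3⟩
        exact ⟨g1, g2, i, by omega, g3.1, g3.2.1, fun e => by omega⟩
      · rintro ⟨g1, g2, i, hi, g3, g4, g5⟩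
        refine ⟨g1, g2, i, ?_, g3, g4, by simp⟩
        by_contra hc
        have hiq : i = reg rQh := by omega
        exact g5 (by omega) ((hl o).mpr ⟨g1, g2, by rw [← g3, hiq]⟩)
    · exact h0
    · omega
  · rintro σ ⟨l₁, l₂, Z', T', rfl, h1, h2, h3, h4, h5, h6, h7, h8, h9, h10, h11, h12⟩ hb
    obtain _ | ⟨o, l₂⟩ := l₂
    · have e : σ.reg rO = 0 := h1
      have hb' : σ.reg rZ < σ.reg rO := hb
      omega
    obtain ⟨e1, e2, e3⟩ := h1
    have ho := (hl o).mp (by simp)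
    have hne : NextOcc σ.arr (σ.reg rQh) N o (σ.reg rS) l₂ := by
      refine ⟨by omega, (List.nodup_append.mp hnd).2.1, ⟨ho.1, ho.2.1⟩, ?_, ?_⟩
      · rw [h5, Nat.add_sub_cancel, h10, h9, ho.2.2]
      · rw [h5, Nat.add_sub_cancel, h11, h6]
    refine wp_frame (wp_visitOccurrence (σ := σ.tick) h7 e1 h2 hne h3) ?_
    rintro σ' hf ⟨T'', g1, g2, g3, g4, g6, g5⟩
    have hlt : reg rQh < σ.reg rQt := by
      have := h2.le
      omega
    have hnz : (o, σ.reg rS) ∉ Z' := h2.not_told hne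
    refine ⟨l₁ ++ [o], l₂, _, T'', by simp, ?_, g1, g2, h4.trans g3, ?_, ?_, ?_, ?_, ?_, ?_, ?_,
      ?_⟩
    · rw [g4]
      change Chain (A aOnext) (σ.arr aOnext o) l₂
      rw [h8]; exact e3
    · rw [hf.reg rQh (by decide)]; exact h5
    · rw [hf.reg rS (by decide)]; exact h6
    · rw [hf.reg rZ (by decide)]; exact h7
    · rw [hf.arr aOnext (by decide)]; exact h8
    · rw [hf.arr aAtm (by decide)]; exact h9
    · rw [(g6 _ hlt).1]; exact h10
    · rw [(g6 _ hlt).2]; exact h11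
    · have e : σ.tick.time = σ.time + 1 := rfl
      have e' : σ.tick.reg rS = σ.reg rS := rfl
      rw [e', Finset.card_insert_of_notMem hnz]; omega
  · rintro σ ⟨l₁, l₂, Z', T', rfl, h1, h2, h3, h4, h5, h6, h7, h8, h9, h10, h11, h12⟩ hb
    obtain _ | ⟨o, l₂⟩ := l₂
    · have e : σ.tick.time = σ.time + 1 := rfl
      exact ⟨Z', T', h2, h3, h4, h5, by omega⟩
    · obtain ⟨e1, e2, e3⟩ := h1
      have hb' : ¬ σ.reg rZ < σ.reg rO := hb
      omega

theorem QueueInv.le {A : ℕ → ℕ → ℕ} {q : ℕ} {V T F : Finset ℕ} (h : QueueInv A q V T F) :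
    q ≤ 2 * V.card := by
  have h1 : T.card ≤ V.card := by
    rw [← Finset.card_image_of_injective T (add_left_injective 1)]
    apply Finset.card_le_card
    intro x hx
    obtain ⟨a, ha, rfl⟩ := Finset.mem_image.mp hx
    exact h.codesT a ha
  have h2 : F.card ≤ V.card := by
    rw [← Finset.card_image_of_injective F (add_left_injective 1)]
    apply Finset.card_le_card
    intro x hx
    obtain ⟨a, ha, rfl⟩ := Finset.mem_image.mp hx
    exact h.codesF a ha
  have := h.card
  omega

/-- A single propagation may be long, but it is paid by the growth of `26 * Z.card + 6 * rQh`, a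
quantity that never decreases and is linear in the size of the program. -/
theorem wp_propagate {σ : State} {P : Program} {m N E : ℕ} {V : Finset ℕ}
    {Z : Finset (ℕ × ℕ)} {T F : Finset ℕ} (h0 : σ.reg rZ = 0)
    (hI : PropInv P σ.arr (σ.reg rQh) (σ.reg rQt) m N E V Z T F [])
    (hH : HeadsTrue σ.arr m T) :
    wp propagate (fun σ' => ∃ Z' T',
      PropInv P σ'.arr (σ'.reg rQh) (σ'.reg rQt) m N E V Z' T' F [] ∧
      HeadsTrue σ'.arr m T' ∧ Emitted 0 σ.out σ'.out T T' ∧ σ'.reg rQh = σ'.reg rQt ∧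
      σ'.time + 26 * Z.card + 6 * σ.reg rQh ≤
        σ.time + 1 + 26 * Z'.card + 6 * σ'.reg rQh) σ := by
  refine wp_loop (fun σ' => ∃ Z' T', σ'.reg rZ = 0 ∧
      PropInv P σ'.arr (σ'.reg rQh) (σ'.reg rQt) m N E V Z' T' F [] ∧
      HeadsTrue σ'.arr m T' ∧ Emitted 0 σ.out σ'.out T T' ∧
      σ'.time + 26 * Z.card + 6 * σ.reg rQh ≤ σ.time + 26 * Z'.card + 6 * σ'.reg rQh)
      (σ.time + 52 * N + 12 * V.card) ?_ ⟨Z, T, h0, hI, hH, Emitted.refl _ _ _, le_rfl⟩ ?_ ?_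
  · rintro σ' ⟨Z', T', -, h1, -, -, h2⟩
    have := h1.card_le
    have := h1.queue.le
    have := h1.le
    omega
  · rintro σ' ⟨Z', T', h1, h2, h3, h4, h5⟩ hb
    refine wp_frame (wp_handleEvent (σ := σ'.tick) h1 h2 h3 hb) ?_
    rintro σ'' hf ⟨Z'', T'', g1, g2, g3, g4, g5⟩
    refine ⟨Z'', T'', ?_, g1, g2, h4.trans g3, ?_⟩
    · rw [hf.reg rZ (by decide)]; exact h1
    · have e : σ'.tick.time = σ'.time + 1 := rfl
      have e' : σ'.tick.reg rQh = σ'.reg rQh := rfl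
      omega
  · rintro σ' ⟨Z', T', h1, h2, h3, h4, h5⟩ hb
    have hb' : ¬ σ'.reg rQh < σ'.reg rQt := hb
    have e : σ'.tick.time = σ'.time + 1 := rfl
    have e' : σ'.tick.reg rQh = σ'.reg rQh := rfl
    have hle := h2.le
    refine ⟨Z', T', h2, h3, h4, ?_, ?_⟩
    · change σ'.reg rQh = σ'.reg rQt
      omega
    · omega

theorem wp_initFacts {σ : State} {P : Program} {m N E : ℕ} {V : Finset ℕ} (h0 : σ.reg rZ = 0)
    (hm : σ.reg rM = m) (hI : PropInv P σ.arr 0 (σ.reg rQt) m N E V ∅ ∅ ∅ []) :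
    wp initFacts (fun σ' => ∃ T, PropInv P σ'.arr 0 (σ'.reg rQt) m N E V ∅ T ∅ [] ∧
      HeadsTrue σ'.arr m T ∧ Emitted 0 σ.out σ'.out ∅ T ∧ σ'.time ≤ σ.time + 2 + 14 * m) σ := by
  obtain ⟨reg, A, out, t⟩ := σ
  dsimp only at *
  simp only [initFacts, exec_rules, Nat.reduceEqDiff]
  refine wp_loop (fun σ => ∃ T, PropInv P σ.arr 0 (σ.reg rQt) m N E V ∅ T ∅ [] ∧
      HeadsTrue σ.arr (σ.reg rR) T ∧ Emitted 0 out σ.out ∅ T ∧ σ.reg rZ = 0 ∧ σ.reg rM = m ∧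
      σ.reg rR ≤ m ∧ σ.time ≤ t + 1 + 14 * σ.reg rR) (t + 1 + 14 * m) ?_ ?_ ?_ ?_
  · rintro σ ⟨T, -, -, -, -, -, h1, h2⟩
    omega
  · refine ⟨∅, ?_, ?_, Emitted.refl _ _ _, ?_, ?_, ?_, ?_⟩ <;>
      simp only [exec_rules, Nat.reduceEqDiff]
    · exact hI
    · intro r h1 h2; omega
    · exact h0
    · exact hm
    · omega
    · omega
  · rintro ⟨reg', A', out', t'⟩ ⟨T, h1, h2, h3, h4, h5, h6, h7⟩ hb
    have hb' : reg' rR < reg' rM := hb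
    dsimp only at *
    simp only [exec_rules, Nat.reduceEqDiff, h4]
    refine ⟨fun hz => ?_, fun hz => ?_⟩
    · obtain ⟨a, ha1, ha2, ha3⟩ := h1.head_mem (by omega) (by omega) hz
      refine wp_frame (wp_makeTrue (V := V) (T := T) (F := ∅) (a := a) ?_ ?_ ha2 ?_) ?_ <;>
        try simp only [exec_rules, Nat.reduceEqDiff]
      · exact h4
      · exact ha1
      · exact h1.queue
      rintro ⟨reg₂, A₂, out₂, t₂⟩ ⟨fr, fA, -⟩ ⟨g1, g2, g3, g4, g5⟩
      have e4 := fr rR (by decide)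
      have e0 := fr rZ (by decide)
      have e1 := fr rM (by decide)
      have a5 := fA aCnt (by decide)
      have a3 := fA aHd (by decide)
      simp only [exec_rules, Nat.reduceEqDiff] at g1 g2 g3 g4 g5 e4 e0 e1 a5 a3 fA
      refine ⟨insert a T, h1.setTrue ha3 g1 g2 ?_ g3, ?_, h3.trans g4, ?_, ?_, ?_, ?_⟩
      · intro k hk
        apply fA
        intro hk'
        have : ∀ k ∈ makeTrue.arrs, k ∈ [1, aQa, aQs] := by decide
        exact hk (this k hk')
      · simp only [e4]
        intro r k1 k2
        rw [a5, a3]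
        intro hc
        by_cases hr : r = reg' rR + 1
        · subst hr
          exact ⟨a, Finset.mem_insert_self _ _, ha1⟩
        · obtain ⟨b, hb, hb'⟩ := h2 r k1 (by omega) hc
          exact ⟨b, Finset.mem_insert_of_mem hb, hb'⟩
      · exact e0.trans h4
      · exact e1.trans h5
      · simp only [e4]; omega
      · simp only [e4]; omega
    · refine ⟨T, h1, ?_, h3, trivial, h5, by omega, by omega⟩
      intro r k1 k2 hc
      by_cases hr : r = reg' rR + 1
      · subst hr
        exact absurd hc hz
      · exact h2 r k1 (by omega) hc
  · rintro σ ⟨T, h1, h2, h3, h4, h5, h6, h7⟩ hb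
    have hb' : ¬ σ.reg rR < σ.reg rM := hb
    have hr : σ.reg rR = m := by omega
    rw [hr] at h2 h7
    have e : σ.tick.time = σ.time + 1 := rfl
    exact ⟨T, h1, h2, h3, by omega⟩

/-! ## The search for closed sets -/

/-- A graph with vertices `verts` and edges from `x` to `tail p` for `first x ≤ p < last x`. -/
structure Graph where
  verts : Finset ℕ
  first : ℕ → ℕ
  last : ℕ → ℕ
  tail : ℕ → ℕ

namespace Graph

/-- The edges lead to vertices or to `0`, and there are no parallel edges. -/
structure Valid (G : Graph) : Prop where
  zero : 0 ∉ G.verts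
  edge : ∀ x ∈ G.verts, ∀ p, G.first x ≤ p → p < G.last x → G.tail p ∈ G.verts ∨ G.tail p = 0
  inj : ∀ x ∈ G.verts, ∀ p q, G.first x ≤ p → p < G.last x → G.first x ≤ q → q < G.last x →
    G.tail p = G.tail q → p = q

/-- A set of vertices that is closed under edges. -/
def Closed (G : Graph) (U : Finset ℕ) : Prop :=
  U ⊆ G.verts ∧ ∀ x ∈ U, ∀ p, G.first x ≤ p → p < G.last x → G.tail p ∈ U

/-- Without parallel edges the edges of `x` inject into `U`. This allows a search for closed sets of
at most `k` elements to ignore vertices of degree above `k`. -/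
theorem Closed.degree_le {G : Graph} (hG : G.Valid) {U : Finset ℕ} (hU : G.Closed U) {x : ℕ}
    (hx : x ∈ U) : G.last x - G.first x ≤ U.card := by
  rw [← Nat.card_Ico, ← Finset.card_image_of_injOn (f := G.tail)]
  · apply Finset.card_le_card
    intro y hy
    simp only [Finset.mem_image, Finset.mem_Ico] at hy
    obtain ⟨p, hp, rfl⟩ := hy
    exact hU.2 x hx p hp.1 hp.2
  · intro p hp q hq e
    simp only [Finset.coe_Ico, Set.mem_Ico] at hp hq
    exact hG.inj x (hU.1 hx) p q hp.1 hp.2 hq.1 hq.2 e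

/-- The closed sets that contain `x` have more than `k` or at least `z` elements. -/
def Excluded (G : Graph) (k z x : ℕ) : Prop :=
  ∀ U, G.Closed U → x ∈ U → k < U.card ∨ z ≤ U.card

/-- The number of edges not yet followed. -/
def rest (G : Graph) (ptr : ℕ → ℕ) : ℕ := ∑ x ∈ G.verts, (G.last x - ptr x)

theorem rest_update {G : Graph} {ptr : ℕ → ℕ} {x : ℕ} (hx : x ∈ G.verts) (h : ptr x < G.last x) :
    G.rest (Function.update ptr x (ptr x + 1)) + 1 = G.rest ptr := by
  rw [rest, rest, ← Finset.add_sum_erase _ _ hx, ← Finset.add_sum_erase _ _ hx]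
  rw [Function.update_self]
  have : ∑ y ∈ G.verts.erase x, (G.last y - Function.update ptr x (ptr x + 1) y) =
      ∑ y ∈ G.verts.erase x, (G.last y - ptr y) := by
    refine Finset.sum_congr rfl fun y hy => ?_
    rw [Function.update_of_ne (Finset.ne_of_mem_erase hy)]
  omega

end Graph

/-- The invariant of the path-based search. The places `base, …, top - 1` of `st` hold the path,
`idx` gives the places of the vertices; the path is divided into blocks that begin at the places
`bs i`, and `us` holds the places of vertices that may have unexplored edges. An edge to `w` may
have been followed and not yet been taken into account. -/
structure PathInv (G : Graph) (idx ptr st us bs : ℕ → ℕ) (k z base top bt ut : ℕ)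
    (w : Option ℕ) : Prop where
  two_le : 2 ≤ base
  le : base ≤ top
  st_mem : ∀ p, 2 ≤ p → p < top → st p ∈ G.verts ∧ idx (st p) = p
  idx_lt : ∀ x ∈ G.verts, 2 ≤ idx x → idx x < top ∧ st (idx x) = x
  idx_zero : idx 0 = 1
  bs_zero : bt ≠ 0 → bs 0 = base
  bs_empty : bt = 0 ↔ base = top
  bs_lt : ∀ i < bt, bs i < top
  bs_mono : ∀ j < bt, ∀ i < j, bs i < bs j
  us_pos : 0 < ut
  us_zero : us 0 = 0
  us_mem : ∀ j, 0 < j → j < ut → base ≤ us j ∧ us j < top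
  us_mono : ∀ j < ut, ∀ i < j, us i < us j
  unfinished : ∀ p, base ≤ p → p < top → (∃ j, 0 < j ∧ j < ut ∧ us j = p) ∨
    ptr (st p) = G.last (st p)
  ptr_le : ∀ x ∈ G.verts, G.first x ≤ ptr x ∧ ptr x ≤ G.last x
  fresh : ∀ x ∈ G.verts, idx x = 0 → ptr x = G.first x
  scanned : ∀ p, base ≤ p → p < top → ∀ q, G.first (st p) ≤ q → q < ptr (st p) →
    w = some (G.tail q) ∨ ∀ i < bt, bs i ≤ p → bs i ≤ idx (G.tail q)
  pending : ∀ y, w = some y → ∀ U, G.Closed U → ∀ p, base ≤ p → p < top → st p ∈ U → y ∈ U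
  conn : ∀ U, G.Closed U → ∀ p p', base ≤ p → p < top → base ≤ p' → p' < top →
    (∀ i < bt, bs i ≤ p → bs i ≤ p') → st p ∈ U → st p' ∈ U
  done : ∀ x, 1 ≤ idx x → idx x < base → G.Excluded k z x

section

variable {G : Graph} {idx ptr st us bs : ℕ → ℕ} {k z base top bt ut x : ℕ} {w : Option ℕ}

theorem PathInv.injOn (h : PathInv G idx ptr st us bs k z base top bt ut w) {p q : ℕ}
    (h1 : 2 ≤ p) (h2 : p < top) (h3 : 2 ≤ q) (h4 : q < top) (e : st p = st q) : p = q := by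
  rw [← (h.st_mem p h1 h2).2, e, (h.st_mem q h3 h4).2]

theorem PathInv.top_le (h : PathInv G idx ptr st us bs k z base top bt ut w) :
    top ≤ G.verts.card + 2 := by
  have h1 : ((Finset.Ico 2 top).image st).card = top - 2 := by
    rw [Finset.card_image_of_injOn, Nat.card_Ico]
    intro p hp q hq e
    simp only [Finset.coe_Ico, Set.mem_Ico] at hp hq
    exact h.injOn hp.1 hp.2 hq.1 hq.2 e
  have h2 : (Finset.Ico 2 top).image st ⊆ G.verts := by
    intro x hx
    simp only [Finset.mem_image, Finset.mem_Ico] at hx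
    obtain ⟨p, hp, rfl⟩ := hx
    exact (h.st_mem p hp.1 hp.2).1
  have := Finset.card_le_card h2
  omega

/-- The path is empty, so nothing has to lead to the new starting vertex `y`. -/
theorem PathInv.start (h : PathInv G idx ptr st us bs k z top top bt ut none) (y : ℕ) :
    PathInv G idx ptr st us bs k z top top bt ut (some y) :=
  { h with
    scanned := fun p h1 h2 => by omega
    pending := fun y _ U _ p h1 h2 => by omega }

/-- Drop the path, of which all vertices are excluded. -/
theorem PathInv.clear (h : PathInv G idx ptr st us bs k z base top bt ut w) {z' : ℕ}
    (hz : z' ≤ z) (hex : ∀ p, base ≤ p → p < top → G.Excluded k z' (st p)) :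
    PathInv G idx ptr st us bs k z' top top 0 1 none where
  two_le := h.two_le.trans h.le
  le := le_rfl
  st_mem := h.st_mem
  idx_lt := h.idx_lt
  idx_zero := h.idx_zero
  bs_zero := fun h => absurd rfl h
  bs_empty := by simp
  bs_lt := fun i hi => by omega
  bs_mono := fun i hi => by omega
  us_pos := one_pos
  us_zero := h.us_zero
  us_mem := fun j h1 h2 => by omega
  us_mono := fun j h1 i h2 => by omega
  unfinished := fun p h1 h2 => by omega
  ptr_le := h.ptr_le
  fresh := h.fresh
  scanned := fun p h1 h2 => by omega
  pending := fun y hy => by simp at hy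
  conn := fun U _ p p' h1 h2 => by omega
  done := by
    intro x h1 h2 U hU hx
    by_cases h3 : idx x < base
    · exact (h.done x h1 h3 U hU hx).imp_right hz.trans
    · have hb := h.two_le
      have h4 := (h.idx_lt x (hU.1 hx) (by omega)).2
      have := hex (idx x) (by omega) h2
      rw [h4] at this
      exact this U hU hx

/-- Remove a vertex without unexplored edges. -/
theorem PathInv.pop (h : PathInv G idx ptr st us bs k z base top bt ut w) (hut : 1 < ut)
    (hx : ptr (st (us (ut - 1))) = G.last (st (us (ut - 1)))) :
    PathInv G idx ptr st us bs k z base top bt (ut - 1) w :=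
  { h with
    us_pos := by omega
    us_mem := fun j h1 h2 => h.us_mem j h1 (by omega)
    us_mono := fun j h1 => h.us_mono j (by omega)
    unfinished := by
      intro p h1 h2
      rcases h.unfinished p h1 h2 with ⟨j, h3, h4, h5⟩ | h3
      · by_cases h6 : j = ut - 1
        · subst h6
          rw [← h5]
          exact Or.inr hx
        · exact Or.inl ⟨j, h3, by omega, h5⟩
      · exact Or.inr h3 }

/-- Follow an edge. -/
theorem PathInv.advance (h : PathInv G idx ptr st us bs k z base top bt ut none) {u : ℕ}
    (hu : base ≤ u) (hut : u < top) (hB : ∀ i < bt, bs i ≤ u) (hj : ∃ j, 0 < j ∧ j < ut ∧ us j = u)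
    (hp : ptr (st u) < G.last (st u)) :
    PathInv G idx (Function.update ptr (st u) (ptr (st u) + 1)) st us bs k z base top bt ut
      (some (G.tail (ptr (st u)))) := by
  have hb := h.two_le
  obtain ⟨hV, hidx⟩ := h.st_mem u (by omega) hut
  refine { h with unfinished := ?_, ptr_le := ?_, fresh := ?_, scanned := ?_, pending := ?_ }
  · intro p h1 h2
    by_cases hpu : p = u
    · subst hpu; exact Or.inl hj
    · rw [Function.update_of_ne]
      · exact h.unfinished p h1 h2
      · exact fun e => hpu (h.injOn (by omega) h2 (by omega) hut e)
  · intro x hx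
    rw [Function.update_apply]
    have := h.ptr_le x hx
    split_ifs with e
    · subst e; omega
    · exact this
  · intro x hx h0
    rw [Function.update_of_ne]
    · exact h.fresh x hx h0
    · rintro rfl; omega
  · intro p h1 h2 q h3 h4
    by_cases hpu : p = u
    · subst hpu
      rw [Function.update_self] at h4
      by_cases hq : q = ptr (st p)
      · subst hq; exact Or.inl rfl
      · exact Or.inr ((h.scanned p h1 h2 q h3 (by omega)).resolve_left (by simp))
    · rw [Function.update_of_ne] at h4
      · exact Or.inr ((h.scanned p h1 h2 q h3 h4).resolve_left (by simp))
      · exact fun e => hpu (h.injOn (by omega) h2 (by omega) hut e)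
  -- `u` lies in the last block, so every vertex of the path leads to it by `conn`, and from it
  -- along the new edge.
  · intro y hy U hU p h1 h2 h3
    cases hy
    exact hU.2 _ (h.conn U hU p u h1 h2 hu hut (fun i hi _ => hB i hi) h3) _ (h.ptr_le _ hV).1 hp

/-- Put a new vertex onto the path. -/
theorem PathInv.push {w : ℕ} (h : PathInv G idx ptr st us bs k z base top bt ut (some w))
    (hw : w ∈ G.verts) (h0 : idx w = 0) :
    PathInv G (Function.update idx w top) ptr (Function.update st top w)
      (Function.update us ut top) (Function.update bs bt top) k z base (top + 1) (bt + 1) (ut + 1)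
      none := by
  have hb := h.two_le
  have hle := h.le
  have hne : ∀ p, 2 ≤ p → p < top → st p ≠ w := by
    rintro p h1 h2 rfl
    have := (h.st_mem p h1 h2).2
    omega
  have hbs : ∀ i < bt, Function.update bs bt top i = bs i := fun i hi =>
    Function.update_of_ne (by omega) _ _
  have hus : ∀ i < ut, Function.update us ut top i = us i := fun i hi =>
    Function.update_of_ne (by omega) _ _
  have hst : ∀ p < top, Function.update st top w p = st p := fun i hi =>
    Function.update_of_ne (by omega) _ _
  have hup := h.us_pos
  refine ⟨hb, by omega, ?_, ?_, ?_, ?_, by omega, ?_, ?_, by omega, ?_, ?_, ?_, ?_, h.ptr_le, ?_,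
    ?_, by simp, ?_, ?_⟩
  · intro p h1 h2
    by_cases hp : p = top
    · subst hp; simp [hw]
    · rw [hst p (by omega), Function.update_of_ne (hne p h1 (by omega))]
      exact h.st_mem p h1 (by omega)
  · intro x hx h1
    rw [Function.update_apply] at h1 ⊢
    split_ifs at h1 ⊢ with e
    · simp [e]
    · have := h.idx_lt x hx h1
      rw [hst _ this.1]
      exact ⟨by omega, this.2⟩
  · rw [Function.update_of_ne]
    · exact h.idx_zero
    · rintro rfl
      have := h.idx_zero
      omega
  · intro _
    by_cases hbt : bt = 0
    · subst hbt
      rw [Function.update_self]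
      exact (h.bs_empty.mp rfl).symm
    · rw [hbs 0 (by omega)]
      exact h.bs_zero hbt
  · intro i hi
    rw [Function.update_apply]
    split_ifs with e
    · omega
    · exact (h.bs_lt i (by omega)).trans (by omega)
  · intro j hj i hi
    rw [hbs i (by omega), Function.update_apply]
    split_ifs with e
    · exact h.bs_lt i (by omega)
    · exact h.bs_mono j (by omega) i hi
  · rw [hus 0 hup]
    exact h.us_zero
  · intro j h1 h2
    rw [Function.update_apply]
    split_ifs with e
    · omega
    · have := h.us_mem j h1 (by omega)
      omega
  · intro j hj i hi
    rw [hus i (by omega), Function.update_apply]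
    split_ifs with e
    · rcases Nat.eq_zero_or_pos i with rfl | hi0
      · rw [h.us_zero]; omega
      · exact (h.us_mem i hi0 (by omega)).2
    · exact h.us_mono j (by omega) i hi
  · intro p h1 h2
    by_cases hp : p = top
    · subst hp
      exact Or.inl ⟨ut, hup, by omega, Function.update_self ..⟩
    · rw [hst p (by omega)]
      rcases h.unfinished p h1 (by omega) with ⟨j, h3, h4, h5⟩ | h3
      · exact Or.inl ⟨j, h3, by omega, by rw [hus j h4, h5]⟩
      · exact Or.inr h3
  · intro x hx h1
    apply h.fresh x hx
    rw [Function.update_apply] at h1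
    split_ifs at h1 with e
    · omega
    · exact h1
  · intro p h1 h2 q h3 h4
    right
    by_cases hp : p = top
    · subst hp
      rw [Function.update_self] at h3 h4
      have := h.fresh w hw h0
      omega
    · rw [hst p (by omega)] at h3 h4
      intro i hi h5
      by_cases hib : i = bt
      · subst hib
        rw [Function.update_self] at h5
        omega
      · rw [hbs i (by omega)] at h5 ⊢
        rw [Function.update_apply]
        -- The edge that was pending leads to `w`, now at place `top`, beyond the start of every
        -- block.
        split_ifs with e
        · exact (h.bs_lt i (by omega)).le
        · refine (h.scanned p h1 (by omega) q h3 h4).resolve_left ?_ i (by omega) h5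
          intro e'
          cases e'
          exact e rfl
  · intro U hU p p' h1 h2 h3 h4 h5 h6
    by_cases hp' : p' = top
    · subst hp'
      rw [Function.update_self]
      by_cases hp : p = p'
      · subst hp
        rwa [Function.update_self] at h6
      · rw [hst p (by omega)] at h6
        exact h.pending w rfl U hU p h1 (by omega) h6
    · rw [hst p' (by omega)]
      by_cases hp : p = top
      · subst hp
        have := h5 bt (by omega)
        rw [Function.update_self] at this
        omega
      · rw [hst p (by omega)] at h6
        refine h.conn U hU p p' h1 (by omega) h3 (by omega) ?_ h6
        intro i hi
        have := h5 i (by omega)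
        rwa [hbs i hi] at this
  · intro x h1 h2
    rw [Function.update_apply] at h1 h2
    split_ifs at h1 h2 with e
    · omega
    · exact h.done x h1 h2

/-- Merge the last two blocks. -/
theorem PathInv.merge {w : ℕ} (h : PathInv G idx ptr st us bs k z base top bt ut (some w))
    (hw : w ∈ G.verts) (hi : base ≤ idx w) (hlt : idx w < bs (bt - 1)) :
    1 < bt ∧ PathInv G idx ptr st us bs k z base top (bt - 1) ut (some w) := by
  have hb := h.two_le
  have hbt : 1 < bt := by
    by_contra hbt
    have e : bt - 1 = 0 := by omega
    rw [e] at hlt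
    by_cases h0 : bt = 0
    · have := h.bs_empty.mp h0
      have := (h.idx_lt w hw (by omega)).1
      omega
    · have := h.bs_zero h0
      omega
  obtain ⟨hwt, hws⟩ := h.idx_lt w hw (by omega)
  refine ⟨hbt, { h with
    bs_zero := fun _ => h.bs_zero (by omega)
    bs_empty := ?_
    bs_lt := fun i hi => h.bs_lt i (by omega)
    bs_mono := fun i hi => h.bs_mono i (by omega)
    scanned := ?_
    conn := ?_ }⟩
  · omega
  · intro p h1 h2 q h3 h4
    exact (h.scanned p h1 h2 q h3 h4).imp_right fun h5 i hi => h5 i (by omega)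
  · intro U hU p p' h1 h2 h3 h4 h5 h6
    by_cases h7 : ∀ i < bt, bs i ≤ p → bs i ≤ p'
    · exact h.conn U hU p p' h1 h2 h3 h4 h7 h6
    · push Not at h7
      obtain ⟨i, h8, h9, h10⟩ := h7
      have hib : i = bt - 1 := by
        by_contra hib
        have := h5 i (by omega) h9
        omega
      subst hib
      -- Only the start of the removed block separates `p` from `p'`. Then the way goes from `p`
      -- along the pending edge back to `w`, which lies before that block, and on to `p'`.
      have hwU := h.pending w rfl U hU p h1 h2 h6
      rw [← hws] at hwU
      refine h.conn U hU (idx w) p' hi hwt h3 h4 ?_ hwU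
      intro j hj hjw
      have hjb : j < bt - 1 := by
        by_contra hjb
        obtain rfl : j = bt - 1 := by omega
        omega
      exact h5 j hjb ((h.bs_mono (bt - 1) (by omega) j hjb).le.trans h9)

/-- The pending edge leads into the last block. -/
theorem PathInv.resolve {w : ℕ} (h : PathInv G idx ptr st us bs k z base top bt ut (some w))
    (hle : bs (bt - 1) ≤ idx w) : PathInv G idx ptr st us bs k z base top bt ut none :=
  { h with
    scanned := by
      intro p h1 h2 q h3 h4
      right
      rcases h.scanned p h1 h2 q h3 h4 with h5 | h5
      · cases h5
        intro i hi _
        by_cases hib : i = bt - 1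
        · rw [hib]; exact hle
        · exact (h.bs_mono (bt - 1) (by omega) i (by omega)).le.trans hle
      · exact h5
    pending := by simp }

/-- The last block is closed if it has no unexplored edges. -/
theorem PathInv.closed (h : PathInv G idx ptr st us bs k z base top bt ut none) (hG : G.Valid)
    (hlt : us (ut - 1) < bs (bt - 1)) (hbt : base < top) :
    2 ≤ bs (bt - 1) ∧ bs (bt - 1) < top ∧ base ≤ bs (bt - 1) ∧
      G.Closed ((Finset.Ico (bs (bt - 1)) top).image st) := by
  have hb := h.two_le
  have hbt0 : bt ≠ 0 := fun h0 => by
    have := h.bs_empty.mp h0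
    omega
  have h1 : base ≤ bs (bt - 1) := by
    rw [← h.bs_zero hbt0]
    by_cases e : bt - 1 = 0
    · rw [e]
    · exact (h.bs_mono (bt - 1) (by omega) 0 (by omega)).le
  refine ⟨by omega, h.bs_lt _ (by omega), h1, ?_, ?_⟩
  · intro x hx
    simp only [Finset.mem_image, Finset.mem_Ico] at hx
    obtain ⟨p, hp, rfl⟩ := hx
    exact (h.st_mem p (by omega) hp.2).1
  · intro x hx q hq1 hq2
    simp only [Finset.mem_image, Finset.mem_Ico] at hx ⊢
    obtain ⟨p, hp, rfl⟩ := hx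
    have hfin : ptr (st p) = G.last (st p) := by
      refine (h.unfinished p (by omega) hp.2).resolve_left ?_
      rintro ⟨j, h2, h3, h4⟩
      -- The places in `us` increase, so none of them reaches the last block.
      have : us j ≤ us (ut - 1) := by
        by_cases e : j = ut - 1
        · rw [e]
        · exact (h.us_mono (ut - 1) (by omega) j (by omega)).le
      omega
    have h2 := (h.scanned p (by omega) hp.2 q hq1 (by omega)).resolve_left (by simp)
      (bt - 1) (by omega) hp.1
    have h3 : G.tail q ∈ G.verts := by
      -- The edge stays in the block, hence its target has index at least `2`, whereas the source
      -- `0` has index `1`.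
      refine (hG.edge _ (h.st_mem p (by omega) hp.2).1 q hq1 hq2).resolve_right fun e => ?_
      rw [e, h.idx_zero] at h2
      omega
    obtain ⟨h4, h5⟩ := h.idx_lt _ h3 (by omega)
    exact ⟨idx (G.tail q), ⟨h2, h4⟩, h5⟩

/-- The vertices of the path are excluded by a closed last block. -/
theorem PathInv.excluded (h : PathInv G idx ptr st us bs k z base top bt ut w)
    (h2 : base ≤ bs (bt - 1)) {p : ℕ} (hp : base ≤ p) (hpt : p < top)
    {z' : ℕ} (hz : z' ≤ top - bs (bt - 1)) : G.Excluded k z' (st p) := by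
  intro U hU hpU
  right
  have hb := h.two_le
  -- Every vertex of the path leads to every vertex of the last block, so a closed set through the
  -- path includes that block.
  have hsub : (Finset.Ico (bs (bt - 1)) top).image st ⊆ U := by
    intro x hx
    simp only [Finset.mem_image, Finset.mem_Ico] at hx
    obtain ⟨p', hp', rfl⟩ := hx
    refine h.conn U hU p p' hp hpt (by omega) hp'.2 ?_ hpU
    intro i hi _
    refine le_trans ?_ hp'.1
    by_cases e : i = bt - 1
    · rw [e]
    · exact (h.bs_mono (bt - 1) (by omega) i (by omega)).le
  have := Finset.card_le_card hsub
  rw [Finset.card_image_of_injOn, Nat.card_Ico] at this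
  · omega
  · intro p hp q hq e
    simp only [Finset.coe_Ico, Set.mem_Ico] at hp hq
    exact h.injOn (by omega) hp.2 (by omega) hq.2 e

end

/-- The best closed set found so far, of cardinality `z`, is in the places `lo, …, hi - 1`. -/
def BestSet (G : Graph) (st : ℕ → ℕ) (z lo hi top : ℕ) : Prop :=
  (z = G.verts.card + 1 ∧ lo = 0 ∧ hi = 0) ∨
  (2 ≤ lo ∧ lo < hi ∧ hi ≤ top ∧ z = hi - lo ∧ G.Closed ((Finset.Ico lo hi).image st))

/-- The machine holds the graph. -/
structure HasGraph (A : ℕ → ℕ → ℕ) (G : Graph) : Prop where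
  first : A aStart = G.first
  last : A aEnd = G.last
  tail : ∀ p, A aEtl (A aEnt p) = G.tail p

/-- The invariant of the search as a property of machine states. -/
structure SearchInv (G : Graph) (k : ℕ) (w : Option ℕ) (σ : State) : Prop where
  zero : σ.reg rZ = 0
  graph : HasGraph σ.arr G
  path : PathInv G (σ.arr aIdx) (σ.arr aPtr) (σ.arr aSt) (σ.arr aUs) (σ.arr aBs) k (σ.reg rBz)
    (σ.reg rBase) (σ.reg rTop) (σ.reg rBt) (σ.reg rUt) w
  best : BestSet G (σ.arr aSt) (σ.reg rBz) (σ.reg rLo) (σ.reg rHi) (σ.reg rTop)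

theorem SearchInv.congr {G : Graph} {k : ℕ} {w : Option ℕ} {σ σ' : State}
    (h : SearchInv G k w σ)
    (hr : ∀ r ∈ [rZ, rBz, rBase, rTop, rBt, rUt, rLo, rHi], σ'.reg r = σ.reg r)
    (ha : ∀ m ∈ [aStart, aEnd, aEtl, aEnt, aIdx, aPtr, aSt, aUs, aBs], σ'.arr m = σ.arr m) :
    SearchInv G k w σ' := by
  simp only [List.mem_cons, List.not_mem_nil, or_false, forall_eq_or_imp, forall_eq] at hr ha
  obtain ⟨r1, r2, r3, r4, r5, r6, r7, r8⟩ := hr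
  obtain ⟨a1, a2, a3, a4, a5, a6, a7, a8, a9⟩ := ha
  obtain ⟨h1, ⟨h2, h3, h4⟩, h5, h6⟩ := h
  refine ⟨r1.trans h1, ⟨a1.trans h2, a2.trans h3, ?_⟩, ?_, ?_⟩
  · rw [a3, a4]; exact h4
  · rw [r2, r3, r4, r5, r6, a5, a6, a7, a8, a9]; exact h5
  · rw [r2, r4, r7, r8, a7]; exact h6

/-- Every round pops one block start, which pays for it; at the end `w` lies in the last block, and
its edge is no longer pending. -/
theorem wp_mergeBlocks {G : Graph} {k w : ℕ} {σ : State} (h : SearchInv G k (some w) σ)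
    (hw : w ∈ G.verts) (hI : σ.reg rI = σ.arr aIdx w) (hle : σ.reg rBase ≤ σ.arr aIdx w)
    (hB : σ.reg rB = σ.arr aBs (σ.reg rBt - 1)) :
    wp mergeBlocks (fun σ' => SearchInv G k none σ' ∧
      σ'.time + 5 * σ'.reg rBt ≤ σ.time + 1 + 5 * σ.reg rBt) σ := by
  refine wp_loop (fun σ' => SearchInv G k (some w) σ' ∧ σ'.reg rI = σ'.arr aIdx w ∧
    σ'.reg rBase ≤ σ'.arr aIdx w ∧ σ'.reg rB = σ'.arr aBs (σ'.reg rBt - 1) ∧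
    σ'.time + 5 * σ'.reg rBt ≤ σ.time + 5 * σ.reg rBt) (σ.time + 5 * σ.reg rBt) ?_
    ⟨h, hI, hle, hB, le_rfl⟩ ?_ ?_
  · rintro σ' ⟨-, -, -, -, h1⟩
    omega
  · rintro ⟨reg, A, o, t⟩ ⟨h1, h2, h3, h4, h5⟩ hb
    dsimp only at *
    simp only [exec_rules] at hb
    obtain ⟨g1, g2⟩ := h1.path.merge hw h3 (by dsimp only; omega)
    dsimp only at g1 g2
    simp only [exec_rules, Nat.reduceEqDiff]
    refine ⟨⟨h1.zero, h1.graph, g2, h1.best⟩, h2, h3, trivial, by omega⟩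
  · rintro σ' ⟨h1, h2, h3, h4, h5⟩ hb
    have hb' : ¬ σ'.reg rI < σ'.reg rB := hb
    refine ⟨⟨h1.zero, h1.graph, h1.path.resolve (by omega), h1.best⟩, ?_⟩
    have e1 : σ'.tick.time = σ'.time + 1 := rfl
    have e2 : σ'.tick.reg = σ'.reg := rfl
    rw [e1, e2]
    omega

theorem wp_countUp (x y z : ℕ) (hxz : z ≠ x) (hyz : y ≠ z) (hxy : x ≠ y) (σ : State) :
    wp (Code.loop (Cond.lt x y) (inc x x ;; inc z z)) (fun σ' =>
      σ'.reg z = σ.reg z + (σ.reg y - σ.reg x) ∧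
      σ'.time ≤ σ.time + 1 + 3 * (σ.reg y - σ.reg x)) σ := by
  refine wp_loop (fun σ' => σ'.reg y = σ.reg y ∧ σ.reg x ≤ σ'.reg x ∧
    (σ.reg x ≤ σ.reg y → σ'.reg x ≤ σ.reg y) ∧ (σ.reg y < σ.reg x → σ'.reg x = σ.reg x) ∧
    σ'.reg z = σ.reg z + (σ'.reg x - σ.reg x) ∧
    σ'.time ≤ σ.time + 3 * (σ'.reg x - σ.reg x)) (σ.time + 3 * (σ.reg y - σ.reg x)) ?_
    ⟨rfl, le_rfl, id, fun _ => rfl, by omega, by omega⟩ ?_ ?_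
  · rintro σ' ⟨h1, h2, h3, h4, h5, h6⟩
    omega
  · rintro ⟨reg, A, o, t⟩ ⟨h1, h2, h3, h4, h5, h6⟩ hb
    dsimp only at *
    simp only [exec_rules] at hb
    simp only [exec_rules, update_reg hxz, update_reg hyz, update_reg hxy.symm,
      update_reg hxz.symm]
    omega
  · rintro σ' ⟨h1, h2, h3, h4, h5, h6⟩ hb
    have hb' : ¬ σ'.reg x < σ'.reg y := hb
    have e1 : σ'.tick.time = σ'.time + 1 := rfl
    have e2 : σ'.tick.reg = σ'.reg := rfl
    rw [e1, e2]
    omega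

/-- Later vertices are put at `top` and beyond, also after the path has been dropped; a recorded set
stays readable. -/
theorem BestSet.mono {G : Graph} {st st' : ℕ → ℕ} {z lo hi top top' : ℕ}
    (h : BestSet G st z lo hi top) (hle : top ≤ top') (hst : ∀ p < top, st' p = st p) :
    BestSet G st' z lo hi top' := by
  rcases h with h | ⟨h1, h2, h3, h4, h5⟩
  · exact Or.inl h
  · refine Or.inr ⟨h1, h2, h3.trans hle, h4, ?_⟩
    rwa [Finset.image_congr (g := st)]
    intro p hp
    simp only [Finset.coe_Ico, Set.mem_Ico] at hp
    exact hst p (by omega)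

theorem wp_pushVertex {G : Graph} {k w : ℕ} {σ : State} (h : SearchInv G k (some w) σ)
    (hX : σ.reg rX = w) (hw : w ∈ G.verts) (h0 : σ.arr aIdx w = 0) :
    wp pushVertex (fun σ' => SearchInv G k none σ' ∧ σ'.reg rTop = σ.reg rTop + 1 ∧
      σ'.reg rBt = σ.reg rBt + 1 ∧ σ'.reg rUt = σ.reg rUt + 1 ∧
      (∀ x, σ.arr aIdx x ≠ 0 ∨ x = w → σ'.arr aIdx x ≠ 0) ∧ σ'.time = σ.time + 7) σ := by
  obtain ⟨reg, A, o, t⟩ := σ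
  obtain ⟨h1, h2, h3, h4⟩ := h
  have h5 := h3.push hw h0
  have hb := h3.two_le
  have hle := h3.le
  dsimp only at *
  simp only [pushVertex, exec_rules, Nat.reduceEqDiff, hX]
  refine ⟨⟨h1, ⟨h2.first, h2.last, h2.tail⟩, h5, ?_⟩, trivial, trivial, trivial, ?_, trivial⟩
  · exact h4.mono (Nat.le_succ _) fun p hp => Function.update_of_ne (by omega) _ _
  · intro x hx
    rw [Function.update_apply]
    split_ifs with e
    · omega
    · exact hx.resolve_right e

/-- The potential of the search. -/
def searchCost (G : Graph) (σ : State) : ℕ :=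
  30 * G.rest (σ.arr aPtr) + 15 * σ.reg rUt + 5 * σ.reg rBt

/-- Following an edge releases 30 units of potential. Growth of `rTop` by one gives 20 more, the 15
and 5 that the new entries of `aUs` and `aBs` store. If the edge ends in a finished vertex, the
exclusion of that vertex passes to the whole path. -/
theorem wp_followEdge {G : Graph} {k u : ℕ} {σ : State} (hG : G.Valid) (h : SearchInv G k none σ)
    (hu : σ.reg rBase ≤ u) (hut : u < σ.reg rTop) (hX : σ.reg rX = σ.arr aSt u)
    (hP : σ.reg rP = σ.arr aPtr (σ.arr aSt u))
    (hlast : σ.reg rP ≠ σ.arr aEnd (σ.arr aSt u))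
    (hB : σ.reg rB = σ.arr aBs (σ.reg rBt - 1)) (hBu : σ.reg rB ≤ u)
    (hj : ∃ j, 0 < j ∧ j < σ.reg rUt ∧ σ.arr aUs j = u) :
    wp followEdge (fun σ' => SearchInv G k none σ' ∧
      (∀ x, σ.arr aIdx x ≠ 0 → σ'.arr aIdx x ≠ 0) ∧
      σ'.time + searchCost G σ' + 20 * (σ.reg rTop + σ.reg rBase) + 12 ≤
        σ.time + searchCost G σ + 20 * (σ'.reg rTop + σ'.reg rBase)) σ := by
  have hb := h.path.two_le
  obtain ⟨hV, hidx⟩ := h.path.st_mem u (by omega) hut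
  have hbs : ∀ i < σ.reg rBt, σ.arr aBs i ≤ u := by
    intro i hi
    refine le_trans ?_ hBu
    rw [hB]
    by_cases e : i = σ.reg rBt - 1
    · rw [e]
    · exact (h.path.bs_mono _ (by omega) i (by omega)).le
  have hptr := h.path.ptr_le _ hV
  have hlt : σ.arr aPtr (σ.arr aSt u) < G.last (σ.arr aSt u) := by
    rw [hP, h.graph.last] at hlast
    omega
  have hadv := h.path.advance hu hut hbs hj hlt
  have hrest := Graph.rest_update hV hlt
  have hedge := hG.edge _ hV _ hptr.1 hlt
  have htail := h.graph.tail (σ.arr aPtr (σ.arr aSt u))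
  generalize hw : G.tail (σ.arr aPtr (σ.arr aSt u)) = w at *
  obtain ⟨reg, A, o, t⟩ := σ
  obtain ⟨h1, h2, h3, h4⟩ := h
  dsimp only at *
  rw [← hP] at htail hrest hadv
  simp only [followEdge, exec_rules, Nat.reduceEqDiff, htail]
  refine ⟨fun hi => ?_, fun hi => ⟨fun hlt => ?_, fun hge => ?_⟩⟩
  · have hwV : w ∈ G.verts := by
      refine hedge.resolve_right fun e => ?_
      rw [e, h3.idx_zero, h1] at hi
      omega
    refine wp_frame (wp_pushVertex (G := G) (k := k) (w := w) ⟨h1, ⟨h2.first, h2.last, h2.tail⟩, ?_, ?_⟩ ?_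
      hwV ?_) ?_ <;> try simp only [exec_rules, Nat.reduceEqDiff]
    · rw [hX]; exact hadv
    · exact h4
    · exact hi.trans h1
    · intro σ' hf ⟨g1, g2, g3, g4, g5, g6⟩
      have e1 := hf.reg rBase (by decide)
      have e2 := hf.arr aPtr (by decide)
      simp only [exec_rules, Nat.reduceEqDiff] at e1 e2 g2 g3 g4 g5 g6
      refine ⟨g1, fun x hx => g5 x (Or.inl hx), ?_⟩
      simp only [searchCost]
      rw [e1, e2, g2, g3, g4, g6, hX]
      omega
  · simp only [clearPath, exec_rules, Nat.reduceEqDiff]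
    refine ⟨⟨h1, ⟨h2.first, h2.last, h2.tail⟩, ?_, h4⟩, fun x hx => hx, ?_⟩
    · have := hadv.clear le_rfl (fun p g1 g2 U hU hpU =>
        h3.done w (by omega) hlt U hU (hadv.pending w rfl U hU p g1 g2 hpU))
      rw [← hX] at this
      exact this
    · simp only [searchCost, exec_rules, Nat.reduceEqDiff]
      have := h3.us_pos
      have := h3.le
      rw [hX]
      omega
  · have hwV : w ∈ G.verts := by
      refine hedge.resolve_right fun e => ?_
      rw [e, h3.idx_zero] at hge
      omega
    refine wp_frame (wp_mergeBlocks (G := G) (k := k) (w := w) ⟨h1, ⟨h2.first, h2.last, h2.tail⟩, ?_, ?_⟩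
      hwV ?_ ?_ ?_) ?_ <;> try simp only [exec_rules, Nat.reduceEqDiff]
    · rw [hX]; exact hadv
    · exact h4
    · omega
    · exact hB
    · intro σ' hf ⟨g1, g2⟩
      have e1 := hf.reg rBase (by decide)
      have e2 := hf.arr aPtr (by decide)
      have e3 := hf.reg rTop (by decide)
      have e4 := hf.reg rUt (by decide)
      have e5 := hf.arr aIdx (by decide)
      simp only [exec_rules, Nat.reduceEqDiff] at e1 e2 e3 e4 e5 g2
      refine ⟨g1, fun x hx => by rwa [e5], ?_⟩
      simp only [searchCost]
      rw [e1, e2, e3, e4, hX]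
      omega

/-- The rest of the path need not be explored, since its closed sets include the block just found
and are at least as large. Counting the block is paid by the growth of `rBase` to `rTop`. -/
theorem wp_blockFound {G : Graph} {k : ℕ} {σ : State} (hG : G.Valid) (h : SearchInv G k none σ)
    (hlt : σ.reg rBase < σ.reg rTop) (hB : σ.reg rB = σ.arr aBs (σ.reg rBt - 1))
    (hU : σ.arr aUs (σ.reg rUt - 1) < σ.reg rB) :
    wp blockFound (fun σ' => SearchInv G k none σ' ∧
      σ'.time + searchCost G σ' + 20 * (σ.reg rTop + σ.reg rBase) + 6 ≤
        σ.time + searchCost G σ + 20 * (σ'.reg rTop + σ'.reg rBase)) σ := by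
  obtain ⟨c1, c2, c3, c4⟩ := h.path.closed hG (by omega) hlt
  rw [← hB] at c1 c2 c3 c4
  have hex : ∀ z', z' ≤ σ.reg rTop - σ.reg rB → ∀ p, σ.reg rBase ≤ p → p < σ.reg rTop →
      G.Excluded k z' (σ.arr aSt p) := fun z' hz' p g1 g2 =>
    h.path.excluded (by omega) g1 g2 (by omega)
  have hup := h.path.us_pos
  have hz := fun z' (hz' : z' ≤ σ.reg rBz) (hz'' : z' ≤ σ.reg rTop - σ.reg rB) =>
    h.path.clear hz' (hex z' hz'')
  simp only [blockFound, wp_seq]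
  obtain ⟨reg, A, o, t⟩ := σ
  obtain ⟨h1, h2, h3, h4⟩ := h
  dsimp only at *
  simp only [exec_rules]
  refine wp_frame (wp_countUp rI rTop rC (by decide) (by decide) (by decide) _) ?_
  intro ⟨reg', A', o', t'⟩ hf ⟨g1, g2⟩
  have fR := fun x hx => hf.reg x hx
  have fA : A' = A := funext fun m => hf.arr m (by simp [Code.arrs, Instr.arrs])
  have e1 := fR rBz (by decide)
  have e2 := fR rTop (by decide)
  have e3 := fR rB (by decide)
  have e4 := fR rZ (by decide)
  have e5 := fR rLo (by decide)
  have e6 := fR rHi (by decide)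
  have e7 := fR rBase (by decide)
  simp only [exec_rules, Nat.reduceEqDiff] at e1 e2 e3 e4 e5 e6 e7 g1 g2
  subst fA
  simp only [clearPath, exec_rules, Nat.reduceEqDiff, searchCost]
  refine ⟨fun hc => ⟨⟨e4.trans h1, ⟨h2.first, h2.last, h2.tail⟩, ?_, ?_⟩, ?_⟩,
    fun hc => ⟨⟨e4.trans h1, ⟨h2.first, h2.last, h2.tail⟩, ?_, ?_⟩, ?_⟩⟩ <;>
    try simp only [exec_rules, Nat.reduceEqDiff]
  · rw [e2, g1]
    exact hz _ (by omega) (by omega)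
  · rw [e2, e3, g1]
    exact Or.inr ⟨c1, c2, le_rfl, by omega, c4⟩
  · omega
  · rw [e1, e2]
    exact hz _ le_rfl (by omega)
  · rw [e1, e2, e5, e6]
    exact h4
  · omega

theorem wp_searchStep {G : Graph} {k : ℕ} {σ : State} (hG : G.Valid) (h : SearchInv G k none σ)
    (hlt : σ.reg rBase < σ.reg rTop) :
    wp searchStep (fun σ' => SearchInv G k none σ' ∧
      (∀ x, σ.arr aIdx x ≠ 0 → σ'.arr aIdx x ≠ 0) ∧
      σ'.time + searchCost G σ' + 20 * (σ.reg rTop + σ.reg rBase) + 1 ≤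
        σ.time + searchCost G σ + 20 * (σ'.reg rTop + σ'.reg rBase)) σ := by
  obtain ⟨reg, A, o, t⟩ := σ
  have h' := h
  obtain ⟨h1, h2, h3, h4⟩ := h
  dsimp only at *
  simp only [searchStep, exec_rules, Nat.reduceEqDiff]
  have hup := h3.us_pos
  have hb := h3.two_le
  have hbt : 0 < reg rBt := by
    rw [Nat.pos_iff_ne_zero]
    intro e
    have := h3.bs_empty.mp e
    omega
  refine ⟨fun hU => ?_, fun hU => ⟨fun hp => ?_, fun hp => ?_⟩⟩
  · refine wp_frame (wp_blockFound (G := G) (k := k) hG ?_ ?_ ?_ ?_) ?_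
    · apply h'.congr <;> simp only [List.mem_cons, List.not_mem_nil, or_false,
        forall_eq_or_imp, forall_eq, exec_rules, Nat.reduceEqDiff, and_self]
    all_goals try simp only [exec_rules, Nat.reduceEqDiff]
    · exact hlt
    · exact hU
    · intro σ' hf ⟨g1, g2⟩
      have e5 := hf.arr aIdx (by decide)
      simp only [exec_rules, Nat.reduceEqDiff, searchCost] at e5 g2 ⊢
      exact ⟨g1, fun x hx => by rwa [e5], by omega⟩
  · have hbs : reg rBase ≤ A aBs (reg rBt - 1) := by
      rw [← h3.bs_zero (by omega)]
      by_cases e : reg rBt - 1 = 0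
      · rw [e]
      · exact (h3.bs_mono (reg rBt - 1) (by omega) 0 (by omega)).le
    -- The sentinel `us 0 = 0` lies below every block start; so the failed test has looked at a
    -- genuine entry.
    have hut : 1 < reg rUt := by
      by_contra hut
      have e : reg rUt - 1 = 0 := by omega
      rw [e, h3.us_zero] at hU
      omega
    refine ⟨⟨h1, ⟨h2.first, h2.last, h2.tail⟩, ?_, h4⟩, fun x hx => hx, ?_⟩
    · exact h3.pop hut (by rw [← h2.last]; exact hp)
    · simp only [exec_rules, Nat.reduceEqDiff, searchCost]
      omega
  · have hbs : reg rBase ≤ A aBs (reg rBt - 1) := by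
      rw [← h3.bs_zero (by omega)]
      by_cases e : reg rBt - 1 = 0
      · rw [e]
      · exact (h3.bs_mono (reg rBt - 1) (by omega) 0 (by omega)).le
    have hut : 1 < reg rUt := by
      by_contra hut
      have e : reg rUt - 1 = 0 := by omega
      rw [e, h3.us_zero] at hU
      omega
    have hu := h3.us_mem (reg rUt - 1) (by omega) (by omega)
    refine wp_frame (wp_followEdge (G := G) (k := k) (u := A aUs (reg rUt - 1)) hG ?_
      ?_ ?_ ?_ ?_ ?_ ?_ ?_ ?_) ?_
    · apply h'.congr <;> simp only [List.mem_cons, List.not_mem_nil, or_false,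
        forall_eq_or_imp, forall_eq, exec_rules, Nat.reduceEqDiff, and_self]
    all_goals try simp only [exec_rules, Nat.reduceEqDiff]
    · exact hu.1
    · exact hu.2
    · exact hp
    · omega
    · exact ⟨_, by omega, by omega, rfl⟩
    · intro σ' hf ⟨g1, g2, g3⟩
      simp only [exec_rules, Nat.reduceEqDiff, searchCost] at g2 g3 ⊢
      exact ⟨g1, g2, by omega⟩

theorem wp_searchFrom {G : Graph} {k : ℕ} {σ : State} (hG : G.Valid) (h : SearchInv G k none σ)
    (hbt : σ.reg rBase = σ.reg rTop) (hx : σ.arr aVarr (σ.reg rJ) ∈ G.verts) :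
    wp searchFrom (fun σ' => SearchInv G k none σ' ∧ σ'.reg rBase = σ'.reg rTop ∧
      (∀ x, σ.arr aIdx x ≠ 0 ∨ x = σ.arr aVarr (σ.reg rJ) → σ'.arr aIdx x ≠ 0) ∧
      σ'.reg rJ = σ.reg rJ + 1 ∧
      σ'.time + searchCost G σ' + 20 * (σ.reg rTop + σ.reg rBase) ≤
        σ.time + searchCost G σ + 20 * (σ'.reg rTop + σ'.reg rBase) + 12) σ := by
  obtain ⟨reg, A, o, t⟩ := σ
  have h' := h
  obtain ⟨h1, h2, h3, h4⟩ := h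
  dsimp only at *
  simp only [searchFrom, exec_rules, Nat.reduceEqDiff]
  refine ⟨fun hi => ?_, fun hi => ?_⟩
  · refine wp_frame (wp_pushVertex (G := G) (k := k) (w := A aVarr (reg rJ))
      ⟨h1, ⟨h2.first, h2.last, h2.tail⟩, ?_, ?_⟩ ?_ hx ?_) ?_ <;>
      try simp only [exec_rules, Nat.reduceEqDiff]
    · rw [hbt] at h3 ⊢
      exact h3.start _
    · exact h4
    · exact hi.trans h1
    · intro σ₁ hf ⟨g1, g2, g3, g4, g5, g6⟩
      have e1 := hf.reg rBase (by decide)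
      have e2 := hf.arr aPtr (by decide)
      have e3 := hf.reg rJ (by decide)
      simp only [exec_rules, Nat.reduceEqDiff] at e1 e2 e3 g2 g3 g4 g5 g6
      refine wp_frame (wp_loop (fun σ₂ => SearchInv G k none σ₂ ∧
        (∀ x, σ₁.arr aIdx x ≠ 0 → σ₂.arr aIdx x ≠ 0) ∧
        σ₂.time + searchCost G σ₂ + 20 * (σ₁.reg rTop + σ₁.reg rBase) ≤
          σ₁.time + searchCost G σ₁ + 20 * (σ₂.reg rTop + σ₂.reg rBase))
        (Q := fun σ₂ => SearchInv G k none σ₂ ∧ σ₂.reg rBase = σ₂.reg rTop ∧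
          (∀ x, σ₁.arr aIdx x ≠ 0 → σ₂.arr aIdx x ≠ 0) ∧
          σ₂.time + searchCost G σ₂ + 20 * (σ₁.reg rTop + σ₁.reg rBase) ≤
          σ₁.time + searchCost G σ₁ + 20 * (σ₂.reg rTop + σ₂.reg rBase) + 1)
        (σ₁.time + searchCost G σ₁ + 40 * (G.verts.card + 2)) ?_
        ⟨g1, fun x hx => hx, le_rfl⟩ ?_ ?_) ?_
      · rintro σ₂ ⟨k1, k2, k3⟩
        have := k1.path.top_le
        have := k1.path.le
        omega
      · rintro σ₂ ⟨k1, k2, k3⟩ hb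
        refine wp_mono (wp_searchStep (k := k) (σ := σ₂.tick) hG ?_ hb) ?_
        · apply k1.congr <;> intros <;> rfl
        · rintro σ₃ ⟨l1, l2, l3⟩
          refine ⟨l1, fun x hx => l2 x (k2 x hx), ?_⟩
          have : searchCost G σ₂.tick = searchCost G σ₂ := rfl
          have : σ₂.tick.time = σ₂.time + 1 := rfl
          have : σ₂.tick.reg = σ₂.reg := rfl
          simp only [*] at l3
          omega
      · rintro σ₂ ⟨k1, k2, k3⟩ hb
        have hb' : ¬ σ₂.reg rBase < σ₂.reg rTop := hb
        have := k1.path.le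
        refine ⟨?_, ?_, k2, ?_⟩
        · apply k1.congr <;> intros <;> rfl
        · change σ₂.reg rBase = σ₂.reg rTop
          omega
        · change σ₂.time + 1 + searchCost G σ₂ + 20 * (σ₁.reg rTop + σ₁.reg rBase) ≤
            σ₁.time + searchCost G σ₁ + 20 * (σ₂.reg rTop + σ₂.reg rBase) + 1
          omega
      · intro σ₂ hf2 ⟨k1, k2, k3, k4⟩
        have e4 := hf2.reg rJ (by decide)
        rw [e3] at e4
        obtain ⟨reg₂, A₂, o₂, t₂⟩ := σ₂
        dsimp only at *
        simp only [exec_rules, Nat.reduceEqDiff]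
        refine ⟨?_, k2, fun x hx => k3 x (g5 x hx), by omega, ?_⟩
        · apply k1.congr <;> simp only [List.mem_cons, List.not_mem_nil, or_false,
            forall_eq_or_imp, forall_eq, exec_rules, Nat.reduceEqDiff, and_self]
        · simp only [searchCost, exec_rules, Nat.reduceEqDiff] at k4 ⊢
          simp only [e1, e2, g2, g3, g4] at k4
          omega
  · refine ⟨?_, hbt, ?_, trivial, ?_⟩
    · apply h'.congr <;> simp only [List.mem_cons, List.not_mem_nil, or_false,
        forall_eq_or_imp, forall_eq, exec_rules, Nat.reduceEqDiff, and_self]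
    · rintro x (hx | rfl)
      · exact hx
      · omega
    · simp only [searchCost, exec_rules, Nat.reduceEqDiff]
      omega

/-- A graph held by the machine, with a list of its vertices and their degrees. -/
structure GraphState (G : Graph) (σ : State) : Prop where
  zero : σ.reg rZ = 0
  graph : HasGraph σ.arr G
  enum : Enumerates (σ.arr aVarr) (σ.reg rN) G.verts
  degree : ∀ x ∈ G.verts, σ.arr aDeg x + G.first x = G.last x
  sentinel : σ.arr aUs 0 = 0

theorem GraphState.congr {G : Graph} {σ σ' : State} (h : GraphState G σ)
    (hr : ∀ r ∈ [rZ, rN], σ'.reg r = σ.reg r)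
    (ha : ∀ m ∈ [aStart, aEnd, aEtl, aEnt, aVarr, aDeg], σ'.arr m = σ.arr m)
    (hs : σ'.arr aUs 0 = 0) : GraphState G σ' := by
  simp only [List.mem_cons, List.not_mem_nil, or_false, forall_eq_or_imp, forall_eq] at hr ha
  obtain ⟨r1, r2⟩ := hr
  obtain ⟨a1, a2, a3, a4, a5, a6⟩ := ha
  obtain ⟨h1, ⟨h2, h3, h4⟩, h5, h6, -⟩ := h
  refine ⟨r1.trans h1, ⟨a1.trans h2, a2.trans h3, ?_⟩, ?_, ?_, hs⟩
  · rw [a3, a4]; exact h4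
  · rw [a5, r2]; exact h5
  · rw [a6]; exact h6

/-- The search for closed sets of cardinality at most `k` has found a smallest closed set if there
is a closed set of cardinality at most `k`. -/
structure SearchResult (G : Graph) (k : ℕ) (σ : State) : Prop where
  best : BestSet G (σ.arr aSt) (σ.reg rBz) (σ.reg rLo) (σ.reg rHi) (σ.reg rTop)
  inj : ∀ p q, σ.reg rLo ≤ p → p < σ.reg rHi → σ.reg rLo ≤ q → q < σ.reg rHi →
    σ.arr aSt p = σ.arr aSt q → p = q
  least : ∀ U, G.Closed U → U.Nonempty → k < U.card ∨ σ.reg rBz ≤ U.card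

/-- The pointer of a discarded vertex is put at the end of its segment, so that the vertex
contributes nothing to `Graph.rest`. -/
theorem wp_resetLoop {G : Graph} {σ : State} (hG : G.Valid) (h : GraphState G σ)
    (hidx : σ.arr aIdx 0 = 1) (hI : σ.reg rI = 0) :
    wp (Code.loop (Cond.lt rI rN) resetVertex) (fun σ' => σ'.arr aIdx 0 = 1 ∧
      (∀ x ∈ G.verts,
        (G.last x - G.first x ≤ σ.reg rK ∧ σ'.arr aIdx x = 0 ∧ σ'.arr aPtr x = G.first x) ∨
        (σ.reg rK < G.last x - G.first x ∧ σ'.arr aIdx x = 1 ∧ σ'.arr aPtr x = G.last x)) ∧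
      σ'.time ≤ σ.time + 1 + 9 * G.verts.card) σ := by
  have hcard := h.enum.card
  refine wp_loop (fun σ' => σ'.reg rZ = 0 ∧ HasGraph σ'.arr G ∧
    σ'.arr aVarr = σ.arr aVarr ∧ σ'.arr aDeg = σ.arr aDeg ∧ σ'.reg rN = σ.reg rN ∧
    σ'.reg rK = σ.reg rK ∧ σ'.reg rI ≤ σ.reg rN ∧
    σ'.arr aIdx 0 = 1 ∧
    (∀ i < σ'.reg rI,
      (G.last (σ.arr aVarr i) - G.first (σ.arr aVarr i) ≤ σ.reg rK ∧
        σ'.arr aIdx (σ.arr aVarr i) = 0 ∧ σ'.arr aPtr (σ.arr aVarr i) = G.first (σ.arr aVarr i)) ∨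
      (σ.reg rK < G.last (σ.arr aVarr i) - G.first (σ.arr aVarr i) ∧
        σ'.arr aIdx (σ.arr aVarr i) = 1 ∧ σ'.arr aPtr (σ.arr aVarr i) = G.last (σ.arr aVarr i))) ∧
    σ'.time ≤ σ.time + 9 * σ'.reg rI)
    (σ.time + 9 * G.verts.card) ?_ ?_ ?_ ?_
  · rintro σ' ⟨-, -, -, -, -, -, h1, -, -, h2⟩
    omega
  · exact ⟨h.zero, h.graph, rfl, rfl, rfl, rfl, by omega, hidx, by omega, by omega⟩
  · rintro ⟨reg, A, o, t⟩ ⟨h1, h2, h3, h4, h5, h6, h7, h8, h9, h10⟩ hb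
    dsimp only at *
    simp only [exec_rules] at hb
    rw [h5] at hb
    have hx : σ.arr aVarr (reg rI) ∈ G.verts := (h.enum.mem _).mpr ⟨_, hb, rfl⟩
    have hd := h.degree _ hx
    have hne : (0 : ℕ) ≠ σ.arr aVarr (reg rI) := by
      intro e
      rw [← e] at hx
      exact hG.zero hx
    have hne' : ∀ i < reg rI, σ.arr aVarr i ≠ σ.arr aVarr (reg rI) := by
      intro i hi e
      have := h.enum.inj i (by omega) _ hb e
      omega
    have hcase : ∀ i, i < reg rI + 1 → i ≠ reg rI → i < reg rI := by omega
    simp only [resetVertex, exec_rules, Nat.reduceEqDiff, h3, h4, h6, h1, h2.first, h2.last]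
    refine ⟨fun hk => ⟨trivial, ⟨h2.first, h2.last, h2.tail⟩, trivial, trivial, h5, trivial,
      by omega, ?_, ?_, by omega⟩, fun hk => ⟨trivial, ⟨h2.first, h2.last, h2.tail⟩, trivial,
      trivial, h5, trivial, by omega, ?_, ?_, by omega⟩⟩
    · rwa [Function.update_of_ne hne]
    · intro i hi
      by_cases e : i = reg rI
      · subst e
        rw [Function.update_self, Function.update_self]
        exact Or.inr ⟨by omega, rfl, rfl⟩
      · have hi' := hcase i hi e
        rw [Function.update_of_ne (hne' i hi'), Function.update_of_ne (hne' i hi')]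
        exact h9 i hi'
    · rwa [Function.update_of_ne hne]
    · intro i hi
      by_cases e : i = reg rI
      · subst e
        rw [Function.update_self, Function.update_self]
        exact Or.inl ⟨by omega, rfl, rfl⟩
      · have hi' := hcase i hi e
        rw [Function.update_of_ne (hne' i hi'), Function.update_of_ne (hne' i hi')]
        exact h9 i hi'
  · rintro σ' ⟨h1, h2, h3, h4, h5, h6, h7, h8, h9, h10⟩ hb
    have hb' : ¬ σ'.reg rI < σ'.reg rN := hb
    refine ⟨h8, ?_, ?_⟩
    · intro x hx
      obtain ⟨i, hi, rfl⟩ := (h.enum.mem x).mp hx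
      exact h9 i (by omega)
    · change σ'.time + 1 ≤ _
      omega

/-- The potential starts with at most 30 units for each of the at most `n * rK` edges considered;
the gains from `rTop` and `rBase`, both at most `n + 2`, and the loops over the vertices add terms
linear in `n`. -/
theorem wp_searchPhase {G : Graph} {σ : State} (hG : G.Valid) (h : GraphState G σ) :
    wp searchPhase (fun σ' => SearchResult G (σ.reg rK) σ' ∧ GraphState G σ' ∧
      σ'.time ≤ σ.time + 30 * (G.verts.card * σ.reg rK) + 70 * G.verts.card + 140) σ := by
  have hcard := h.enum.card
  simp only [searchPhase, wp_seq]
  obtain ⟨reg, A, o, t⟩ := σ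
  have h0 := h.zero
  dsimp only at *
  simp only [exec_rules, Nat.reduceEqDiff]
  refine wp_frame (wp_resetLoop hG (G := G) ?_ ?_ ?_) ?_
  · refine h.congr ?_ ?_ ?_
    · simp [exec_rules]
    · simp [exec_rules]
    · simp only [exec_rules, Nat.reduceEqDiff]
      exact h.sentinel
  · simp only [exec_rules, Nat.reduceEqDiff, h0]
  · simp only [exec_rules]
  rintro ⟨reg', A', o', t'⟩ hf ⟨g1, g2, g3⟩
  have hR : ∀ r ∈ [rZ, rN, rK], reg' r = reg r := by
    intro r hr
    have := hf.reg r (by revert r; decide)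
    simp only [exec_rules] at this
    simp only [List.mem_cons, List.not_mem_nil, or_false] at hr
    rw [this, Function.update_of_ne (by omega), Function.update_of_ne (by omega)]
  have hA : ∀ m ∈ [aStart, aEnd, aEtl, aEnt, aVarr, aDeg, aUs], A' m = A m := by
    intro m hm
    have := hf.arr m (by revert m; decide)
    simp only [exec_rules] at this
    simp only [List.mem_cons, List.not_mem_nil, or_false] at hm
    rw [this, Function.update_of_ne (by omega)]
  dsimp only at g1 g2 g3
  simp only [exec_rules, Nat.reduceEqDiff] at g2 g3
  have hS : GraphState G ⟨reg', A', o', t'⟩ := by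
    refine h.congr (fun r hr => hR r ?_) (fun r hr => hA r ?_) ?_
    · revert r; decide
    · revert r; decide
    · exact (congrFun (hA aUs (by decide)) 0).trans h.sentinel
  have hRN := hR rN (by decide)
  have hRK := hR rK (by decide)
  clear hf hA hR
  -- A vertex that is kept has at most `rK` edges, and a discarded one has none left.
  have hrest : G.rest (A' aPtr) ≤ G.verts.card * reg rK := by
    rw [← smul_eq_mul]
    refine Finset.sum_le_card_nsmul _ _ _ fun x hx => ?_
    rcases g2 x hx with ⟨k1, k2, k3⟩ | ⟨k1, k2, k3⟩ <;> rw [k3] <;> omega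
  simp only [clearPath, exec_rules, Nat.reduceEqDiff]
  refine wp_frame (wp_loop (fun σ₁ => SearchInv G (reg rK) none σ₁ ∧ σ₁.arr aVarr = A' aVarr ∧
    σ₁.reg rN = reg' rN ∧ σ₁.reg rJ ≤ reg' rN ∧
    σ₁.reg rBase = σ₁.reg rTop ∧ (∀ i < σ₁.reg rJ, σ₁.arr aIdx (A' aVarr i) ≠ 0) ∧
    σ₁.time + searchCost G σ₁ + 80 ≤
      t' + 8 + 30 * G.rest (A' aPtr) + 15 + 13 * σ₁.reg rJ +
        20 * (σ₁.reg rTop + σ₁.reg rBase)) (Q := fun σ₁ => SearchInv G (reg rK) none σ₁ ∧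
      σ₁.reg rBase = σ₁.reg rTop ∧
      (∀ x ∈ G.verts, σ₁.arr aIdx x ≠ 0) ∧ σ₁.time ≤ t' + 24 + 30 * G.rest (A' aPtr) +
        53 * G.verts.card) (t' + 23 + 30 * G.rest (A' aPtr) + 53 * G.verts.card) ?_ ?_ ?_ ?_) ?_
  · rintro σ₁ ⟨h1, h2, h3, h4, h5, h6, h7⟩
    have := h1.path.top_le
    omega
  · refine ⟨⟨?_, ⟨hS.graph.first, hS.graph.last, hS.graph.tail⟩, ?_, ?_⟩, rfl, rfl, ?_, rfl, ?_,
      ?_⟩ <;> try simp only [exec_rules, Nat.reduceEqDiff]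
    · exact hS.zero
    · have hsmall : ∀ x ∈ G.verts, ¬ 2 ≤ A' aIdx x := by
        intro x hx
        rcases g2 x hx with k | k <;> omega
      refine ⟨le_rfl, le_rfl, by omega, fun x hx h => absurd h (hsmall x hx), g1, by simp,
        by simp, by omega, by omega, one_pos, hS.sentinel, by omega, by omega, by omega, ?_, ?_,
        by omega, by simp, by omega, ?_⟩
      · intro x hx
        have := h.degree x hx
        rcases g2 x hx with ⟨k1, k2, k3⟩ | ⟨k1, k2, k3⟩ <;> rw [k3] <;> omega
      · intro x hx hx0
        rcases g2 x hx with ⟨k1, k2, k3⟩ | ⟨k1, k2, k3⟩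
        · exact k3
        · omega
      -- The vertices finished in advance have degree above the bound, so they lie in larger closed
      -- sets only.
      · intro x h1 h2 U hU hxU
        left
        have := hU.degree_le hG hxU
        rcases g2 x (hU.1 hxU) with ⟨k1, k2, k3⟩ | ⟨k1, k2, k3⟩ <;> omega
    · exact Or.inl ⟨by omega, rfl, rfl⟩
    · omega
    · omega
    · simp only [searchCost, exec_rules, Nat.reduceEqDiff]
      omega
  · rintro σ₁ ⟨h1, h2, h3, h4, h5, h6, h7⟩ hb
    have hb' : σ₁.reg rJ < σ₁.reg rN := hb
    refine wp_frame (wp_searchFrom (G := G) (k := reg rK) hG ?_ h5 ?_) ?_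
    · apply h1.congr <;> intros <;> rfl
    · change σ₁.arr aVarr (σ₁.reg rJ) ∈ _
      rw [h2]
      exact (hS.enum.mem _).mpr ⟨_, by dsimp only; omega, rfl⟩
    · rintro σ₂ hf ⟨k1, k2, k3, k4, k5⟩
      have e1 : σ₂.reg rN = σ₁.reg rN := hf.reg rN (by decide)
      have e2 : σ₂.arr aVarr = σ₁.arr aVarr := hf.arr aVarr (by decide)
      have k3' : ∀ x, σ₁.arr aIdx x ≠ 0 ∨ x = σ₁.arr aVarr (σ₁.reg rJ) → σ₂.arr aIdx x ≠ 0 := k3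
      have k4' : σ₂.reg rJ = σ₁.reg rJ + 1 := k4
      have k5' : σ₂.time + searchCost G σ₂ + 20 * (σ₁.reg rTop + σ₁.reg rBase) ≤
        σ₁.time + 1 + searchCost G σ₁ + 20 * (σ₂.reg rTop + σ₂.reg rBase) + 12 := k5
      refine ⟨k1, e2.trans h2, e1.trans h3, by omega, k2, ?_, by omega⟩
      intro i hi
      apply k3'
      by_cases e : i = σ₁.reg rJ
      · exact Or.inr (by rw [e, h2])
      · exact Or.inl (h6 i (by omega))
  · rintro σ₁ ⟨h1, h2, h3, h4, h5, h6, h7⟩ hb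
    have hb' : ¬ σ₁.reg rJ < σ₁.reg rN := hb
    refine ⟨?_, h5, ?_, ?_⟩
    · apply h1.congr <;> intros <;> rfl
    · intro x hx
      obtain ⟨i, hi, rfl⟩ := (hS.enum.mem x).mp hx
      dsimp only at hi
      exact h6 i (by omega)
    · change σ₁.time + 1 ≤ _
      have := h1.path.top_le
      omega
  · rintro σ₁ hf ⟨k1, k2, k3, k4⟩
    have hlo : ∀ p, σ₁.reg rLo ≤ p → p < σ₁.reg rHi → 2 ≤ p ∧ p < σ₁.reg rTop := by
      intro p h1 h2
      rcases k1.best with h | ⟨h3, h4, h5, -⟩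
      · omega
      · exact ⟨by omega, by omega⟩
    refine ⟨⟨k1.best, ?_, ?_⟩, ⟨k1.zero, k1.graph, ?_, ?_, k1.path.us_zero⟩, by omega⟩
    · intro p q h1 h2 h3 h4 e
      exact k1.path.injOn (hlo p h1 h2).1 (hlo p h1 h2).2 (hlo q h3 h4).1 (hlo q h3 h4).2 e
    -- At the end the path is empty and no vertex is new; so every vertex is finished, hence
    -- excluded.
    · intro U hU ⟨x, hx⟩
      have h2 := k1.path.two_le
      have h3 := k3 x (hU.1 hx)
      refine k1.path.done x (by omega) ?_ U hU hx
      by_cases h4 : 2 ≤ σ₁.arr aIdx x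
      · have := (k1.path.idx_lt x (hU.1 hx) h4).1
        omega
      · omega
    · have e1 := hf.reg rN (by decide)
      have e2 := hf.arr aVarr (by decide)
      simp only [exec_rules, Nat.reduceEqDiff] at e1 e2
      rw [e1, e2]
      exact hS.enum
    · have e2 := hf.arr aDeg (by decide)
      simp only at e2
      rw [e2]
      exact hS.degree

/-- The places `lo, …, hi - 1` hold a smallest nonempty closed set `D`, if there is one. -/
structure FoundClosed (G : Graph) (D : Finset ℕ) (σ : State) : Prop where
  image : D = (Finset.Ico (σ.reg rLo) (σ.reg rHi)).image (σ.arr aSt)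
  inj : ∀ p q, σ.reg rLo ≤ p → p < σ.reg rHi → σ.reg rLo ≤ q → q < σ.reg rHi →
    σ.arr aSt p = σ.arr aSt q → p = q
  closed : G.Closed D
  least : ∀ U, G.Closed U → U.Nonempty → D.Nonempty ∧ D.card ≤ U.card

/-- The ignored closed sets have more than `k` elements: more than the best set in the one case,
more than there are vertices in the other. -/
theorem SearchResult.found {G : Graph} {k : ℕ} {σ : State} (h : SearchResult G k σ)
    (hk : σ.reg rBz ≤ k ∨ G.verts.card ≤ k) : ∃ D, FoundClosed G D σ := by
  have hsub : ∀ U, G.Closed U → U.card ≤ G.verts.card := fun U hU => Finset.card_le_card hU.1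
  refine ⟨_, rfl, h.inj, ?_, ?_⟩
  · rcases h.best with ⟨-, h1, h2⟩ | ⟨-, -, -, -, h1⟩
    · rw [h1, h2]
      exact ⟨by simp, by simp⟩
    · exact h1
  · intro U hU hne
    have h1 := hsub U hU
    rcases h.best with ⟨h2, -, -⟩ | ⟨-, h3, -, h4, h5⟩
    · rcases h.least U hU hne with h3 | h3 <;> omega
    · have hc : ((Finset.Ico (σ.reg rLo) (σ.reg rHi)).image (σ.arr aSt)).card = σ.reg rBz := by
        rw [Finset.card_image_of_injOn, Nat.card_Ico, h4]
        intro p hp q hq e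
        simp only [Finset.coe_Ico, Set.mem_Ico] at hp hq
        exact h.inj p q hp.1 hp.2 hq.1 hq.2 e
      have h6 := hsub _ h5
      refine ⟨?_, ?_⟩
      · exact ⟨_, Finset.mem_image_of_mem _ (Finset.mem_Ico.mpr ⟨le_rfl, h3⟩)⟩
      · rcases h.least U hU hne with h7 | h7 <;> omega

theorem wp_doubleBound (σ : State) : wp doubleBound (fun σ' => σ'.reg rK = 2 * σ.reg rK ∧
    σ'.time ≤ σ.time + 3 + 3 * σ.reg rK) σ := by
  obtain ⟨reg, A, o, t⟩ := σ
  simp only [doubleBound, exec_rules, Nat.reduceEqDiff]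
  refine wp_loop (fun σ' => σ'.reg rC = reg rK ∧ σ'.reg rI ≤ reg rK ∧
    σ'.reg rK = reg rK + σ'.reg rI ∧ σ'.time ≤ t + 2 + 3 * σ'.reg rI) (t + 2 + 3 * reg rK)
    ?_ ?_ ?_ ?_
  · rintro σ' ⟨h1, h2, h3, h4⟩
    omega
  · simp [exec_rules]
  · rintro ⟨reg', A', o', t'⟩ ⟨h1, h2, h3, h4⟩ hb
    dsimp only at *
    simp only [exec_rules] at hb
    simp only [exec_rules, Nat.reduceEqDiff]
    omega
  · rintro σ' ⟨h1, h2, h3, h4⟩ hb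
    have hb' : ¬ σ'.reg rI < σ'.reg rC := hb
    change σ'.reg rK = _ ∧ σ'.time + 1 ≤ _
    omega

/-- A phase costs O((n + 1)K), and doubling makes the sum a constant multiple of the last term. The
last bound is at most twice the size of a smallest closed set, or at most `2 * n + 1`. -/
theorem wp_findClosed {G : Graph} {σ : State} (hG : G.Valid) (h : GraphState G σ) :
    wp findClosed (fun σ' => GraphState G σ' ∧ ∃ D, FoundClosed G D σ' ∧
      (D.Nonempty → σ'.time ≤ σ.time + 1300 * (D.card * G.verts.card)) ∧
      (D = ∅ → σ'.time ≤ σ.time + 1800 * (G.verts.card ^ 2 + 1))) σ := by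
  obtain ⟨reg, A, o, t⟩ := σ
  simp only [findClosed, exec_rules, Nat.reduceEqDiff]
  generalize hn : G.verts.card = n
  have key : ∀ K, 1 ≤ K → 30 * (n * K) + 70 * n + 150 + 3 * K ≤ 153 * (n + 1) * K := by
    intro K hK
    have : n ≤ n * K := Nat.le_mul_of_pos_right n hK
    nlinarith
  -- The geometric sum in additive form: with cost proportional to `K`, the phases before bound `K`
  -- have used `K - 1` units.
  have hstep : ∀ K, 1 ≤ K →
      153 * (n + 1) * (K - 1) + 153 * (n + 1) * K = 153 * (n + 1) * (2 * K - 1) := by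
    intro K hK
    rw [← Nat.mul_add]
    congr 1
    omega
  have hle : ∀ K, 1 ≤ K →
      153 * (n + 1) * (K - 1) + 153 * (n + 1) * K ≤ 306 * ((n + 1) * K) := by
    intro K hK
    have : 153 * (n + 1) * (K - 1) ≤ 153 * (n + 1) * K := Nat.mul_le_mul_left _ (by omega)
    nlinarith
  have hmono : ∀ K, K ≤ 2 * n + 1 → (n + 1) * K ≤ (n + 1) * (2 * n + 1) := fun K hK =>
    Nat.mul_le_mul_left _ hK
  have hmono' : ∀ K, K ≤ 2 * n + 1 →
      153 * (n + 1) * (K - 1) ≤ 306 * ((n + 1) * (2 * n + 1)) := by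
    intro K hK
    have : 153 * (n + 1) * (K - 1) ≤ 153 * (n + 1) * (2 * n + 1) :=
      Nat.mul_le_mul_left _ (by omega)
    nlinarith
  -- `rK` is doubled only if no nonempty closed set has at most `rK` elements, hence the factor `2`
  -- against `U.card`; and only while below `n`, hence `2 * n + 1`, which also covers the start `1`
  -- when `n = 0`.
  refine wp_loop (fun σ' => GraphState G σ' ∧
    ((σ'.reg rGo = 1 ∧ 1 ≤ σ'.reg rK ∧ σ'.reg rK ≤ 2 * n + 1 ∧
      (∀ U, G.Closed U → U.Nonempty → σ'.reg rK ≤ 2 * U.card) ∧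
      σ'.time ≤ t + 2 + 153 * (n + 1) * (σ'.reg rK - 1)) ∨
    (σ'.reg rGo = 0 ∧ ∃ D K, FoundClosed G D σ' ∧ K ≤ 2 * n + 1 ∧
      (∀ U, G.Closed U → U.Nonempty → K ≤ 2 * U.card) ∧
      σ'.time ≤ t + 2 + 306 * ((n + 1) * K))))
    (t + 2 + 306 * ((n + 1) * (2 * n + 1))) ?_ ?_ ?_ ?_
  · rintro σ' ⟨-, ⟨-, -, h1, -, h2⟩ | ⟨-, D, K, -, h1, -, h2⟩⟩
    · have := hmono' _ h1
      omega
    · have := hmono _ h1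
      omega
  · refine ⟨h.congr ?_ ?_ ?_, Or.inl ⟨?_, ?_, ?_, ?_, ?_⟩⟩
    · simp [exec_rules]
    · simp
    · exact h.sentinel
    all_goals simp only [exec_rules, Nat.reduceEqDiff]
    · omega
    · omega
    · intro U _ hU
      have := hU.card_pos
      omega
    · omega
  · rintro σ₀ ⟨h0, hcase⟩ hb
    have hb' : σ₀.reg rZ < σ₀.reg rGo := hb
    obtain ⟨-, k1, k2, k3, k4⟩ := hcase.resolve_right (fun hc => by have := hc.1; omega)
    rw [wp_seq]
    refine wp_frame (wp_searchPhase (σ := σ₀.tick) hG (h0.congr ?_ ?_ ?_)) ?_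
    · intros; rfl
    · intros; rfl
    · exact h0.sentinel
    · rintro ⟨reg', A', o', t'⟩ hf ⟨g1, g2, g3⟩
      have e1 := hf.reg rK (by decide)
      have e2 := hf.reg rGo (by decide)
      have e3 := (hf.reg rN (by decide)).trans (show _ = σ₀.reg rN from rfl)
      have hN := h0.enum.card
      dsimp only at e1 e2 e3 g3
      have e4 : σ₀.tick.reg = σ₀.reg := rfl
      have e5 : σ₀.tick.time = σ₀.time + 1 := rfl
      rw [e4] at e1 e2 g3 g1
      rw [e5] at g3
      rw [hn] at hN g3
      have hkey := key _ k1
      have hst := hstep _ k1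
      have hl := hle _ k1
      simp only [exec_rules]
      refine ⟨fun c1 => ⟨fun c2 => ?_, fun c2 => ?_⟩, fun c1 => ?_⟩
      · refine wp_frame (wp_doubleBound _) ?_
        rintro σ₁ hf' ⟨l1, l2⟩
        have e6 := hf'.reg rGo (by decide)
        dsimp only at l1 l2 e6
        refine ⟨g2.congr ?_ ?_ ?_, Or.inl ⟨?_, ?_, ?_, ?_, ?_⟩⟩
        · intro r hr
          exact hf'.reg r (by revert r; decide)
        · intro r hr
          exact hf'.arr r (by revert r; decide)
        · rw [hf'.arr aUs (by decide)]
          exact g2.sentinel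
        · have hgo : σ₀.reg rGo = 1 := by
            rcases hcase with hc | hc
            · exact hc.1
            · have := hc.1; omega
          omega
        · omega
        · omega
        · intro U hU hne
          rcases g1.least U hU hne with h' | h'
          · omega
          · dsimp only at h'
            omega
        · rw [l1, e1]
          omega
      · obtain ⟨D, hD⟩ := g1.found (Or.inr (by omega))
        refine ⟨g2.congr ?_ ?_ g2.sentinel, Or.inr ⟨trivial, D, σ₀.reg rK,
          ⟨?_, ?_, hD.closed, hD.least⟩, k2, k3, by omega⟩⟩
        · simp [exec_rules]
        · simp
        · simp only [exec_rules, Nat.reduceEqDiff]; exact hD.image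
        · simp only [exec_rules, Nat.reduceEqDiff]; exact hD.inj
      · obtain ⟨D, hD⟩ := g1.found (Or.inl (by dsimp only; omega))
        refine ⟨g2.congr ?_ ?_ g2.sentinel, Or.inr ⟨trivial, D, σ₀.reg rK,
          ⟨?_, ?_, hD.closed, hD.least⟩, k2, k3, by omega⟩⟩
        · simp [exec_rules]
        · simp
        · simp only [exec_rules, Nat.reduceEqDiff]; exact hD.image
        · simp only [exec_rules, Nat.reduceEqDiff]; exact hD.inj
  · rintro σ' ⟨h0, hcase⟩ hb
    have hb' : ¬ σ'.reg rZ < σ'.reg rGo := hb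
    have hz := h0.zero
    obtain ⟨-, D, K, k1, k2, k3, k4⟩ := hcase.resolve_left (fun hc => by have := hc.1; omega)
    refine ⟨h0.congr (fun _ _ => rfl) (fun _ _ => rfl) h0.sentinel, D,
      ⟨k1.image, k1.inj, k1.closed, k1.least⟩, ?_, ?_⟩
    · intro hne
      change σ'.time + 1 ≤ t + 1300 * (D.card * n)
      have h1 := k3 D k1.closed hne
      have h2 := hne.card_pos
      have h3 := Finset.card_le_card k1.closed.1
      rw [hn] at h3
      -- `n + 1 ≤ 2 * n` because a nonempty `D` makes `n` positive.
      have h4 : (n + 1) * K ≤ (2 * n) * (2 * D.card) := Nat.mul_le_mul (by omega) h1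
      have h5 : 1 ≤ D.card * n := Nat.mul_pos h2 (by omega)
      have h6 : (2 * n) * (2 * D.card) = 4 * (D.card * n) := by ring
      omega
    · intro _
      change σ'.time + 1 ≤ t + 1800 * (n ^ 2 + 1)
      have h1 := hmono K k2
      have h2 : (n + 1) * (2 * n + 1) ≤ 5 * (n ^ 2 + 1) := by nlinarith
      omega

/-! ## One pass -/

section

variable {P : Program} {A A' : ℕ → ℕ → ℕ} {h q m N E : ℕ} {V : Finset ℕ}
  {Z : Finset (ℕ × ℕ)} {T F : Finset ℕ} {l : List ℕ}

/-- The new events are only queued; derived atoms remain sound because `trueLM` grows with the false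
set. -/
theorem PropInv.setFalse (hI : PropInv P A h q m N E V Z T F l) {q' : ℕ} {F' : Finset ℕ}
    (hq : QueueInv A' q' V T F') (hqq : q ≤ q') (hF : F ⊆ F')
    (hA : ∀ k, k ∉ [2, aQa, aQs, aVarr, aIdx, aPtr, aSt, aUs, aBs] → A' k = A k)
    (hold : ∀ i < q, A' aQa i = A aQa i ∧ A' aQs i = A aQs i) :
    PropInv P A' h q' m N E V Z T F' l := by
  refine ⟨hI.tab.congr ?_, hq, hI.le.trans hqq, ?_, ?_, ?_, ?_, ?_⟩
  · intro k hk
    apply hA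
    revert k
    decide
  · intro o s
    rw [hI.told, hA aAtm (by decide)]
    have hle := hI.le
    constructor
    · rintro ⟨g1, g2, i, hi, g3, g4, g5⟩
      have := hold i (by omega)
      exact ⟨g1, g2, i, hi, this.1.trans g3, this.2.trans g4, g5⟩
    · rintro ⟨g1, g2, i, hi, g3, g4, g5⟩
      have := hold i (by omega)
      exact ⟨g1, g2, i, hi, this.1.symm.trans g3, this.2.symm.trans g4, g5⟩
  · rw [hA aCnt (by decide), hA aRule (by decide), hA aSgn (by decide)]
    exact hI.cnt
  · rw [hA aDead (by decide), hA aRule (by decide), hA aSgn (by decide)]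
    exact hI.dead
  · rw [aliveRules, hA aDead (by decide)]
    refine hI.lists.congr ?_
    intro k hk
    apply hA
    revert k
    decide
  · intro a ha
    exact trueLM_mono P (Finset.coe_subset.mpr hF) (hI.sound a ha)

end

/-- The atoms with codes in `D`. -/
def decode (D : Finset ℕ) : Finset ℕ := D.image Nat.pred

theorem wp_makeFalse {σ : State} {V T F D : Finset ℕ} (h0 : σ.reg rZ = 0)
    (hq : QueueInv σ.arr (σ.reg rQt) V T F)
    (hD : D = (Finset.Ico (σ.reg rLo) (σ.reg rHi)).image (σ.arr aSt))
    (hinj : ∀ p q, σ.reg rLo ≤ p → p < σ.reg rHi → σ.reg rLo ≤ q → q < σ.reg rHi →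
      σ.arr aSt p = σ.arr aSt q → p = q)
    (hDV : D ⊆ V) (hDF : ∀ x ∈ D, ∃ a, x = a + 1 ∧ a ∉ F) :
    wp makeFalse (fun σ' => QueueInv σ'.arr (σ'.reg rQt) V T (F ∪ decode D) ∧
      σ.reg rQt ≤ σ'.reg rQt ∧
      (∀ i < σ.reg rQt, σ'.arr aQa i = σ.arr aQa i ∧ σ'.arr aQs i = σ.arr aQs i) ∧
      Emitted 1 σ.out σ'.out F (F ∪ decode D) ∧ σ'.time ≤ σ.time + 2 + 10 * D.card) σ := by
  obtain ⟨reg, A, o, t⟩ := σ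
  dsimp only at *
  have hcard : D.card = reg rHi - reg rLo := by
    rw [hD, Finset.card_image_of_injOn, Nat.card_Ico]
    intro p hp q hq e
    simp only [Finset.coe_Ico, Set.mem_Ico] at hp hq
    exact hinj p q hp.1 hp.2 hq.1 hq.2 e
  simp only [makeFalse, exec_rules, Nat.reduceEqDiff]
  refine wp_loop (fun σ' => σ'.reg rZ = 0 ∧ σ'.reg rHi = reg rHi ∧ σ'.arr aSt = A aSt ∧
    reg rLo ≤ σ'.reg rI ∧ (reg rLo ≤ reg rHi → σ'.reg rI ≤ reg rHi) ∧
    (reg rHi < reg rLo → σ'.reg rI = reg rLo) ∧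
    QueueInv σ'.arr (σ'.reg rQt) V T
      (F ∪ decode ((Finset.Ico (reg rLo) (σ'.reg rI)).image (A aSt))) ∧
    reg rQt ≤ σ'.reg rQt ∧
    (∀ i < reg rQt, σ'.arr aQa i = A aQa i ∧ σ'.arr aQs i = A aQs i) ∧
    Emitted 1 o σ'.out F (F ∪ decode ((Finset.Ico (reg rLo) (σ'.reg rI)).image (A aSt))) ∧
    σ'.time ≤ t + 1 + 10 * (σ'.reg rI - reg rLo)) (t + 1 + 10 * (reg rHi - reg rLo)) ?_ ?_ ?_ ?_
  · rintro σ' ⟨h1, h2, h3, h4, h5, h6, h7, h8, h9, h10, h11⟩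
    omega
  · simp only [exec_rules, Nat.reduceEqDiff, Finset.Ico_self, Finset.image_empty, decode,
      Finset.union_empty]
    exact ⟨h0, trivial, trivial, le_rfl, fun h => h, fun _ => trivial, hq, le_rfl, by simp,
      Emitted.refl _ _ _, by omega⟩
  · rintro ⟨reg', A', o', t'⟩ ⟨h1, h2, h3, h4, h5, h6, h7, h8, h9, h10, h11⟩ hb
    dsimp only at *
    simp only [exec_rules] at hb
    have hxD : A aSt (reg' rI) ∈ D := by
      rw [hD]
      exact Finset.mem_image_of_mem _ (Finset.mem_Ico.mpr ⟨h4, by omega⟩)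
    obtain ⟨a, ha, haF⟩ := hDF _ hxD
    have haV := hDV hxD
    rw [ha] at haV
    have hnew : a ∉ F ∪ decode ((Finset.Ico (reg rLo) (reg' rI)).image (A aSt)) := by
      rw [Finset.mem_union, not_or]
      refine ⟨haF, ?_⟩
      simp only [decode, Finset.mem_image, Finset.mem_Ico, not_exists, not_and]
      rintro y ⟨p, hp, rfl⟩ e
      obtain ⟨b, hb', -⟩ := hDF (A aSt p) (by
        rw [hD]
        exact Finset.mem_image_of_mem _ (Finset.mem_Ico.mpr ⟨hp.1, by omega⟩))
      rw [hb', Nat.pred_succ] at e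
      have := hinj p (reg' rI) hp.1 (by omega) h4 (by omega) (by rw [hb', ha, e])
      omega
    have hset : F ∪ decode ((Finset.Ico (reg rLo) (reg' rI + 1)).image (A aSt)) =
        insert a (F ∪ decode ((Finset.Ico (reg rLo) (reg' rI)).image (A aSt))) := by
      rw [← Finset.insert_Ico_right_eq_Ico_add_one h4, Finset.image_insert, decode, decode,
        Finset.image_insert, ha, Nat.pred_succ, Finset.union_insert]
    simp only [exec_rules, Nat.reduceEqDiff, h3, ha, h1, Nat.add_sub_cancel, hset]
    refine ⟨trivial, h2, trivial, by omega, by omega, by omega,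
      h7.insertF hnew haV rfl rfl rfl rfl, by omega, ?_, h10.insert hnew, by omega⟩
    intro i hi
    rw [Function.update_of_ne (by omega), Function.update_of_ne (by omega)]
    exact h9 i hi
  · rintro σ' ⟨h1, h2, h3, h4, h5, h6, h7, h8, h9, h10, h11⟩ hb
    have hb' : ¬ σ'.reg rI < σ'.reg rHi := hb
    have hset : (Finset.Ico (reg rLo) (σ'.reg rI)).image (A aSt) = D := by
      rw [hD]
      by_cases hc : reg rLo ≤ reg rHi
      · rw [show σ'.reg rI = reg rHi by have := h5 hc; omega]
      · rw [h6 (by omega), Finset.Ico_self, Finset.Ico_eq_empty_of_le (by omega)]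
    rw [hset] at h7 h10
    refine ⟨h7, h8, h9, h10, ?_⟩
    change σ'.time + 1 ≤ _
    omega

/-- The list is compacted in place, which is safe because the writing place never overtakes the
reading place. -/
theorem wp_compactAtoms {σ : State} {W F : Finset ℕ} (h0 : σ.reg rZ = 0)
    (hW : Enumerates (σ.arr aVarr) (σ.reg rN) W) (hF : σ.arr 2 = Set.indicator ↑F 1) :
    wp compactAtoms (fun σ' =>
      Enumerates (σ'.arr aVarr) (σ'.reg rN) (W.filter fun x => x - 1 ∉ F) ∧
      σ'.time ≤ σ.time + 4 + 8 * W.card) σ := by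
  obtain ⟨reg, A, o, t⟩ := σ
  dsimp only at *
  have hcard := hW.card
  simp only [compactAtoms, exec_rules, Nat.reduceEqDiff]
  refine wp_frame (wp_loop (fun σ' => σ'.reg rZ = 0 ∧ σ'.reg rN = reg rN ∧ σ'.arr 2 = A 2 ∧
    σ'.reg rI ≤ reg rN ∧ σ'.reg rC ≤ σ'.reg rI ∧
    (∀ i, σ'.reg rI ≤ i → σ'.arr aVarr i = A aVarr i) ∧
    Enumerates (σ'.arr aVarr) (σ'.reg rC)
      (((Finset.range (σ'.reg rI)).image (A aVarr)).filter fun x => x - 1 ∉ F) ∧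
    σ'.time ≤ t + 2 + 8 * σ'.reg rI)
    (Q := fun σ' => σ'.reg rN = reg rN ∧
      Enumerates (σ'.arr aVarr) (σ'.reg rC) (W.filter fun x => x - 1 ∉ F) ∧
      σ'.time ≤ t + 3 + 8 * reg rN) (t + 2 + 8 * reg rN) ?_ ?_ ?_ ?_) ?_
  · rintro σ' ⟨h1, h2, h3, h4, h5, h6, h7, h8⟩
    omega
  · simp only [exec_rules, Nat.reduceEqDiff]
    refine ⟨h0, trivial, trivial, by omega, le_rfl, fun _ _ => trivial, ⟨by omega, by simp⟩, by omega⟩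
  · rintro ⟨reg', A', o', t'⟩ ⟨h1, h2, h3, h4, h5, h6, h7, h8⟩ hb
    dsimp only at *
    simp only [exec_rules] at hb
    have hx := h6 (reg' rI) le_rfl
    simp only [exec_rules, Nat.reduceEqDiff, hx, h3, hF, h1]
    have hmem : A aVarr (reg' rI) ∉ ((Finset.range (reg' rI)).image (A aVarr)).filter
        fun x => x - 1 ∉ F := by
      simp only [Finset.mem_filter, Finset.mem_image, Finset.mem_range, not_and]
      rintro ⟨j, hj, e⟩
      have := hW.inj j (by omega) (reg' rI) (by omega) e
      omega
    rw [Finset.range_add_one, Finset.image_insert, Finset.filter_insert]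
    refine ⟨fun hc => ?_, fun hc => ?_⟩
    · have hc' := indicator_eq_zero.mp hc
      rw [if_pos hc']
      refine ⟨trivial, h2, trivial, by omega, by omega, ?_, h7.insert hmem, by omega⟩
      intro i hi
      rw [Function.update_of_ne (by omega)]
      exact h6 i (by omega)
    · have hc' : ¬ A aVarr (reg' rI) - 1 ∉ F := fun h => hc (indicator_eq_zero.mpr h)
      rw [if_neg hc']
      exact ⟨trivial, h2, trivial, by omega, by omega, fun i hi => h6 i (by omega), h7, by omega⟩
  · rintro σ' ⟨h1, h2, h3, h4, h5, h6, h7, h8⟩ hb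
    have hb' : ¬ σ'.reg rI < σ'.reg rN := hb
    have hset : (Finset.range (σ'.reg rI)).image (A aVarr) = W := by
      ext x
      rw [hW.mem, show σ'.reg rI = reg rN by omega]
      simp
    rw [hset] at h7
    refine ⟨h2, h7, ?_⟩
    change σ'.time + 1 ≤ _
    omega
  · rintro ⟨reg', A', o', t'⟩ hf ⟨g1, g2, g3⟩
    dsimp only at *
    simp only [exec_rules, Nat.reduceEqDiff]
    exact ⟨g2, by omega⟩

/-! ## The graph of the remaining program -/

/-- `D` is a smallest nonempty closed set, or the empty set if there is none. -/
def LeastClosed (V : Set ℕ) (Q : Set (HornRule ℕ)) (D : Set ℕ) : Prop :=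
  ClosedSet V Q D ∧ ∀ U, ClosedSet V Q U → U.Nonempty → D.Nonempty ∧ D.ncard ≤ U.ncard

theorem LeastClosed.falseOp {P : Program} {F T D : Set ℕ}
    (h : LeastClosed (atoms P \ F) (restrict P F T) D) : falseOp P F (restrict P F T) D :=
  falseReturns_of_minimal (atoms_finite P).sdiff (restrict_finite P F T)
    (hornAtoms_restrict P F T) (Or.inr h.1) h.2

/-- A body may repeat its positive atom; this identifies the first occurrence, used by `false`, with
the last one, recorded by the machine. -/
theorem head?_of_card_le_one {l : List ℕ} (hl : l.toFinset.card ≤ 1) {a : ℕ} (ha : a ∈ l) :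
    l.head? = some a := by
  obtain _ | ⟨b, l⟩ := l
  · simp at ha
  · rw [Finset.card_le_one] at hl
    have := hl a (by simpa using ha) b (by simp)
    simp [this]

/-- The complement of a closed set is a model. -/
theorem ClosedSet.disjoint_LM {V U : Set ℕ} {Q : Set (HornRule ℕ)} (h : ClosedSet V Q U) :
    ∀ a ∈ U, a ∉ LM Q := by
  intro a ha hLM
  refine LM_subset (M := Uᶜ) ?_ hLM ha
  intro r hr hb hh
  obtain ⟨b, hbU, hb'⟩ := h.2 r hr hh
  exact hb b (List.mem_of_mem_head? hb') hbU

/-- The atoms outside the least model form a closed set: a rule with such a head has a body atom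
outside the least model, and this is its only body atom. So an empty result means that the least
model is everything. -/
theorem leastClosed_admissible {P : Program} (hP : InLP1 P) :
    AdmissibleRel P fun F Q D => LeastClosed (atoms P \ F) Q D := by
  intro F D _ hD
  refine ⟨fun a ha => ⟨hD.1.1 ha, hD.1.disjoint_LM a ha⟩, fun he => ?_⟩
  by_contra hne
  have hcl : ClosedSet (atoms P \ F) (restrict P F (trueLM P F))
      ((atoms P \ F) \ LM (restrict P F (trueLM P F))) := by
    refine ⟨Set.sdiff_subset, ?_⟩
    rintro r hr ⟨h1, h2⟩
    have h3 : ¬ ∀ b ∈ r.body, b ∈ LM (restrict P F (trueLM P F)) := fun h => h2 (LM_model hr h)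
    push Not at h3
    obtain ⟨b, hb, hb'⟩ := h3
    refine ⟨b, ⟨hornAtoms_restrict P F _ ⟨r, hr, Or.inr hb⟩, hb'⟩, ?_⟩
    obtain ⟨ρ, hρ, -, -, -, rfl⟩ := hr
    exact head?_of_card_le_one (hP ρ hρ) hb
  have := (hD.2 _ hcl (Set.nonempty_iff_ne_empty.mpr hne)).1
  rw [he] at this
  exact Set.not_nonempty_empty this

theorem Template.mono {P : Program} {Δ Δ' : Set ℕ → Set (HornRule ℕ) → Set ℕ → Prop}
    (hΔ : ∀ F D, Δ F (restrict P F (trueLM P F)) D → Δ' F (restrict P F (trueLM P F)) D)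
    {T F T' F' : Set ℕ} {passes : List Pass} (h : Template P Δ T F passes T' F') :
    Template P Δ' T F passes T' F' := by
  induction h with
  | last h1 h2 => exact Template.last (hΔ _ _ h1) h2
  | more h1 h2 _ ih => exact Template.more (hΔ _ _ h1) h2 ih

/-- The codes of the atoms that are not false. -/
def openCodes (V F : Finset ℕ) : Finset ℕ := V.filter fun x => x - 1 ∉ F

/-- The graph of the remaining program. -/
def remGraph (A : ℕ → ℕ → ℕ) (V F : Finset ℕ) : Graph where
  verts := openCodes V F
  first := A aStart
  last := A aEnd
  tail := fun p => A aEtl (A aEnt p)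

section

variable {P : Program} {A : ℕ → ℕ → ℕ} {q m N E : ℕ} {V : Finset ℕ}
  {Z : Finset (ℕ × ℕ)} {T F : Finset ℕ}

theorem PropInv.told_iff (h : PropInv P A q q m N E V Z T F []) {o s : ℕ} :
    (o, s) ∈ Z ↔ 1 ≤ o ∧ o ≤ N ∧
      ((s = 1 ∧ ∃ a ∈ T, A aAtm o = a + 1) ∨ (s = 0 ∧ ∃ a ∈ F, A aAtm o = a + 1)) := by
  rw [h.told, ← h.queue.mem]
  simp

theorem PropInv.mem_openCodes (h : PropInv P A q q m N E V Z T F []) {x : ℕ} :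
    x ∈ openCodes V F ↔ ∃ a ∈ atoms P \ ↑F, x = a + 1 := by
  rw [openCodes, Finset.mem_filter, h.tab.codes]
  constructor
  · rintro ⟨⟨a, ha, rfl⟩, h2⟩
    exact ⟨a, ⟨ha, h2⟩, rfl⟩
  · rintro ⟨a, ⟨ha, h2⟩, rfl⟩
    exact ⟨⟨a, ha, rfl⟩, h2⟩

/-- The queue is exhausted, so every true literal has been reported. A rule with true body then has
counter zero, and `HeadsTrue` gives its head: `T` together with `not(F)` is a model. -/
theorem PropInv.trueLM_eq (h : PropInv P A q q m N E V Z T F []) (hH : HeadsTrue A m T) :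
    trueLM P ↑F = ↑T := by
  apply Set.Subset.antisymm _ h.sound
  intro a ha
  have key : LM ({h | ∃ r ∈ P, h = r.literals} ∪ {h | ∃ a ∈ (↑F : Set ℕ), h = ⟨Sum.inr a, []⟩}) ⊆
      {x | (∀ a, x = Sum.inl a → a ∈ T) ∧ ∀ a, x = Sum.inr a → a ∈ F} := by
    apply LM_subset
    rintro _ (⟨ρ, hρ, rfl⟩ | ⟨a, ha, rfl⟩) hb
    · refine ⟨?_, by simp [Rule.literals]⟩
      rintro _ hb'
      obtain ⟨r, h1, h2, hrep⟩ := h.tab.exists_num ρ hρ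
      have hc : A aCnt r = 0 := by
        rw [h.cnt r h1 h2, Finset.card_eq_zero, Finset.filter_eq_empty_iff]
        intro o ho
        rw [Finset.mem_Icc] at ho
        rw [not_and, not_not]
        intro hor
        obtain ⟨-, -, k3, k4⟩ := h.tab.lit o ho.1 ho.2
        obtain ⟨c, -, hc⟩ := (h.tab.codes _).mp k4
        rw [h.told_iff]
        refine ⟨ho.1, ho.2, ?_⟩
        rcases Nat.eq_zero_or_pos (A aSgn o) with k5 | k5
        · have hn : c ∈ ρ.neg := (hrep.neg c).mpr ⟨o, ho.1, ho.2, hor, k5, hc⟩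
          exact Or.inr ⟨k5, c, (hb (Sum.inr c) (by simp [Rule.literals, hn])).2 c rfl, hc⟩
        · have k6 : A aSgn o = 1 := by omega
          have hn : c ∈ ρ.pos := (hrep.pos c).mpr ⟨o, ho.1, ho.2, hor, k6, hc⟩
          exact Or.inl ⟨k6, c, (hb (Sum.inl c) (by simp [Rule.literals, hn])).1 c rfl, hc⟩
      obtain ⟨b, hbT, hb2⟩ := hH r h1 h2 hc
      have hh := hrep.head
      simp only [Rule.literals, Sum.inl.injEq] at hb'
      obtain rfl : b = ρ.head := by omega
      rwa [← hb']
    · refine ⟨by simp, ?_⟩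
      rintro b hb'
      simp only [Sum.inr.injEq] at hb'
      rw [← hb']
      exact ha
  exact (key ha).1 a rfl

/-- Rules with a false head are not deleted. They do no harm, because their heads are no longer
vertices of `remGraph`. -/
theorem PropInv.alive_iff (h : PropInv P A q q m N E V Z T F []) {r : ℕ} {ρ : Rule} (h1 : 1 ≤ r)
    (hm : r ≤ m) (hrep : Represents A N ρ r) :
    r ∈ aliveRules A m ↔ (∀ b ∈ ρ.pos, b ∉ F) ∧ ∀ c ∈ ρ.neg, c ∉ T := by
  rw [mem_aliveRules, h.dead r h1 hm]
  constructor
  · rintro ⟨-, -, h2⟩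
    refine ⟨fun b hb hF => ?_, fun c hc hT => ?_⟩
    · obtain ⟨o, g1, g2, g3, g4, g5⟩ := (hrep.pos b).mp hb
      have := h2 o 0 (h.told_iff.mpr ⟨g1, g2, Or.inr ⟨rfl, b, hF, g5⟩⟩) g3
      omega
    · obtain ⟨o, g1, g2, g3, g4, g5⟩ := (hrep.neg c).mp hc
      have := h2 o 1 (h.told_iff.mpr ⟨g1, g2, Or.inl ⟨rfl, c, hT, g5⟩⟩) g3
      omega
  · rintro ⟨h2, h3⟩
    refine ⟨h1, hm, fun o s hz hor => ?_⟩
    obtain ⟨g1, g2, g3⟩ := h.told_iff.mp hz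
    have g4 := (h.tab.lit o g1 g2).2.2.1
    rcases g3 with ⟨rfl, a, ha, g5⟩ | ⟨rfl, a, ha, g5⟩
    · by_contra hne
      exact h3 a ((hrep.neg a).mpr ⟨o, g1, g2, hor, by omega, g5⟩) ha
    · by_contra hne
      exact h2 a ((hrep.pos a).mpr ⟨o, g1, g2, hor, by omega, g5⟩) ha

theorem PropInv.edge_iff (h : PropInv P A q q m N E V Z T F []) {x y : ℕ} (hx : x ∈ V) :
    (∃ p, A aStart x ≤ p ∧ p < A aEnd x ∧ A aEtl (A aEnt p) = y) ↔
      ∃ r ∈ aliveRules A m, A aHd r = x ∧ A aTl r = y := by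
  constructor
  · rintro ⟨p, h1, h2, rfl⟩
    obtain ⟨h3, h4, h5, h6⟩ := h.lists.ent x hx p h1 h2
    rw [h.lists.gcnt _ h3, Finset.card_pos] at h6
    obtain ⟨r, hr⟩ := h6
    obtain ⟨hr1, hr2⟩ := Finset.mem_filter.mp hr
    obtain ⟨-, h7, h8⟩ := h.lists.eof r hr1
    rw [hr2] at h7 h8
    exact ⟨r, hr1, h7.symm.trans h4, h8.symm⟩
  · rintro ⟨r, hr, rfl, rfl⟩
    obtain ⟨h1, h2, h3⟩ := h.lists.eof r hr
    have h4 : 0 < A aGcnt (A aEof r) := by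
      rw [h.lists.gcnt _ h1, Finset.card_pos]
      exact ⟨r, Finset.mem_filter.mpr ⟨hr, rfl⟩⟩
    obtain ⟨-, h5, h6, h7⟩ := h.lists.loc _ h1 h4
    rw [h2] at h5 h6
    exact ⟨_, h5, h6, by rw [h7, h3]⟩

theorem PropInv.graph_valid (h : PropInv P A q q m N E V Z T F []) :
    (remGraph A V F).Valid where
  zero := by
    intro h0
    obtain ⟨a, -, ha⟩ := h.mem_openCodes.mp h0
    omega
  edge := by
    intro x hx p h1 h2
    obtain ⟨r, hr, -, h3⟩ := (h.edge_iff (Finset.mem_filter.mp hx).1).mp ⟨p, h1, h2, rfl⟩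
    obtain ⟨g1, g2, -⟩ := mem_aliveRules.mp hr
    obtain ⟨ρ, hρ, hrep⟩ := h.tab.exists_rule r g1 g2
    change A aEtl (A aEnt p) ∈ openCodes V F ∨ A aEtl (A aEnt p) = 0
    rw [← h3]
    rcases hrep.tail with ⟨h4, -⟩ | ⟨a, ha, h4⟩
    · exact Or.inr h4
    · rw [h.mem_openCodes]
      exact Or.inl ⟨a, ⟨⟨ρ, hρ, Or.inr (Or.inl ha)⟩, ((h.alive_iff g1 g2 hrep).mp hr).1 a ha⟩, h4⟩
  inj := by
    intro x hx p p' h1 h2 h3 h4 e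
    have hxV := (Finset.mem_filter.mp hx).1
    obtain ⟨g1, g2, g3, g4⟩ := h.lists.ent x hxV p h1 h2
    obtain ⟨k1, k2, k3, k4⟩ := h.lists.ent x hxV p' h3 h4
    have := h.lists.uniq _ g1 _ k1 (g2.trans k2.symm) e
    rw [← g3, this, k3]

theorem decode_mem {D : Finset ℕ} (hD : 0 ∉ D) {a : ℕ} : a ∈ decode D ↔ a + 1 ∈ D := by
  rw [decode, Finset.mem_image]
  constructor
  · rintro ⟨x, hx, rfl⟩
    obtain _ | x := x
    · exact absurd hx hD
    · exact hx
  · exact fun h => ⟨_, h, rfl⟩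

theorem decode_card {D : Finset ℕ} (hD : 0 ∉ D) : (decode D).card = D.card := by
  apply Finset.card_image_of_injOn
  intro x hx y hy e
  have hx0 : x ≠ 0 := fun e => hD (e ▸ hx)
  have hy0 : y ≠ 0 := fun e => hD (e ▸ hy)
  simp only [Nat.pred_eq_sub_one] at e
  omega

/-- A rule of the restricted program is alive, so it provides an edge to the code of its tail. An
empty body would provide an edge to `0`, which is not in `D`. -/
theorem PropInv.closed_decode (h : PropInv P A q q m N E V Z T F []) (hP : InLP1 P)
    {D : Finset ℕ} (hD : (remGraph A V F).Closed D) :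
    ClosedSet (atoms P \ ↑F) (restrict P ↑F ↑T) ↑(decode D) := by
  have h0 : 0 ∉ D := fun h0 => h.graph_valid.zero (hD.1 h0)
  refine ⟨?_, ?_⟩
  · intro a ha
    obtain ⟨b, hb, e⟩ := h.mem_openCodes.mp (hD.1 ((decode_mem h0).mp ha))
    obtain rfl : a = b := by omega
    exact hb
  · rintro _ ⟨ρ, hρ, h1, h2, h3, rfl⟩ hh
    obtain ⟨r, g1, g2, hrep⟩ := h.tab.exists_num ρ hρ
    have hr := (h.alive_iff g1 g2 hrep).mpr ⟨h2, h3⟩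
    have hx : ρ.head + 1 ∈ D := (decode_mem h0).mp hh
    obtain ⟨p, k1, k2, k3⟩ := (h.edge_iff (Finset.mem_filter.mp (hD.1 hx)).1).mpr
      ⟨r, hr, hrep.head, rfl⟩
    have hD' : A aEtl (A aEnt p) ∈ D := hD.2 _ hx p k1 k2
    rw [k3] at hD'
    rcases hrep.tail with ⟨h4, -⟩ | ⟨a, ha, h4⟩
    · rw [h4] at hD'
      exact absurd hD' h0
    · rw [h4] at hD'
      exact ⟨a, (decode_mem h0).mpr hD', head?_of_card_le_one (hP ρ hρ) ha⟩

theorem PropInv.closed_encode (h : PropInv P A q q m N E V Z T F []) (hP : InLP1 P)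
    {U : Set ℕ} (hU : ClosedSet (atoms P \ ↑F) (restrict P ↑F ↑T) U) :
    ∃ D, (remGraph A V F).Closed D ∧ U = ↑(decode D) := by
  classical
  have hmem : ∀ a, a + 1 ∈ (openCodes V F).filter (fun x => x - 1 ∈ U) ↔ a ∈ U := by
    intro a
    rw [Finset.mem_filter, h.mem_openCodes]
    constructor
    · exact fun h => h.2
    · exact fun h => ⟨⟨a, hU.1 h, rfl⟩, h⟩
  have h0 : 0 ∉ (openCodes V F).filter (fun x => x - 1 ∈ U) := fun h0 =>
    h.graph_valid.zero (Finset.mem_filter.mp h0).1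
  refine ⟨(openCodes V F).filter fun x => x - 1 ∈ U, ⟨Finset.filter_subset _ _, ?_⟩, ?_⟩
  · intro x hx p h1 h2
    obtain ⟨hxo, hxU⟩ := Finset.mem_filter.mp hx
    obtain ⟨r, hr, h3, h4⟩ := (h.edge_iff (Finset.mem_filter.mp hxo).1).mp ⟨p, h1, h2, rfl⟩
    obtain ⟨g1, g2, -⟩ := mem_aliveRules.mp hr
    obtain ⟨ρ, hρ, hrep⟩ := h.tab.exists_rule r g1 g2
    obtain ⟨h5, h6⟩ := (h.alive_iff g1 g2 hrep).mp hr
    have hhead : x - 1 = ρ.head := by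
      rw [← h3, hrep.head, Nat.add_sub_cancel]
    rw [hhead] at hxU
    obtain ⟨b, hb, hb'⟩ := hU.2 ρ.horn ⟨ρ, hρ, (hU.1 hxU).2, h5, h6, rfl⟩ hxU
    change A aEtl (A aEnt p) ∈ _
    rw [← h4]
    rcases hrep.tail with ⟨-, h7⟩ | ⟨a, ha, h7⟩
    · simp [Rule.horn, h7] at hb'
    · have := head?_of_card_le_one (hP ρ hρ) ha
      rw [h7, hmem]
      have hab : some a = some b := this.symm.trans hb'
      rw [Option.some.inj hab]
      exact hb
  · ext a
    rw [Finset.mem_coe, decode_mem h0, hmem]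

theorem PropInv.leastClosed (h : PropInv P A q q m N E V Z T F []) (hP : InLP1 P)
    {D : Finset ℕ} {σ : State} (hD : FoundClosed (remGraph A V F) D σ) :
    LeastClosed (atoms P \ ↑F) (restrict P ↑F ↑T) ↑(decode D) := by
  have h0 : ∀ D, (remGraph A V F).Closed D → 0 ∉ D := fun D hD h0 => h.graph_valid.zero (hD.1 h0)
  refine ⟨h.closed_decode hP hD.closed, ?_⟩
  intro U hU hne
  obtain ⟨D', hD', rfl⟩ := h.closed_encode hP hU
  have hne' : D'.Nonempty := by
    obtain ⟨a, ha⟩ := hne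
    exact ⟨_, (decode_mem (h0 _ hD')).mp ha⟩
  obtain ⟨h1, h2⟩ := hD.least D' hD' hne'
  rw [Set.ncard_coe_finset, Set.ncard_coe_finset, decode_card (h0 _ hD'),
    decode_card (h0 _ hD.closed)]
  refine ⟨?_, h2⟩
  rw [Finset.coe_nonempty]
  exact h1.image _

end

/-- The invariant of the main loop. -/
structure MainInv (P : Program) (m N E : ℕ) (V : Finset ℕ) (Z : Finset (ℕ × ℕ)) (T F : Finset ℕ)
    (σ : State) : Prop where
  zero : σ.reg rZ = 0
  prop : PropInv P σ.arr (σ.reg rQh) (σ.reg rQt) m N E V Z T F []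
  heads : HeadsTrue σ.arr m T
  enum : Enumerates (σ.arr aVarr) (σ.reg rN) (openCodes V F)
  sentinel : σ.arr aUs 0 = 0

/-- What one pass does, with the events it writes and the time of the call it contains. -/
structure PassSpec (P : Program) (V T F T' D : Finset ℕ) (o o' : List Event) (l : PassLog) :
    Prop where
  trueLM : trueLM P ↑F = ↑T'
  least : LeastClosed (atoms P \ ↑F) (restrict P ↑F ↑T') ↑D
  disjoint : ∀ a ∈ D, a ∉ F
  sub : D.card ≤ (openCodes V F).card
  emitted : T ⊆ T' ∧ l.trueAtoms.Nodup ∧ ∀ a, a ∈ l.trueAtoms ↔ a ∈ T' ∧ a ∉ T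
  reported : l.falseAtoms.Nodup ∧ ∀ a, a ∈ l.falseAtoms ↔ a ∈ D
  out : o' = o ++ l.events
  found : D.Nonempty → l.duration ≤ 2000 * (D.card * (openCodes V F).card)
  empty : D = ∅ → l.duration ≤ 2000 * ((openCodes V F).card ^ 2 + 1)

theorem openCodes_union (V F D : Finset ℕ) :
    (openCodes V F).filter (fun x => x - 1 ∉ F ∪ decode D) = openCodes V (F ∪ decode D) := by
  ext x
  simp only [openCodes, Finset.mem_filter, Finset.mem_union, not_or]
  tauto

/-- The marks enclose `findClosed`, `makeFalse` and `compactAtoms`, so all of these are charged to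
the call; outside remain the amortised propagation and a constant. -/
theorem wp_templatePass {σ : State} {P : Program} {m N E : ℕ} {V : Finset ℕ}
    {Z : Finset (ℕ × ℕ)} {T F : Finset ℕ} (hP : InLP1 P) (h : MainInv P m N E V Z T F σ) :
    wp templatePass (fun σ' => ∃ Z' T' D l, MainInv P m N E V Z' T' (F ∪ D) σ' ∧
      PassSpec P V T F T' D σ.out σ'.out l ∧
      (D.Nonempty → σ'.reg rMain = σ.reg rMain) ∧ (D = ∅ → σ'.reg rMain = 0) ∧
      σ'.time + 26 * Z.card + 6 * σ.reg rQh ≤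
        σ.time + 26 * Z'.card + 6 * σ'.reg rQh + l.duration + 4) σ := by
  rw [templatePass, wp_seq]
  refine wp_frame (wp_propagate h.zero h.prop h.heads) ?_
  rintro ⟨reg₁, A₁, o₁, t₁⟩ hf ⟨Z', T', g1, g2, g3, g4, g5⟩
  have fz := (hf.reg rZ (by decide)).trans h.zero
  have fN := hf.reg rN (by decide)
  have fM := hf.reg rMain (by decide)
  have fV := hf.arr aVarr (by decide)
  have fU := (congrFun (hf.arr aUs (by decide)) 0).trans h.sentinel
  clear hf
  dsimp only at *
  have g1' := g1
  rw [g4] at g1'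
  have hgraph := g1'.graph_valid
  simp only [exec_rules]
  refine wp_frame (wp_findClosed (G := remGraph A₁ V F) hgraph ⟨fz, ⟨rfl, rfl, fun _ => rfl⟩, ?_, ?_, fU⟩) ?_
  · dsimp only
    rw [fN, fV]
    exact h.enum
  · intro x hx
    exact g1.lists.seg x (Finset.mem_filter.mp hx).1
  rintro ⟨reg₂, A₂, o₂, t₂⟩ hf2 ⟨s1, D, s2, s3, s4⟩
  have fR2 : ∀ r ∈ [rQh, rQt, rMain], reg₂ r = reg₁ r := fun r hr =>
    hf2.reg r (by revert r; decide)
  have fA2 : ∀ k, k ∉ [aIdx, aPtr, aSt, aUs, aBs] → A₂ k = A₁ k := by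
    intro k hk
    apply hf2.arr k
    intro hk'
    exact hk ((by decide : ∀ k ∈ findClosed.arrs, k ∈ [aIdx, aPtr, aSt, aUs, aBs]) k hk')
  have fO2 : o₂ = o₁ ++ [Event.mark 0 t₁] := hf2.out (by decide)
  have fT2 : t₁ + 1 ≤ t₂ := hf2.time
  clear hf2
  dsimp only at s3 s4
  have hDz : 0 ∉ D := fun h0 => hgraph.zero (s2.closed.1 h0)
  have hleast := g1'.leastClosed hP s2
  rw [wp_seq]
  refine wp_frame (wp_makeFalse (σ := ⟨reg₂, A₂, o₂, t₂⟩) (V := V) (T := T') (F := F) (D := D)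
    s1.zero ?_ s2.image s2.inj ?_ ?_) ?_
  · dsimp only
    rw [fR2 rQt (by decide)]
    exact g1.queue.congr (fA2 1 (by decide)) (fA2 2 (by decide)) (fA2 aQa (by decide))
      (fA2 aQs (by decide))
  · exact s2.closed.1.trans (Finset.filter_subset _ _)
  · intro x hx
    obtain ⟨a, ha, e⟩ := g1'.mem_openCodes.mp (s2.closed.1 hx)
    exact ⟨a, e, ha.2⟩
  rintro ⟨reg₃, A₃, o₃, t₃⟩ hf3 ⟨u1, u2, u3, u4, u5⟩
  have fR3 : ∀ r ∈ [rQh, rMain, rZ, rN, rLo, rHi], reg₃ r = reg₂ r := fun r hr =>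
    hf3.reg r (by revert r; decide)
  have fA3 : ∀ k, k ∉ [2, aQa, aQs] → A₃ k = A₂ k := by
    intro k hk
    apply hf3.arr k
    intro hk'
    exact hk ((by decide : ∀ k ∈ makeFalse.arrs, k ∈ [2, aQa, aQs]) k hk')
  have fT3 : t₂ ≤ t₃ := hf3.time
  clear hf3
  dsimp only at u1 u2 u3 u4 u5
  rw [wp_seq]
  refine wp_frame (wp_compactAtoms (W := openCodes V F) (F := F ∪ decode D) ?_ ?_ u1.arrF) ?_
  · exact (fR3 rZ (by decide)).trans s1.zero
  · dsimp only
    rw [fA3 aVarr (by decide), fR3 rN (by decide)]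
    exact s1.enum
  rintro ⟨reg₄, A₄, o₄, t₄⟩ hf4 ⟨v1, v2⟩
  have fR4 : ∀ r ∈ [rQh, rQt, rMain, rZ, rLo, rHi], reg₄ r = reg₃ r := fun r hr =>
    hf4.reg r (by revert r; decide)
  have fA4 : ∀ k, k ≠ aVarr → A₄ k = A₃ k := by
    intro k hk
    apply hf4.arr k
    intro hk'
    exact hk ((by decide : ∀ k ∈ compactAtoms.arrs, k = aVarr) k hk')
  have fO4 : o₄ = o₃ := hf4.out (by decide)
  have fT4 : t₃ ≤ t₄ := hf4.time
  clear hf4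
  dsimp only at v1 v2
  rw [openCodes_union] at v1
  have hsub : D.card ≤ (openCodes V F).card := Finset.card_le_card s2.closed.1
  have hcardD : (decode D).card = D.card := decode_card hDz
  have hdisj : ∀ a ∈ decode D, a ∉ F := by
    intro a ha
    obtain ⟨b, hb, e⟩ := g1'.mem_openCodes.mp (s2.closed.1 ((decode_mem hDz).mp ha))
    obtain rfl : a = b := by omega
    exact hb.2
  have hlohi : (reg₄ rLo < reg₄ rHi ↔ D.Nonempty) := by
    rw [fR4 rLo (by decide), fR4 rHi (by decide), fR3 rLo (by decide), fR3 rHi (by decide),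
      s2.image, Finset.image_nonempty, Finset.nonempty_Ico]
  have hne : (decode D).Nonempty ↔ D.Nonempty := Finset.image_nonempty
  have hold : ∀ i < reg₁ rQt, A₄ aQa i = A₁ aQa i ∧ A₄ aQs i = A₁ aQs i := by
    intro i hi
    rw [fA4 aQa (by decide), fA4 aQs (by decide), ← fA2 aQa (by decide), ← fA2 aQs (by decide)]
    exact u3 i (by rw [fR2 rQt (by decide)]; exact hi)
  have hA14 : ∀ k, k ∉ [2, aQa, aQs, aVarr, aIdx, aPtr, aSt, aUs, aBs] → A₄ k = A₁ k := by
    intro k hk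
    simp only [List.mem_cons, List.not_mem_nil, or_false, not_or] at hk
    rw [fA4 k (by omega), fA3 k (by simp; omega), fA2 k (by simp; omega)]
  have hprop : PropInv P A₄ (reg₄ rQh) (reg₄ rQt) m N E V Z' T' (F ∪ decode D) [] := by
    rw [fR4 rQh (by decide), fR4 rQt (by decide), fR3 rQh (by decide), fR2 rQh (by decide)]
    refine g1.setFalse ?_ ?_ Finset.subset_union_left hA14 hold
    · exact u1.congr (fA4 1 (by decide)) (fA4 2 (by decide)) (fA4 aQa (by decide))
        (fA4 aQs (by decide))
    · rw [← fR2 rQt (by decide)]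
      exact u2
  have hheads : HeadsTrue A₄ m T' := by
    rw [HeadsTrue, hA14 aCnt (by decide), hA14 aHd (by decide)]
    exact g2
  have hus : A₄ aUs 0 = 0 := by
    rw [fA4 aUs (by decide), fA3 aUs (by decide)]
    exact s1.sentinel
  have hz4 : reg₄ rZ = 0 := by
    rw [fR4 rZ (by decide), fR3 rZ (by decide)]
    exact s1.zero
  obtain ⟨w0, l₁, w1, w2, w3⟩ := g3
  obtain ⟨x0, l₂, x1, x2, x3⟩ := u4
  obtain ⟨d, hd⟩ : ∃ d, t₄ = t₁ + d := Nat.exists_eq_add_of_le (by omega)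
  have hqh : reg₄ rQh = reg₁ rQh := by
    rw [fR4 rQh (by decide), fR3 rQh (by decide), fR2 rQh (by decide)]
  have hspec : PassSpec P V T F T' (decode D) σ.out (o₄ ++ [Event.mark 1 t₄])
      ⟨l₁, t₁, l₂, d⟩ := by
    refine ⟨g1'.trueLM_eq g2, hleast, hdisj, by omega, ⟨w0, w2, w3⟩, ⟨x2, fun a => ?_⟩, ?_, ?_, ?_⟩
    · rw [x3, Finset.mem_union]
      constructor
      · rintro ⟨h1 | h1, h2⟩
        · exact absurd h1 h2
        · exact h1
      · exact fun h1 => ⟨Or.inr h1, hdisj a h1⟩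
    · rw [fO4, x1, fO2, w1, hd]
      simp [PassLog.events]
    · intro hD
      have h1 := hne.mp hD
      have h2 := s3 h1
      have h3 := h1.card_pos
      -- Reporting `D` and compacting the list are linear; they are absorbed by the product, whose
      -- factors are positive.
      have h4 : D.card ≤ D.card * (openCodes V F).card := Nat.le_mul_of_pos_right _ (by omega)
      have h5 : (openCodes V F).card ≤ D.card * (openCodes V F).card :=
        Nat.le_mul_of_pos_left _ h3
      change t₂ ≤ t₁ + 1 + 1300 * (D.card * (openCodes V F).card) at h2
      rw [hcardD]
      dsimp only
      omega
    · intro hD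
      have h1 : D = ∅ := by
        rw [← Finset.not_nonempty_iff_eq_empty, ← hne, hD]
        simp
      have h2 := s4 h1
      change t₂ ≤ t₁ + 1 + 1800 * ((openCodes V F).card ^ 2 + 1) at h2
      have h3 : 2 * (openCodes V F).card ≤ (openCodes V F).card ^ 2 + 1 := by
        generalize (openCodes V F).card = c
        nlinarith [sq_nonneg ((c : ℤ) - 1), Nat.le_total c 1]
      have h4 : D.card = 0 := by rw [h1]; rfl
      dsimp only
      omega
  simp only [exec_rules]
  refine ⟨fun hc => ⟨Z', T', decode D, ⟨l₁, t₁, l₂, d⟩, ⟨hz4, hprop, hheads, v1, hus⟩, hspec,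
      ?_, ?_, ?_⟩,
    fun hc => ⟨Z', T', decode D, ⟨l₁, t₁, l₂, d⟩, ⟨hz4, hprop, hheads, v1, hus⟩, hspec,
      ?_, ?_, ?_⟩⟩ <;> try simp only [exec_rules, Nat.reduceEqDiff]
  · intro _
    rw [fR4 rMain (by decide), fR3 rMain (by decide), fR2 rMain (by decide), fM]
  · intro he
    rw [hlohi, ← hne, he] at hc
    simp at hc
  · omega
  · intro he
    exact absurd (hlohi.mpr (hne.mp he)) hc
  · intro _; trivial
  · omega

/-! ## The main loop -/

theorem Tables.ncard {P : Program} {A : ℕ → ℕ → ℕ} {m N : ℕ} {V : Finset ℕ}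
    (h : Tables P A m N V) (F : Finset ℕ) : (atoms P \ ↑F).ncard = (openCodes V F).card := by
  rw [← Set.ncard_coe_finset, ← Set.ncard_image_of_injective _ (add_left_injective 1)]
  congr 1
  ext x
  simp only [openCodes, Set.mem_image, Finset.coe_filter, Set.mem_ofPred_eq, h.codes]
  constructor
  · rintro ⟨a, ⟨h1, h2⟩, rfl⟩
    exact ⟨⟨a, h1, rfl⟩, h2⟩
  · rintro ⟨⟨a, h1, rfl⟩, h2⟩
    exact ⟨a, ⟨h1, h2⟩, rfl⟩

/-- `T₀` and `o₀` belong to the end of the previous pass. They differ from `T` and `o` in the first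
pass only, where the atoms reported by `initFacts` before the loop have to be joined to the log. -/
theorem PassSpec.log {P : Program} {A : ℕ → ℕ → ℕ} {m N : ℕ} {V T₀ T F T' D : Finset ℕ}
    {o₀ o o' : List Event} {l : PassLog} (h : PassSpec P V T F T' D o o' l)
    (htab : Tables P A m N V) (ho : Emitted 0 o₀ o T₀ T) :
    ∃ l' : PassLog, l'.Reports ⟨↑F, WFS.trueLM P ↑F \ ↑T₀, ↑D⟩ ∧
      l'.CallBound P 4000 ⟨↑F, WFS.trueLM P ↑F \ ↑T₀, ↑D⟩ ∧ o' = o₀ ++ l'.events ∧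
      l'.duration = l.duration := by
  have em : Emitted 0 o (o ++ l.trueAtoms.map (Event.value 0)) T T' :=
    ⟨h.emitted.1, _, rfl, h.emitted.2⟩
  obtain ⟨-, L, h1, h2, h3⟩ := ho.trans em
  refine ⟨⟨L, l.callTime, l.falseAtoms, l.duration⟩, ⟨h2, ?_, h.reported.1, ?_⟩, ⟨?_, ?_⟩, ?_, rfl⟩
  · ext a
    rw [h.trueLM]
    exact h3 a
  · ext a
    exact h.reported.2 a
  · intro hD
    have := h.found (Finset.nonempty_iff_ne_empty.mpr (by simpa using hD))
    simp only [Set.ncard_coe_finset, htab.ncard]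
    omega
  · intro hD
    have := h.empty (by simpa using hD)
    simp only [htab.ncard]
    omega
  · rw [h.out, PassLog.events, PassLog.events, ← List.append_assoc, h1, List.append_assoc]

/-- Induction on the number `n` of atoms not yet false. All passes but the last falsify an atom, so
there are at most `n + 1` of them, with 5 steps each beside the amortised propagation and the calls.
-/
theorem wp_mainLoop {P : Program} {m N E : ℕ} {V : Finset ℕ} (hP : InLP1 P) (n : ℕ)
    {σ : State} {Z : Finset (ℕ × ℕ)} {T F T₀ : Finset ℕ} {o₀ : List Event}
    (h : MainInv P m N E V Z T F σ) (hmain : σ.reg rMain = 1) (ho : Emitted 0 o₀ σ.out T₀ T)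
    (hn : (openCodes V F).card = n) :
    wp (Code.loop (Cond.lt rZ rMain) templatePass) (fun σ' => ∃ passes logs,
      ∃ T' F' : Finset ℕ,
      Template P (fun F Q D => LeastClosed (atoms P \ F) Q D) ↑T₀ ↑F passes ↑T' ↑F' ∧
      List.Forall₂ PassLog.Reports logs passes ∧
      List.Forall₂ (PassLog.CallBound P 4000) logs passes ∧
      σ'.out = o₀ ++ logs.flatMap PassLog.events ∧
      σ'.arr 1 = Set.indicator ↑T' 1 ∧ σ'.arr 2 = Set.indicator ↑F' 1 ∧
      σ'.time + 26 * Z.card + 6 * σ.reg rQh ≤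
        σ.time + (logs.map PassLog.duration).sum + 52 * N + 12 * V.card + 5 * n + 6 ∧
      (logs.map PassLog.duration).sum ≤ 2000 * (2 * n ^ 2 + 1)) σ := by
  induction n using Nat.strong_induction_on generalizing σ Z T F T₀ o₀ with
  | _ n ih =>
  have hz := h.zero
  refine wp_loop_step (fun _ => ?_) (fun hb => ?_)
  swap
  · have hb' : ¬ σ.reg rZ < σ.reg rMain := hb
    omega
  refine wp_mono (wp_templatePass (σ := σ.tick) hP
    ⟨h.zero, h.prop, h.heads, h.enum, h.sentinel⟩) ?_
  rintro σ₁ ⟨Z', T', D, l, h1, h2, h3, h4, h5⟩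
  have ht : σ.tick.time = σ.time + 1 := rfl
  have hr : σ.tick.reg = σ.reg := rfl
  rw [ht, hr] at h5
  rw [hr] at h3
  obtain ⟨l', k1, k2, k3, k4⟩ := h2.log h.prop.tab ho
  have hle := h2.least
  rw [← h2.trueLM] at hle
  by_cases hD : D = ∅
  · have hm := h4 hD
    refine wp_loop_step (fun hb => ?_) (fun _ => ?_)
    · have hb' : σ₁.reg rZ < σ₁.reg rMain := hb
      omega
    refine ⟨_, [l'], T', F ∪ D, ?_, List.Forall₂.cons k1 .nil, List.Forall₂.cons k2 .nil, ?_, ?_,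
      h1.prop.queue.arrF, ?_, ?_⟩
    · have := Template.last (T := (↑T₀ : Set ℕ))
        (Δ := fun F Q D => LeastClosed (atoms P \ F) Q D) hle (by simp [hD])
      rw [← h2.trueLM, Finset.coe_union]
      exact this
    · change σ₁.out = _
      rw [k3]
      simp
    · exact h1.prop.queue.arrT
    · change σ₁.time + 1 + _ + _ ≤ _
      simp only [List.map_cons, List.map_nil, List.sum_cons, List.sum_nil, k4]
      have := h1.prop.card_le
      have := h1.prop.le
      have := h1.prop.queue.le
      omega
    · simp only [List.map_cons, List.map_nil, List.sum_cons, List.sum_nil, k4]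
      have := h2.empty hD
      rw [hn] at this
      have : n ^ 2 ≤ 2 * n ^ 2 := by omega
      omega
  · have hne := Finset.nonempty_iff_ne_empty.mpr hD
    have hpos := hne.card_pos
    have hfound := h2.found hne
    have hsub := h2.sub
    rw [hn] at hfound hsub
    have hcard : (openCodes V (F ∪ D)).card = n - D.card := by
      rw [← h.prop.tab.ncard, Finset.coe_union, show atoms P \ ((↑F : Set ℕ) ∪ ↑D) =
        (atoms P \ ↑F) \ ↑D from sdiff_sdiff_left.symm, Set.ncard_sdiff h2.least.1.1, h.prop.tab.ncard, Set.ncard_coe_finset, hn]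
    refine wp_mono (ih (n - D.card) (by omega) h1 ((h3 hne).trans hmain)
      (Emitted.refl 0 σ₁.out T') hcard) ?_
    rintro σ₂ ⟨passes, logs, T₂, F₂, g1, g2, g3, g4, g5, g6, g7, g8⟩
    refine ⟨_, l' :: logs, T₂, F₂, ?_, List.Forall₂.cons k1 g2, List.Forall₂.cons k2 g3, ?_, g5,
      g6, ?_, ?_⟩
    · refine Template.more (T := (↑T₀ : Set ℕ))
        (Δ := fun F Q D => LeastClosed (atoms P \ F) Q D) hle ?_ ?_
      · intro e
        obtain ⟨a, ha⟩ := hne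
        have : a ∈ (↑F ∪ ↑D : Set ℕ) := Or.inr ha
        rw [e] at this
        exact h2.disjoint a ha this
      · rw [h2.trueLM, ← Finset.coe_union]
        exact g1
    · rw [g4, k3]
      simp
    · simp only [List.map_cons, List.sum_cons, k4]
      omega
    · simp only [List.map_cons, List.sum_cons, k4]
      -- With `d = D.card` and `n = c + d` the sum closes by `d * n + 2 * c ^ 2 ≤ 2 * n ^ 2`.
      obtain ⟨c, hc⟩ : ∃ c, n = c + D.card := ⟨n - D.card, by omega⟩
      rw [hc] at hfound
      rw [hc, Nat.add_sub_cancel] at g8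
      rw [hc]
      nlinarith

theorem Tables.card_le {P : Program} {A : ℕ → ℕ → ℕ} {m N : ℕ} {V : Finset ℕ}
    (h : Tables P A m N V) : V.card ≤ WFS.size P := by
  have hsub : V ⊆ (Finset.Icc 1 m).image (A aHd) ∪ (Finset.Icc 1 N).image (A aAtm) := by
    intro x hx
    obtain ⟨a, ⟨ρ, hρ, ha⟩, rfl⟩ := (h.codes x).mp hx
    obtain ⟨r, h1, h2, hrep⟩ := h.exists_num ρ hρ
    simp only [Finset.mem_union, Finset.mem_image, Finset.mem_Icc]
    rcases ha with rfl | ha | ha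
    · exact Or.inl ⟨r, ⟨h1, h2⟩, hrep.head⟩
    · obtain ⟨o, g1, g2, -, -, g3⟩ := (hrep.pos a).mp ha
      exact Or.inr ⟨o, ⟨g1, g2⟩, g3⟩
    · obtain ⟨o, g1, g2, -, -, g3⟩ := (hrep.neg a).mp ha
      exact Or.inr ⟨o, ⟨g1, g2⟩, g3⟩
  have h1 := Finset.card_le_card hsub
  have h2 := Finset.card_union_le ((Finset.Icc 1 m).image (A aHd)) ((Finset.Icc 1 N).image (A aAtm))
  have h3 := Finset.card_image_le (s := Finset.Icc 1 m) (f := A aHd)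
  have h4 := Finset.card_image_le (s := Finset.Icc 1 N) (f := A aAtm)
  rw [Nat.card_Icc] at h3 h4
  have := h.size
  omega

theorem wp_setup (P : Program) :
    wp (readProgram ;; buildLists ;; initFacts ;; cst rMain 1) (fun σ => ∃ m N E V T,
      MainInv P m N E V ∅ T ∅ σ ∧ σ.reg rMain = 1 ∧ Emitted 0 [] σ.out ∅ T ∧
      σ.time ≤ 8 + 75 * size P) (startState P) := by
  rw [wp_seq]
  refine wp_frame (wp_readProgram P) ?_
  rintro σ₁ hf ⟨h1, h2⟩
  obtain ⟨V, tab, enum, heads⟩ := h1.tables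
  have hmap := h1.parse.hmap
  rw [List.length_map, h1.len] at hmap
  have hcnt := h1.parse.cnt
  have hpos : ∀ x ∈ V, 0 < x := by
    intro x hx
    obtain ⟨a, -, rfl⟩ := (tab.codes x).mp hx
    omega
  have hreg : ∀ r ∈ [rZ, rE, rQh, rQt], σ₁.reg r = 0 := fun r hr =>
    hf.reg r (by revert r; decide)
  have harr : ∀ k, k ∉ [0, aHd, aTl, aCnt, aRule, aSgn, aAtm, aOnext, aOfst, aHfst, aHnext, aSeen,
      aVarr] → ∀ i, σ₁.arr k i = 0 := by
    intro k hk i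
    rw [hf.arr k (fun hk' => hk ((by decide : ∀ k ∈ readProgram.arrs, k ∈ [0, aHd, aTl, aCnt,
      aRule, aSgn, aAtm, aOnext, aOfst, aHfst, aHnext, aSeen, aVarr]) k hk'))]
    have : k ≠ 0 := by
      rintro rfl
      simp at hk
    simp [startState, this]
  have hout : σ₁.out = [] := hf.out (by decide)
  clear hf
  rw [wp_seq]
  refine wp_frame (wp_buildLists (m := σ₁.reg rM) (V := V) (hreg rZ (by decide))
    (hreg rE (by decide)) ?_ enum hpos heads hmap) ?_
  · intro k hk i
    apply harr
    simp only [List.mem_cons, List.not_mem_nil, or_false, not_or]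
    omega
  rintro σ₂ hf ⟨h3, h4⟩
  have hreg2 : ∀ r ∈ [rZ, rM, rN, rQh, rQt], σ₂.reg r = σ₁.reg r := fun r hr =>
    hf.reg r (by revert r; decide)
  have harr2 : ∀ k, k ∉ [aMark, aSlot, aEtl, aOwn, aEnt, aLoc, aEnd, aDeg, aEof, aGcnt, aStart] →
      σ₂.arr k = σ₁.arr k := fun k hk => hf.arr k fun hk' =>
    hk ((by decide : ∀ k ∈ buildLists.arrs, k ∈ [aMark, aSlot, aEtl, aOwn, aEnt, aLoc, aEnd, aDeg,
      aEof, aGcnt, aStart]) k hk')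
  have hout2 : σ₂.out = σ₁.out := hf.out (by decide)
  clear hf
  have htab : Tables P σ₂.arr (σ₁.reg rM) (σ₁.reg rO) V := by
    refine tab.congr fun k hk => harr2 k ?_
    revert k
    decide
  have hdead : ∀ r, σ₂.arr aDead r = 0 := by
    intro r
    rw [harr2 aDead (by decide)]
    exact harr aDead (by decide) r
  have hprop : PropInv P σ₂.arr 0 (σ₂.reg rQt) (σ₁.reg rM) (σ₁.reg rO) (σ₂.reg rE) V ∅ ∅ ∅ [] := by
    refine ⟨htab, ⟨?_, ?_, ?_, ?_, ?_, by simp, by simp⟩, Nat.zero_le _, by simp, ?_, ?_, ?_,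
      by simp⟩
    · rw [harr2 1 (by decide)]
      funext i
      simpa using harr 1 (by decide) i
    · rw [harr2 2 (by decide)]
      funext i
      simpa using harr 2 (by decide) i
    · rw [hreg2 rQt (by decide), hreg rQt (by decide)]
      rfl
    · rw [hreg2 rQt (by decide), hreg rQt (by decide)]
      omega
    · rw [hreg2 rQt (by decide), hreg rQt (by decide)]
      simp
    · intro r _ _
      rw [harr2 aCnt (by decide), harr2 aRule (by decide), hcnt]
      simp
    · intro r _ _
      simp [hdead]
    · have : aliveRules σ₂.arr (σ₁.reg rM) = Finset.Icc 1 (σ₁.reg rM) := by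
        rw [aliveRules, Finset.filter_true_of_mem]
        intro r _
        exact hdead r
      rw [this]
      exact h3
  rw [wp_seq]
  refine wp_frame (wp_initFacts (m := σ₁.reg rM) ?_ (hreg2 rM (by decide)) hprop) ?_
  · rw [hreg2 rZ (by decide), hreg rZ (by decide)]
  rintro ⟨reg₃, A₃, o₃, t₃⟩ hf ⟨T, h5, h6, h7, h8⟩
  have hreg3 : ∀ r ∈ [rZ, rN, rQh], reg₃ r = σ₁.reg r := fun r hr =>
    (hf.reg r (by revert r; decide)).trans (hreg2 r (by revert r; decide))
  have harr3 : ∀ k ∈ [aVarr, aUs], A₃ k = σ₁.arr k := fun k hk =>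
    (hf.arr k (by revert k; decide)).trans (harr2 k (by revert k; decide))
  clear hf
  dsimp only at *
  simp only [exec_rules]
  refine ⟨σ₁.reg rM, σ₁.reg rO, σ₂.reg rE, V, T, ⟨?_, ?_, h6, ?_, ?_⟩, ?_, ?_, ?_⟩ <;>
    try simp only [exec_rules, Nat.reduceEqDiff]
  · rw [hreg3 rZ (by decide), hreg rZ (by decide)]
  · rw [hreg3 rQh (by decide), hreg rQh (by decide)]
    exact h5
  · rw [harr3 aVarr (by decide), hreg3 rN (by decide)]
    simpa [openCodes] using enum
  · rw [harr3 aUs (by decide)]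
    exact harr aUs (by decide) 0
  · rw [← hout, ← hout2]
    exact h7
  · have := tab.card_le
    have := enum.card
    have := tab.size
    omega

theorem wfsMachine_correct {P : Program} (hP : InLP1 P) :
    ∃ σ passes logs T F, RunsTemplate wfsMachine P σ passes logs T F ∧
      IsWellFounded P T F ∧
      σ.time ≤ 5000 * ((atoms P).ncard ^ 2 + size P + 1) ∧
      List.Forall₂ (PassLog.CallBound P 5000) logs passes ∧
      σ.time ≤ 5000 * (size P + 1) + (logs.map PassLog.duration).sum := by
  have hwp : wp wfsMachine (fun σ => ∃ passes logs, ∃ T F : Finset ℕ,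
      Template P (fun F Q D => LeastClosed (atoms P \ F) Q D) ∅ ∅ passes ↑T ↑F ∧
      List.Forall₂ PassLog.Reports logs passes ∧
      List.Forall₂ (PassLog.CallBound P 4000) logs passes ∧
      σ.out = logs.flatMap PassLog.events ∧
      σ.arr 1 = Set.indicator ↑T 1 ∧ σ.arr 2 = Set.indicator ↑F 1 ∧
      -- The slack of 3000 takes up the additive 2000 of the bound on all calls, so that one
      -- constant serves for the total time too.
      σ.time ≤ 5000 * (size P + 1) + (logs.map PassLog.duration).sum - 3000 ∧
      (logs.map PassLog.duration).sum ≤ 2000 * (2 * (atoms P).ncard ^ 2 + 1)) (startState P) := by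
    have hsetup := wp_setup P
    rw [wp_seq] at hsetup
    rw [wfsMachine, wp_seq]
    refine wp_mono hsetup fun σ₁ h1 => ?_
    rw [wp_seq] at h1 ⊢
    refine wp_mono h1 fun σ₂ h2 => ?_
    rw [wp_seq] at h2 ⊢
    refine wp_mono h2 fun σ₃ h3 => ?_
    rw [wp_seq]
    refine wp_mono h3 ?_
    rintro σ ⟨m, N, E, V, T, h4, h5, h6, h7⟩
    refine wp_mono (wp_mainLoop hP _ h4 h5 h6 rfl) ?_
    rintro σ' ⟨passes, logs, T', F', g1, g2, g3, g4, g5, g6, g7, g8⟩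
    have hn := h4.prop.tab.ncard ∅
    have hle := h4.prop.tab.card_le
    have hsz := h4.prop.tab.size
    have hc : (openCodes V ∅).card = V.card := by simp [openCodes]
    simp only [Finset.coe_empty, Set.sdiff_empty] at g1 hn
    rw [← hn] at g8
    rw [hc] at g7
    refine ⟨passes, logs, T', F', g1, g2, g3, by simpa using g4, g5, g6, ?_, g8⟩
    omega
  obtain ⟨σ, hex, passes, logs, T, F, h1, h2, h3, h4, h5, h6, h7, h8⟩ := hwp
  -- Here the smallest closed sets that the machine computes become values of `false`.
  refine ⟨σ, passes, logs, ↑T, ↑F, ⟨hex, h1.mono fun _ _ h => h.falseOp, h2, h4, h5, h6⟩,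
    h1.wellFounded (leastClosed_admissible hP) (TemplateInv.empty P), by omega, ?_, by omega⟩
  refine h3.imp fun l p h => ⟨fun hD => (h.1 hD).trans ?_, fun hD => (h.2 hD).trans ?_⟩ <;>
    exact Nat.mul_le_mul_right _ (by omega)

end WFS

theorem mainTheorem3 :
    -- every instance of the template with an admissible operator is correct
    (∀ (P : WFS.Program) (Δ : Set ℕ → Set (WFS.HornRule ℕ) → Set ℕ), WFS.Admissible P Δ →
      (∃ passes T F, WFS.Template P (fun F Q D => D = Δ F Q) ∅ ∅ passes T F) ∧
      ∀ passes T F, WFS.Template P (fun F Q D => D = Δ F Q) ∅ ∅ passes T F →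
        WFS.IsWellFounded P T F) ∧
    -- the instance given by the procedure for false atoms has an implementation
    ∃ (code : WFS.Code) (C : ℕ), ∀ P : WFS.Program, WFS.InLP1 P →
      ∃ σ passes logs T F, WFS.RunsTemplate code P σ passes logs T F ∧
        WFS.IsWellFounded P T F ∧
        -- total time
        σ.time ≤ C * ((WFS.atoms P).ncard ^ 2 + WFS.size P + 1) ∧
        -- time of each call
        List.Forall₂ (WFS.PassLog.CallBound P C) logs passes ∧
        -- time outside the calls
        σ.time ≤ C * (WFS.size P + 1) + (logs.map WFS.PassLog.duration).sum :=
  ⟨WFS.template_correct, WFS.wfsMachine, 5000, fun _ hP => WFS.wfsMachine_correct hP⟩
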